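/- Fourier conventions: for $\phi\in\mathcal S(\mathbb R)$ put $\hat\phi(\omega)=\mathcal F\phi(\omega)=\frac1{\sqrt{2\pi}}\int_{-\infty}^\infty\phi(t)e^{-i\omega t}\,dt$, and write $(\phi\otimes\psi)(t,x)=\phi(t)\psi(x)$. An attenuation coefficient is a smooth function $\kappa:\mathbb R\to\overline{\mathbb H}$, not identically zero, with values in the closed upper half plane $\overline{\mathbb H}=\{z\in\mathbb C:\operatorname{Im}z\ge0\}$, such that (i) every derivative $\kappa^{(\ell)}$, $\ell\ge0$, is polynomially bounded; (ii) there is a continuous function $\tilde\kappa:\overline{\mathbb H}\to\overline{\mathbb H}$ with $\tilde\kappa|_{\mathbb R}=\kappa$ that is holomorphic in $\{\operatorname{Im}z>0\}$ and satisfies $|\tilde\kappa(z)|\le C(1+|z|)^N$ on $\overline{\mathbb H}$ for some constants $C>0$, $N\in\mathbb N$; (iii) $\kappa(-\omega)=-\overline{\kappa(\omega)}$ for all $\omega\in\mathbb R$. The attenuation operator $\mathcal A_\kappa:\mathcal S'(\mathbb R\times\mathbb R^3)\to\mathcal S'(\mathbb R\times\mathbb R^3)$ is determined by $\langle\mathcal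 A_\kappa u,\phi\otimes\psi\rangle=-\langle u,(\mathcal F^{-1}\kappa^2\mathcal F\phi)\otimes\psi\rangle$, and the (spatial) Laplace operator on $\mathcal S'(\mathbb R\times\mathbb R^3)$ by $\langle\Delta u,\phi\otimes\psi\rangle=\langle u,\phi\otimes\Delta\psi\rangle$, for all $\phi\in\mathcal S(\mathbb R)$, $\psi\in\mathcal S(\mathbb R^3)$. **Proposition.** Let $\kappa$ be an attenuation coefficient and let $h\in L^2(\mathbb R^3)$ (complex-valued) have compact essential support. Then the attenuated wave equation $\mathcal A_\kappa p-\Delta p=\delta'(t)h(x)$, that is, $$\langle\mathcal A_\kappa p,\vartheta\rangle-\langle\Delta p,\vartheta\rangle=-\int_{\mathbb R^3}h(x)\,\partial_t\vartheta(0,x)\,dx\quad\text{for all }\vartheta\in\mathcal S(\mathbb R\times\mathbb R^3),$$ has a unique solution $p\in\mathcal S'(\mathbb R\times\mathbb R^3)$ with $\operatorname{supp}p\subset[0,\infty)\times\mathbb R^3$. Moreover, for all $\phi\in\mathcal S(\mathbb R)$ and $\psi\in\mathcal S(\mathbb R^3)$, $$\langle p,\phi\otimes\psi\rangle=\int_{-\infty}^\infty\int_{\mathbb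 R^3}\int_{\mathbb R^3}G_\kappa(\omega,x-y)h(y)\,dy\;\hat\phi(\omega)\psi(x)\,dx\,d\omega,$$ where $$G_\kappa(\omega,x)=-\frac{i\omega}{4\pi\sqrt{2\pi}}\,\frac{e^{i\kappa(\omega)|x|}}{|x|},\qquad\omega\in\mathbb R,\ x\in\mathbb R^3\setminus\{0\},$$ and the function $(\omega,x,y)\mapsto G_\kappa(\omega,x-y)h(y)\hat\phi(\omega)\psi(x)$ is integrable on $\mathbb R\times\mathbb R^3\times\mathbb R^3$. -/

import Mathlib

open MeasureTheory SchwartzMap LineDeriv FourierTransform Laplacian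

noncomputable section

namespace AttWave

/-- Physical space `ℝ³`. -/
abbrev Space : Type := EuclideanSpace ℝ (Fin 3)

/-- Space-time `ℝ × ℝ³`, with its Euclidean structure. -/
abbrev SpaceTime : Type := WithLp 2 (ℝ × Space)

/-- The point `(t, x)` of space-time. -/
def event (t : ℝ) (x : Space) : SpaceTime := WithLp.toLp 2 (t, x)

/-! ### Attenuation coefficients -/

/-- `κt` is a holomorphic continuation of `κ` to the closed upper half plane: it is continuous on
the closed half plane with values in the closed half plane, agrees with `κ` on the real axis, is
holomorphic on the open half plane, and is polynomially bounded. -/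
structure IsHolomorphicContinuation (κ : ℝ → ℂ) (κt : ℂ → ℂ) : Prop where
  continuousOn : ContinuousOn κt {z : ℂ | 0 ≤ z.im}
  im_nonneg : ∀ z : ℂ, 0 ≤ z.im → 0 ≤ (κt z).im
  eq_on_real : ∀ ω : ℝ, κt (ω : ℂ) = κ ω
  differentiableOn : DifferentiableOn ℂ κt {z : ℂ | 0 < z.im}
  poly_bound : ∃ C : ℝ, 0 < C ∧ ∃ N : ℕ, ∀ z : ℂ, 0 ≤ z.im → ‖κt z‖ ≤ C * (1 + ‖z‖) ^ N

/-- Attenuation coefficients: smooth functions `κ : ℝ → ℂ`, not identically zero, with values in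
the closed upper half plane, all of whose derivatives are polynomially bounded, which have a
polynomially bounded holomorphic continuation to the upper half plane (with values in the closed
upper half plane), and which satisfy `κ(-ω) = -conj (κ(ω))`. -/
structure IsAttenuationCoefficient (κ : ℝ → ℂ) : Prop where
  ne_zero : κ ≠ 0
  smooth : ContDiff ℝ (⊤ : ℕ∞) κ
  im_nonneg : ∀ ω : ℝ, 0 ≤ (κ ω).im
  deriv_bound : ∀ l : ℕ, ∃ C : ℝ, 0 < C ∧ ∃ N : ℕ, ∀ ω : ℝ,
    ‖iteratedDeriv l κ ω‖ ≤ C * (1 + |ω|) ^ N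
  holomorphic : ∃ κt : ℂ → ℂ, IsHolomorphicContinuation κ κt
  symm : ∀ ω : ℝ, κ (-ω) = -(starRingEnd ℂ) (κ ω)

theorem IsAttenuationCoefficient.hasTemperateGrowth {κ : ℝ → ℂ} (h : IsAttenuationCoefficient κ) :
    κ.HasTemperateGrowth := by
  refine ⟨h.smooth, fun n => ?_⟩
  obtain ⟨C, -, N, hb⟩ := h.deriv_bound n
  refine ⟨N, C, fun x => ?_⟩
  rw [norm_iteratedFDeriv_eq_norm_iteratedDeriv]
  exact hb x

/-! ### Tensor products of Schwartz functions -/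

/-- The tensor product `(φ ⊗ ψ)(t, x) = φ(t) ψ(x)`. -/
def tensor (φ : 𝓢(ℝ, ℂ)) (ψ : 𝓢(Space, ℂ)) : 𝓢(SpaceTime, ℂ) where
  toFun z := φ z.fst * ψ z.snd
  smooth' := by
    have h1 : ContDiff ℝ (⊤ : ℕ∞) (fun z : SpaceTime => φ z.fst) :=
      (φ.smooth ⊤).comp (WithLp.fstL 2 ℝ ℝ Space).contDiff
    have h2 : ContDiff ℝ (⊤ : ℕ∞) (fun z : SpaceTime => ψ z.snd) :=
      (ψ.smooth ⊤).comp (WithLp.sndL 2 ℝ ℝ Space).contDiff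
    exact h1.mul h2
  decay' := by
    intro k n
    have h1 : ContDiff ℝ (⊤ : ℕ∞) (fun z : SpaceTime => φ z.fst) :=
      (φ.smooth ⊤).comp (WithLp.fstL 2 ℝ ℝ Space).contDiff
    have h2 : ContDiff ℝ (⊤ : ℕ∞) (fun z : SpaceTime => ψ z.snd) :=
      (ψ.smooth ⊤).comp (WithLp.sndL 2 ℝ ℝ Space).contDiff
    have n1 : ‖WithLp.fstL 2 ℝ ℝ Space‖ ≤ 1 :=
      ContinuousLinearMap.opNorm_le_bound _ zero_le_one fun z => by
        simpa using WithLp.norm_fst_le (p := 2) (x := z)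
    have n2 : ‖WithLp.sndL 2 ℝ ℝ Space‖ ≤ 1 :=
      ContinuousLinearMap.opNorm_le_bound _ zero_le_one fun z => by
        simpa using WithLp.norm_snd_le (p := 2) (x := z)
    have b1 : ∀ (i : ℕ) (z : SpaceTime), ‖iteratedFDeriv ℝ i (fun z : SpaceTime => φ z.fst) z‖
        ≤ ‖iteratedFDeriv ℝ i φ z.fst‖ := by
      intro i z
      have := (WithLp.fstL 2 ℝ ℝ Space).iteratedFDeriv_comp_right (φ.smooth ⊤) z
        (i := i) (by exact_mod_cast le_top)
      have e : (φ ∘ (WithLp.fstL 2 ℝ ℝ Space)) = (fun z : SpaceTime => φ z.fst) := rfl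
      rw [e] at this
      rw [this]
      refine (ContinuousMultilinearMap.norm_compContinuousLinearMap_le _ _).trans ?_
      refine mul_le_of_le_one_right (norm_nonneg _) ?_
      simpa using pow_le_one₀ (norm_nonneg _) n1
    have b2 : ∀ (i : ℕ) (z : SpaceTime), ‖iteratedFDeriv ℝ i (fun z : SpaceTime => ψ z.snd) z‖
        ≤ ‖iteratedFDeriv ℝ i ψ z.snd‖ := by
      intro i z
      have := (WithLp.sndL 2 ℝ ℝ Space).iteratedFDeriv_comp_right (ψ.smooth ⊤) z
        (i := i) (by exact_mod_cast le_top)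
      have e : (ψ ∘ (WithLp.sndL 2 ℝ ℝ Space)) = (fun z : SpaceTime => ψ z.snd) := rfl
      rw [e] at this
      rw [this]
      refine (ContinuousMultilinearMap.norm_compContinuousLinearMap_le _ _).trans ?_
      refine mul_le_of_le_one_right (norm_nonneg _) ?_
      simpa using pow_le_one₀ (norm_nonneg _) n2
    set A : ℝ := 2 ^ k * (Finset.Iic (k, n)).sup (fun m => SchwartzMap.seminorm ℝ m.1 m.2) φ
    set B : ℝ := 2 ^ k * (Finset.Iic (k, n)).sup (fun m => SchwartzMap.seminorm ℝ m.1 m.2) ψ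
    refine ⟨∑ i ∈ Finset.range (n + 1), (n.choose i : ℝ) * (A * B), fun z => ?_⟩
    have hz : ‖z‖ ≤ (1 + ‖z.fst‖) * (1 + ‖z.snd‖) := by
      have : ‖z‖ ≤ ‖z.fst‖ + ‖z.snd‖ := by
        rw [WithLp.prod_norm_eq_of_L2]
        refine Real.sqrt_le_iff.2 ⟨by positivity, ?_⟩
        nlinarith [norm_nonneg z.fst, norm_nonneg z.snd,
          mul_nonneg (norm_nonneg z.fst) (norm_nonneg z.snd)]
      nlinarith [norm_nonneg z.fst, norm_nonneg z.snd,
        mul_nonneg (norm_nonneg z.fst) (norm_nonneg z.snd)]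
    have hz' : ‖z‖ ^ k ≤ (1 + ‖z.fst‖) ^ k * (1 + ‖z.snd‖) ^ k := by
      rw [← mul_pow]
      exact pow_le_pow_left₀ (norm_nonneg _) hz k
    have hm := norm_iteratedFDeriv_mul_le (𝕜 := ℝ) (N := ((⊤ : ℕ∞) : WithTop ℕ∞)) h1 h2 z (n := n)
      (by exact_mod_cast le_top)
    refine (mul_le_mul hz' hm (norm_nonneg _) (by positivity)).trans ?_
    rw [Finset.mul_sum]
    refine Finset.sum_le_sum fun i hi => ?_
    have hi' : i ≤ n := by
      have := Finset.mem_range.1 hi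
      omega
    have a1 : (1 + ‖z.fst‖) ^ k * ‖iteratedFDeriv ℝ i φ z.fst‖ ≤ A :=
      SchwartzMap.one_add_le_sup_seminorm_apply (𝕜 := ℝ) (m := (k, n)) le_rfl hi' φ z.fst
    have a2 : (1 + ‖z.snd‖) ^ k * ‖iteratedFDeriv ℝ (n - i) ψ z.snd‖ ≤ B :=
      SchwartzMap.one_add_le_sup_seminorm_apply (𝕜 := ℝ) (m := (k, n)) le_rfl (Nat.sub_le n i)
        ψ z.snd
    have a1' : (1 + ‖z.fst‖) ^ k * ‖iteratedFDeriv ℝ i (fun z : SpaceTime => φ z.fst) z‖ ≤ A :=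
      (mul_le_mul_of_nonneg_left (b1 i z) (by positivity)).trans a1
    have a2' : (1 + ‖z.snd‖) ^ k * ‖iteratedFDeriv ℝ (n - i) (fun z : SpaceTime => ψ z.snd) z‖
        ≤ B :=
      (mul_le_mul_of_nonneg_left (b2 (n - i) z) (by positivity)).trans a2
    calc _ = (n.choose i : ℝ) *
          (((1 + ‖z.fst‖) ^ k * ‖iteratedFDeriv ℝ i (fun z : SpaceTime => φ z.fst) z‖) *
          ((1 + ‖z.snd‖) ^ k *
            ‖iteratedFDeriv ℝ (n - i) (fun z : SpaceTime => ψ z.snd) z‖)) := by ring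
      _ ≤ _ := by
        refine mul_le_mul_of_nonneg_left ?_ (by positivity)
        exact mul_le_mul a1' a2' (by positivity) (le_trans (by positivity) a1')

@[simp]
theorem tensor_apply (φ : 𝓢(ℝ, ℂ)) (ψ : 𝓢(Space, ℂ)) (z : SpaceTime) :
    tensor φ ψ z = φ z.fst * ψ z.snd := rfl

/-! ### The attenuation operator -/

/-- The temporal Fourier transform `φ̂(ω) = (2π)^{-1/2} ∫ φ(t) e^{-iωt} dt`. -/
def timeFourier (φ : 𝓢(ℝ, ℂ)) (ω : ℝ) : ℂ :=
  (1 / Real.sqrt (2 * Real.pi) : ℝ) * ∫ t : ℝ, φ t * Complex.exp (-(Complex.I * ω * t))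

/-- The operator `ϑ ↦ F⁻¹ κ² F ϑ` on Schwartz functions on space-time, where `F` is the Fourier
transform with respect to time. Because `κ²` does not depend on the spatial frequencies, `F` may be
taken as the full space-time Fourier transform. The factor `2π` translates between the
angular frequency `ω` and Mathlib's convention `e^{-2πi⟨·,·⟩}`. -/
def attenuationTest (κ : ℝ → ℂ) : 𝓢(SpaceTime, ℂ) →L[ℂ] 𝓢(SpaceTime, ℂ) :=
  SchwartzMap.fourierMultiplierCLM ℂ (fun ξ : SpaceTime => κ (2 * Real.pi * ξ.fst) ^ 2)

/-- The attenuation operator `A_κ` on tempered distributions, the transpose of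
`ϑ ↦ -F⁻¹ κ² F ϑ`. -/
def attenuationOp (κ : ℝ → ℂ) : 𝓢'(SpaceTime, ℂ) →L[ℂ] 𝓢'(SpaceTime, ℂ) :=
  PointwiseConvergenceCLM.precomp ℂ (-attenuationTest κ)

theorem attenuationOp_apply (κ : ℝ → ℂ) (u : 𝓢'(SpaceTime, ℂ)) (ϑ : 𝓢(SpaceTime, ℂ)) :
    attenuationOp κ u ϑ = -u (attenuationTest κ ϑ) :=
  map_neg u (attenuationTest κ ϑ)

/-- The operator `φ ↦ F⁻¹ κ² F φ` on `𝓢(ℝ)`. -/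
def timeMultiplier (κ : ℝ → ℂ) : 𝓢(ℝ, ℂ) →L[ℂ] 𝓢(ℝ, ℂ) :=
  SchwartzMap.fourierMultiplierCLM ℂ (fun ξ : ℝ => κ (2 * Real.pi * ξ) ^ 2)

theorem temperate_aux {κ : ℝ → ℂ} (hκ : κ.HasTemperateGrowth) :
    (fun ξ : ℝ => κ (2 * Real.pi * ξ) ^ 2).HasTemperateGrowth := by
  have hl : (fun ξ : ℝ => 2 * Real.pi * ξ).HasTemperateGrowth :=
    ((2 * Real.pi) • ContinuousLinearMap.id ℝ ℝ).hasTemperateGrowth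
  exact (hκ.comp hl).pow 2

theorem temperate_aux' {κ : ℝ → ℂ} (hκ : κ.HasTemperateGrowth) :
    (fun ξ : SpaceTime => κ (2 * Real.pi * ξ.fst) ^ 2).HasTemperateGrowth :=
  (temperate_aux hκ).comp (WithLp.fstL 2 ℝ ℝ Space).hasTemperateGrowth

theorem fourier_eq_timeFourier (φ : 𝓢(ℝ, ℂ)) (ξ : ℝ) :
    𝓕 φ ξ = (Real.sqrt (2 * Real.pi) : ℝ) * timeFourier φ (2 * Real.pi * ξ) := by
  have hs : (Real.sqrt (2 * Real.pi) : ℂ) ≠ 0 := by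
    exact_mod_cast (Real.sqrt_pos.2 (by positivity)).ne'
  rw [SchwartzMap.fourier_coe, Real.fourier_eq', timeFourier]
  push_cast
  rw [← mul_assoc, mul_one_div_cancel hs, one_mul]
  refine integral_congr_ae (Filter.Eventually.of_forall fun t => ?_)
  simp only [RCLike.inner_apply, conj_trivial, smul_eq_mul]
  rw [mul_comm]
  congr 2
  push_cast
  ring

/-- `(F⁻¹ κ² F φ)(t) = (2π)^{-1/2} ∫ κ(ω)² φ̂(ω) e^{iωt} dω`. -/
theorem timeMultiplier_apply {κ : ℝ → ℂ} (hκ : κ.HasTemperateGrowth) (φ : 𝓢(ℝ, ℂ)) (t : ℝ) :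
    timeMultiplier κ φ t = (1 / Real.sqrt (2 * Real.pi) : ℝ) *
      ∫ ω : ℝ, κ ω ^ 2 * timeFourier φ ω * Complex.exp (Complex.I * ω * t) := by
  have hp : (0 : ℝ) < 2 * Real.pi := by positivity
  have hs : (Real.sqrt (2 * Real.pi) : ℂ) ≠ 0 := by
    exact_mod_cast (Real.sqrt_pos.2 hp).ne'
  have hsq : (Real.sqrt (2 * Real.pi) : ℂ) * (Real.sqrt (2 * Real.pi) : ℂ) = (2 * Real.pi : ℝ) := by
    exact_mod_cast Real.mul_self_sqrt hp.le
  rw [timeMultiplier, SchwartzMap.fourierMultiplierCLM_apply, SchwartzMap.fourierInv_coe,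
    Real.fourierInv_eq']
  have key := Measure.integral_comp_mul_left
    (fun ω : ℝ => κ ω ^ 2 * timeFourier φ ω * Complex.exp (Complex.I * ω * t)) (2 * Real.pi)
  rw [abs_of_pos (inv_pos.2 hp)] at key
  have key' : (∫ ω : ℝ, κ ω ^ 2 * timeFourier φ ω * Complex.exp (Complex.I * ω * t))
      = (2 * Real.pi : ℝ) * ∫ ξ : ℝ, κ (2 * Real.pi * ξ) ^ 2 * timeFourier φ (2 * Real.pi * ξ) *
        Complex.exp (Complex.I * (2 * Real.pi * ξ : ℝ) * t) := by
    rw [key, Complex.real_smul, ← mul_assoc, ← Complex.ofReal_mul, mul_inv_cancel₀ hp.ne']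
    simp
  rw [key', ← hsq]
  push_cast
  rw [← mul_assoc, ← mul_assoc, one_div, inv_mul_cancel₀ hs, one_mul, ← integral_const_mul]
  refine integral_congr_ae (Filter.Eventually.of_forall fun ξ => ?_)
  simp only [SchwartzMap.smulLeftCLM_apply_apply (temperate_aux hκ), fourier_eq_timeFourier,
    RCLike.inner_apply, conj_trivial, smul_eq_mul]
  have : Complex.exp (2 * (Real.pi : ℂ) * ((t * ξ : ℝ) : ℂ) * Complex.I) =
      Complex.exp (Complex.I * (2 * Real.pi * ξ) * t) := by
    congr 1
    push_cast
    ring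
  rw [this]
  ring

theorem fourier_tensor (φ : 𝓢(ℝ, ℂ)) (ψ : 𝓢(Space, ℂ)) :
    𝓕 (tensor φ ψ) = tensor (𝓕 φ) (𝓕 ψ) := by
  ext ξ
  rw [tensor_apply, SchwartzMap.fourier_coe, SchwartzMap.fourier_coe, SchwartzMap.fourier_coe,
    Real.fourier_eq', Real.fourier_eq', Real.fourier_eq', ← integral_prod_mul]
  refine Eq.trans ?_ ((WithLp.volume_preserving_ofLp ℝ Space).integral_comp
      (MeasurableEquiv.toLp 2 (ℝ × Space)).symm.measurableEmbedding _)
  refine integral_congr_ae (Filter.Eventually.of_forall fun z => ?_)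
  simp only [tensor_apply, smul_eq_mul, WithLp.prod_inner_apply]
  have : Complex.exp (((-2 * Real.pi * (inner ℝ z.ofLp.1 ξ.ofLp.1 + inner ℝ z.ofLp.2 ξ.ofLp.2)
        : ℝ) : ℂ) * Complex.I) =
      Complex.exp (((-2 * Real.pi * inner ℝ z.fst ξ.fst : ℝ) : ℂ) * Complex.I) *
      Complex.exp (((-2 * Real.pi * inner ℝ z.snd ξ.snd : ℝ) : ℂ) * Complex.I) := by
    rw [← Complex.exp_add]
    congr 1
    simp only [WithLp.ofLp_fst, WithLp.ofLp_snd]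
    push_cast
    ring
  rw [this]
  simp only [WithLp.ofLp_fst, WithLp.ofLp_snd]
  ring

theorem attenuationTest_tensor {κ : ℝ → ℂ} (hκ : κ.HasTemperateGrowth) (φ : 𝓢(ℝ, ℂ))
    (ψ : 𝓢(Space, ℂ)) :
    attenuationTest κ (tensor φ ψ) = tensor (timeMultiplier κ φ) ψ := by
  have h : SchwartzMap.smulLeftCLM ℂ (fun ξ : SpaceTime => κ (2 * Real.pi * ξ.fst) ^ 2)
      (tensor (𝓕 φ) (𝓕 ψ)) =
      tensor (SchwartzMap.smulLeftCLM ℂ (fun ξ : ℝ => κ (2 * Real.pi * ξ) ^ 2) (𝓕 φ)) (𝓕 ψ) := by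
    ext ξ
    rw [SchwartzMap.smulLeftCLM_apply_apply (temperate_aux' hκ), tensor_apply, tensor_apply,
      SchwartzMap.smulLeftCLM_apply_apply (temperate_aux hκ), smul_eq_mul, smul_eq_mul]
    ring
  rw [attenuationTest, timeMultiplier, SchwartzMap.fourierMultiplierCLM_apply,
    SchwartzMap.fourierMultiplierCLM_apply, fourier_tensor, h,
    ← FourierTransform.fourierInv_fourier_eq (F := 𝓢(SpaceTime, ℂ))
      (tensor (𝓕⁻ (SchwartzMap.smulLeftCLM ℂ (fun ξ : ℝ => κ (2 * Real.pi * ξ) ^ 2) (𝓕 φ))) ψ),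
    fourier_tensor, FourierTransform.fourier_fourierInv_eq]

/-- The characterisation of `A_κ` by its action on tensor products:
`⟨A_κ u, φ ⊗ ψ⟩ = -⟨u, (F⁻¹ κ² F φ) ⊗ ψ⟩`. -/
theorem attenuationOp_tensor {κ : ℝ → ℂ} (hκ : κ.HasTemperateGrowth) (u : 𝓢'(SpaceTime, ℂ))
    (φ : 𝓢(ℝ, ℂ)) (ψ : 𝓢(Space, ℂ)) :
    attenuationOp κ u (tensor φ ψ) = -u (tensor (timeMultiplier κ φ) ψ) := by
  rw [attenuationOp_apply, attenuationTest_tensor hκ]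

/-! ### The attenuated wave equation -/

/-- The Laplace operator with respect to the space variables, on tempered distributions on
space-time. -/
def spatialLaplacian (u : 𝓢'(SpaceTime, ℂ)) : 𝓢'(SpaceTime, ℂ) :=
  ∑ i : Fin 3, ∂_{event 0 (EuclideanSpace.single i 1)} (∂_{event 0 (EuclideanSpace.single i 1)} u)

theorem lineDeriv_tensor (φ : 𝓢(ℝ, ℂ)) (ψ : 𝓢(Space, ℂ)) (v : Space) :
    ∂_{event 0 v} (tensor φ ψ) = tensor φ (∂_{v} ψ) := by
  ext z
  rw [tensor_apply, SchwartzMap.lineDerivOp_apply, SchwartzMap.lineDerivOp_apply, lineDeriv,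
    lineDeriv]
  simp [event, deriv_const_mul_field]

/-- The characterisation of the Laplace operator by its action on tensor products:
`⟨Δu, φ ⊗ ψ⟩ = ⟨u, φ ⊗ Δψ⟩`. -/
theorem spatialLaplacian_tensor (u : 𝓢'(SpaceTime, ℂ)) (φ : 𝓢(ℝ, ℂ)) (ψ : 𝓢(Space, ℂ)) :
    spatialLaplacian u (tensor φ ψ) = u (tensor φ (Δ ψ)) := by
  have hsum : tensor φ (Δ ψ) = ∑ i : Fin 3, tensor φ
      (∂_{EuclideanSpace.single i (1 : ℝ)} (∂_{EuclideanSpace.single i (1 : ℝ)} ψ)) := by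
    rw [SchwartzMap.laplacian_eq_sum (EuclideanSpace.basisFun (Fin 3) ℝ)]
    ext z
    simp [Finset.mul_sum]
  have h1 : spatialLaplacian u (tensor φ ψ) = ∑ i : Fin 3,
      (∂_{event 0 (EuclideanSpace.single i 1)} (∂_{event 0 (EuclideanSpace.single i 1)} u))
        (tensor φ ψ) := by
    simp [spatialLaplacian, Fin.sum_univ_three]
  rw [h1, hsum, map_sum]
  refine Finset.sum_congr rfl fun i _ => ?_
  rw [TemperedDistribution.lineDerivOp_apply_apply, map_neg,
    TemperedDistribution.lineDerivOp_apply_apply, map_neg, neg_neg, lineDeriv_tensor,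
    lineDeriv_tensor]

/-- `p` is a causal solution of the attenuated wave equation `A_κ p - Δp = δ'(t) h(x)`: the
equation holds in the sense of tempered distributions on space-time, and `p` is supported in
`[0, ∞) × ℝ³`. -/
structure IsCausalSolution (κ : ℝ → ℂ) (h : Space → ℂ) (p : 𝓢'(SpaceTime, ℂ)) : Prop where
  equation : ∀ ϑ : 𝓢(SpaceTime, ℂ), attenuationOp κ p ϑ - spatialLaplacian p ϑ =
    -∫ x : Space, h x * deriv (fun t : ℝ => ϑ (event t x)) 0
  support : Distribution.dsupport p ⊆ {z : SpaceTime | 0 ≤ z.fst}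

/-- The kernel `G_κ(ω, x) = -(iω / (4π √(2π))) e^{iκ(ω)|x|} / |x|`, for `x ≠ 0`. -/
def greenKernel (κ : ℝ → ℂ) (ω : ℝ) (x : Space) : ℂ :=
  -(Complex.I * ω / (4 * Real.pi * Real.sqrt (2 * Real.pi) : ℝ)) *
    (Complex.exp (Complex.I * κ ω * ‖x‖) / ‖x‖)

end AttWave

end

namespace AttWave

open Filter Topology Set

/-! ### The Fourier-Laplace transform of functions supported in a half line -/

/-! Existence. Taking the Fourier transform in time turns the equation into a family of Helmholtz
equations with wave number `κ ω`, and `e^{ik|x|}/(4π|x|)` is a fundamental solution of `-(Δ + k²)`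
when `Im k ≥ 0` (`integral_helmholtzU_mul`). The Green integral against `h` is the candidate. It
converges absolutely because `Im κ ≥ 0` makes the exponential at most 1 in modulus, `1/|x|` is
locally integrable in dimension three, and an `L²` function of compact support is in `L¹`
(`integrable_solutionIntegrand`). The equation then follows from Fubini and Fourier inversion at `t
= 0` (`solution_equation`).

Causality is a Paley–Wiener argument. If a test function lives at negative times, its time transform
continues to the upper half plane, decays rapidly and stays bounded there. The kernel continues too,
with polynomial growth, since `κt` maps into the closed upper half plane. Pushing the contour to
`+i∞` shows that the frequency integral is zero (`integral_mul_fourierLaplace_eq_zero`,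
`solution_isVanishingOn`).

Uniqueness. The difference `q` of two causal solutions annihilates every `F⁻¹κ²Fθ + Δθ` and does not
see test functions that vanish for `t > -1`. The symbol `κ(ω)² - |ξ|²` may vanish at real
frequencies, so it cannot be inverted directly. Conjugating with `e^{-t}` replaces `ω` by `ω + i`,
where `Im κt > 0` by the open mapping theorem (`IsAttenuationCoefficient.im_pos`), and then `κt² -
|ξ|²` has no zeros (`shiftedSymbol_sub_ne_zero`). Since `e^{-t}` blows up at `-∞`, it is cut off
below `t = -1`. This is harmless: for `t > -1` the conjugated multiplier depends only on the values
of its argument at times after `-1`, which is the same contour argument again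
(`timeMultiplier_cutoff`). Hence every test function whose Fourier transform has compact support is,
after weighting, in the range of the operator as far as `q` can tell, and density gives `q = 0`
(`eq_zero_of_homogeneous`). -/

/-- The Fourier-Laplace transform `z ↦ ∫ g(t) e^{-izt} dt`. -/
noncomputable def fourierLaplace (g : ℝ → ℂ) (z : ℂ) : ℂ :=
  ∫ t : ℝ, g t * Complex.exp (-(Complex.I * z * t))

theorem norm_exp_neg_I_mul (z : ℂ) (t : ℝ) :
    ‖Complex.exp (-(Complex.I * z * t))‖ = Real.exp (z.im * t) := by
  rw [Complex.norm_exp]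
  simp

/-- The exponential has modulus `e^{t Im z}`, and only times `t ≤ a` contribute. -/
theorem norm_mul_exp_le {g : ℝ → ℂ} {a : ℝ} (hg : ∀ t, a < t → g t = 0) {z : ℂ} (hz : 0 ≤ z.im)
    (t : ℝ) : ‖g t * Complex.exp (-(Complex.I * z * t))‖ ≤ ‖g t‖ * Real.exp (a * z.im) := by
  rw [norm_mul, norm_exp_neg_I_mul]
  rcases lt_or_ge a t with h | h
  · simp [hg t h]
  · refine mul_le_mul_of_nonneg_left (Real.exp_le_exp.2 ?_) (norm_nonneg _)
    rw [mul_comm]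
    exact mul_le_mul_of_nonneg_right h hz

theorem continuous_exp_neg_I_mul (z : ℂ) :
    Continuous fun t : ℝ => Complex.exp (-(Complex.I * z * t)) := by fun_prop

theorem integrable_mul_exp {g : ℝ → ℂ} (hgi : Integrable g) {a : ℝ}
    (hg : ∀ t, a < t → g t = 0) {z : ℂ} (hz : 0 ≤ z.im) :
    Integrable fun t : ℝ => g t * Complex.exp (-(Complex.I * z * t)) :=
  (hgi.norm.mul_const (Real.exp (a * z.im))).mono'
    (hgi.aestronglyMeasurable.mul (continuous_exp_neg_I_mul z).aestronglyMeasurable)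
    (Eventually.of_forall fun t => norm_mul_exp_le hg hz t)

theorem norm_fourierLaplace_le {g : ℝ → ℂ} (hgi : Integrable g) {a : ℝ}
    (hg : ∀ t, a < t → g t = 0) {z : ℂ} (hz : 0 ≤ z.im) :
    ‖fourierLaplace g z‖ ≤ (∫ t, ‖g t‖) * Real.exp (a * z.im) := by
  rw [← integral_mul_const]
  exact norm_integral_le_of_norm_le (hgi.norm.mul_const _)
    (Eventually.of_forall fun t => norm_mul_exp_le hg hz t)

theorem deriv_eq_zero_of_eq_zero {g : ℝ → ℂ} {a : ℝ} (hg : ∀ t, a < t → g t = 0) (t : ℝ)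
    (ht : a < t) : deriv g t = 0 := by
  have : g =ᶠ[𝓝 t] fun _ => 0 := by
    filter_upwards [lt_mem_nhds ht] with s hs using hg s hs
  rw [this.deriv_eq]
  simp

theorem fourierLaplace_deriv (g : 𝓢(ℝ, ℂ)) {a : ℝ} (hg : ∀ t, a < t → g t = 0) {z : ℂ}
    (hz : 0 ≤ z.im) :
    fourierLaplace (derivCLM ℂ ℂ g) z = Complex.I * z * fourierLaplace g z := by
  have hd : ∀ t : ℝ, HasDerivAt (fun t : ℝ => Complex.exp (-(Complex.I * z * t)))
      (-(Complex.I * z) * Complex.exp (-(Complex.I * z * t))) t := by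
    intro t
    have h1 : HasDerivAt (fun t : ℝ => -(Complex.I * z * t)) (-(Complex.I * z * 1)) t :=
      ((Complex.ofRealCLM.hasDerivAt (x := t)).const_mul _).neg
    convert h1.cexp using 1
    ring
  have h0 := integrable_mul_exp g.integrable hg hz
  have h1 := integrable_mul_exp (derivCLM ℂ ℂ g).integrable (a := a)
    (fun t ht => deriv_eq_zero_of_eq_zero hg t ht) hz
  have key := integral_mul_deriv_eq_deriv_mul_of_integrable (u := g)
    (fun t _ => g.hasDerivAt t) (fun t _ => hd t)
    ((h0.const_mul (-(Complex.I * z))).congr (Eventually.of_forall fun t => by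
      simp only [Pi.mul_apply]; ring)) h1 h0
  have h2 : ∫ t : ℝ, g t * (-(Complex.I * z) * Complex.exp (-(Complex.I * z * t))) =
      -(Complex.I * z) * fourierLaplace g z := by
    rw [fourierLaplace, ← integral_const_mul]
    congr 1
    ext t
    ring
  rw [h2] at key
  have h3 : fourierLaplace (derivCLM ℂ ℂ g) z =
      ∫ t : ℝ, deriv g t * Complex.exp (-(Complex.I * z * t)) := rfl
  rw [h3, ← neg_neg (∫ t : ℝ, deriv g t * Complex.exp (-(Complex.I * z * t))), ← key]
  ring

/-- Each derivative of `g` brings down a factor `iz` and keeps the support in `(-∞, a]`. The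
induction runs over all `g` because its step is applied to `g'`. -/
theorem exists_norm_pow_mul_fourierLaplace_le (k : ℕ) : ∀ (g : 𝓢(ℝ, ℂ)) {a : ℝ}
    (_ : ∀ t, a < t → g t = 0), ∃ C : ℝ, 0 ≤ C ∧ ∀ z : ℂ, 0 ≤ z.im →
      ‖z‖ ^ k * ‖fourierLaplace g z‖ ≤ C * Real.exp (a * z.im) := by
  induction k with
  | zero =>
    intro g a hg
    refine ⟨∫ t, ‖g t‖, integral_nonneg fun _ => norm_nonneg _, fun z hz => ?_⟩
    simpa using norm_fourierLaplace_le g.integrable hg hz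
  | succ k ih =>
    intro g a hg
    obtain ⟨C, hC, h⟩ := ih (derivCLM ℂ ℂ g) (a := a)
      (fun t ht => deriv_eq_zero_of_eq_zero hg t ht)
    refine ⟨C, hC, fun z hz => ?_⟩
    have := h z hz
    rw [fourierLaplace_deriv g hg hz, norm_mul, norm_mul, Complex.norm_I, one_mul] at this
    rwa [pow_succ, mul_assoc]

theorem exists_norm_fourierLaplace_le (k : ℕ) (g : 𝓢(ℝ, ℂ)) {a : ℝ}
    (hg : ∀ t, a < t → g t = 0) : ∃ C : ℝ, 0 ≤ C ∧ ∀ z : ℂ, 0 ≤ z.im →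
      (1 + ‖z‖) ^ k * ‖fourierLaplace g z‖ ≤ C * Real.exp (a * z.im) := by
  obtain ⟨C, hC, h⟩ := exists_norm_pow_mul_fourierLaplace_le k g hg
  obtain ⟨C', hC', h'⟩ := exists_norm_pow_mul_fourierLaplace_le 0 g hg
  refine ⟨2 ^ k * (C + C'), by positivity, fun z hz => ?_⟩
  have h1 := h z hz
  have h2 := h' z hz
  rw [pow_zero, one_mul] at h2
  have h3 : (1 + ‖z‖) ^ k ≤ 2 ^ k * (‖z‖ ^ k + 1) := by
    rcases le_total 1 ‖z‖ with h | h
    · calc (1 + ‖z‖) ^ k ≤ (2 * ‖z‖) ^ k := by gcongr; linarith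
        _ = 2 ^ k * ‖z‖ ^ k := mul_pow _ _ _
        _ ≤ _ := by gcongr; linarith
    · calc (1 + ‖z‖) ^ k ≤ 2 ^ k := by gcongr; linarith
        _ = 2 ^ k * 1 := (mul_one _).symm
        _ ≤ _ := by gcongr; linarith [pow_nonneg (norm_nonneg z) k]
  calc _ ≤ 2 ^ k * (‖z‖ ^ k + 1) * ‖fourierLaplace g z‖ := by gcongr
    _ = 2 ^ k * (‖z‖ ^ k * ‖fourierLaplace g z‖ + ‖fourierLaplace g z‖) := by ring
    _ ≤ 2 ^ k * (C * Real.exp (a * z.im) + C' * Real.exp (a * z.im)) := by gcongr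
    _ = _ := by ring

theorem continuousOn_fourierLaplace {g : ℝ → ℂ} (hgi : Integrable g) {a : ℝ}
    (hg : ∀ t, a < t → g t = 0) : ContinuousOn (fourierLaplace g) {z : ℂ | 0 ≤ z.im} := by
  intro z hz
  -- The bound `e^{a Im w}` need not be uniform on the half plane, so domination is used on a strip
  -- of bounded height. The absolute value `|a|` covers both signs of `a`.
  have h : ContinuousOn (fourierLaplace g) {w : ℂ | 0 ≤ w.im ∧ w.im ≤ z.im + 1} := by
    refine continuousOn_of_dominated (bound := fun t => ‖g t‖ * Real.exp (|a| * (z.im + 1)))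
      (fun w hw => (integrable_mul_exp hgi hg hw.1).aestronglyMeasurable)
      (fun w hw => Eventually.of_forall fun t => (norm_mul_exp_le hg hw.1 t).trans ?_)
      (hgi.norm.mul_const _)
      (Eventually.of_forall fun t => by fun_prop)
    exact mul_le_mul_of_nonneg_left (Real.exp_le_exp.2
      (mul_le_mul (le_abs_self a) hw.2 hw.1 (abs_nonneg a))) (norm_nonneg _)
  refine (h z ⟨hz, by linarith⟩).mono_of_mem_nhdsWithin ?_
  have : {w : ℂ | w.im < z.im + 1} ∈ 𝓝 z :=
    (isOpen_lt Complex.continuous_im continuous_const).mem_nhds (by simp)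
  filter_upwards [self_mem_nhdsWithin, mem_nhdsWithin_of_mem_nhds this] with w h1 h2
  exact ⟨h1, le_of_lt h2⟩

theorem differentiableOn_fourierLaplace (g : 𝓢(ℝ, ℂ)) {a : ℝ}
    (hg : ∀ t, a < t → g t = 0) :
    DifferentiableOn ℂ (fourierLaplace g) {z : ℂ | 0 < z.im} := by
  intro z hz
  refine DifferentiableAt.differentiableWithinAt ?_
  have htg : Integrable fun t : ℝ => ‖t‖ * ‖g t‖ := by
    simpa using g.integrable_pow_mul volume 1
  refine (hasDerivAt_integral_of_dominated_loc_of_deriv_le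
    (bound := fun t => ‖t‖ * ‖g t‖ * Real.exp (|a| * (z.im + 1)))
    (F := fun w (t : ℝ) => g t * Complex.exp (-(Complex.I * w * t)))
    (F' := fun w (t : ℝ) => g t * (-(Complex.I * t) * Complex.exp (-(Complex.I * w * t))))
    (s := {w : ℂ | 0 < w.im ∧ w.im < z.im + 1}) ?_ ?_ ?_ ?_ ?_ ?_ ?_).2.differentiableAt
  · exact ((isOpen_lt continuous_const Complex.continuous_im).inter
      (isOpen_lt Complex.continuous_im continuous_const)).mem_nhds ⟨hz, by simp⟩
  · exact Eventually.of_forall fun w => (by fun_prop : Continuous _).aestronglyMeasurable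
  · exact integrable_mul_exp g.integrable hg (le_of_lt hz)
  · exact (by fun_prop : Continuous _).aestronglyMeasurable
  · refine Eventually.of_forall fun t w hw => ?_
    have h1 := norm_mul_exp_le hg (le_of_lt hw.1) t
    calc _ = ‖t‖ * ‖g t * Complex.exp (-(Complex.I * w * t))‖ := by
          simp only [norm_mul, norm_neg, Complex.norm_I, Complex.norm_real]
          ring
      _ ≤ ‖t‖ * (‖g t‖ * Real.exp (a * w.im)) := by gcongr
      _ = ‖t‖ * ‖g t‖ * Real.exp (a * w.im) := by ring
      _ ≤ _ := mul_le_mul_of_nonneg_left (Real.exp_le_exp.2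
          (mul_le_mul (le_abs_self a) hw.2.le hw.1.le (abs_nonneg a))) (by positivity)
  · exact htg.mul_const _
  · refine Eventually.of_forall fun t w _ => ?_
    refine HasDerivAt.const_mul _ ?_
    have h1 : HasDerivAt (fun w : ℂ => -(Complex.I * w * t)) (-(Complex.I * 1 * t)) w :=
      (((hasDerivAt_id w).const_mul _).mul_const _).neg
    exact h1.cexp.congr_deriv (by ring)

/-! ### Shifting the contour of integration -/

theorem integrable_of_norm_le_inv_one_add_sq {f : ℝ → ℂ} (hf : Continuous f) {C : ℝ}
    (h : ∀ x, ‖f x‖ ≤ C * (1 + x ^ 2)⁻¹) : Integrable f :=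
  (integrable_inv_one_add_sq.const_mul C).mono' hf.aestronglyMeasurable (Eventually.of_forall h)

theorem continuous_comp_add_mul_I {F : ℂ → ℂ} {s : Set ℂ} (hc : ContinuousOn F s) {y : ℝ}
    (hy : ∀ x : ℝ, (x + y * Complex.I : ℂ) ∈ s) : Continuous fun x : ℝ => F (x + y * Complex.I) :=
  hc.comp_continuous (by fun_prop) hy

/-- Cauchy's theorem on the rectangle `[-T, T] × [0, R]`: the vertical sides contribute at most `C R
/ (1 + T²)`, which tends to zero. -/
theorem integral_eq_integral_add_mul_I {F : ℂ → ℂ} {R C : ℝ} (hR : 0 ≤ R)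
    (hc : ContinuousOn F {z | 0 ≤ z.im ∧ z.im ≤ R})
    (hd : DifferentiableOn ℂ F {z | 0 < z.im ∧ z.im < R})
    (hb : ∀ z : ℂ, 0 ≤ z.im → z.im ≤ R → ‖F z‖ ≤ C * (1 + z.re ^ 2)⁻¹) :
    ∫ x : ℝ, F x = ∫ x : ℝ, F (x + R * Complex.I) := by
  have c0 : Continuous fun x : ℝ => F x := by
    simpa using continuous_comp_add_mul_I hc (y := 0) (by simp [hR])
  have cR : Continuous fun x : ℝ => F (x + R * Complex.I) :=
    continuous_comp_add_mul_I hc (y := R) (by simp [hR])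
  have i0 : Integrable fun x : ℝ => F x :=
    integrable_of_norm_le_inv_one_add_sq c0 (C := C) fun x => by simpa using hb x (by simp) (by simpa)
  have iR : Integrable fun x : ℝ => F (x + R * Complex.I) :=
    integrable_of_norm_le_inv_one_add_sq cR (C := C) fun x => by
      simpa using hb (x + R * Complex.I) (by simpa) (by simp)
  have t0 := intervalIntegral_tendsto_integral i0 tendsto_neg_atTop_atBot tendsto_id
  have tR := intervalIntegral_tendsto_integral iR tendsto_neg_atTop_atBot tendsto_id
  have hdec : Tendsto (fun T : ℝ => C * (1 + T ^ 2)⁻¹ * R) atTop (𝓝 0) := by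
    have : Tendsto (fun T : ℝ => (1 + T ^ 2)⁻¹) atTop (𝓝 0) :=
      tendsto_inv_atTop_zero.comp
        (tendsto_atTop_add_const_left _ _ (tendsto_pow_atTop two_ne_zero))
    simpa using (this.const_mul C).mul_const R
  have hside : ∀ s : ℝ → ℝ, (∀ T, s T ^ 2 = T ^ 2) → Tendsto
      (fun T : ℝ => Complex.I • ∫ y : ℝ in (0 : ℝ)..R, F ((s T : ℝ) + y * Complex.I))
      atTop (𝓝 0) := by
    intro s hs
    refine squeeze_zero_norm (fun T => ?_) hdec
    rw [norm_smul, Complex.norm_I, one_mul]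
    refine (intervalIntegral.norm_integral_le_of_norm_le_const (C := C * (1 + T ^ 2)⁻¹)
      fun y hy => ?_).trans_eq ?_
    · rw [uIoc_of_le hR] at hy
      refine (hb _ (by simpa using hy.1.le) (by simpa using hy.2)).trans_eq ?_
      simp [hs]
    · rw [sub_zero, abs_of_nonneg hR]
  have h1 := hside (fun T => T) fun T => rfl
  have h2 := hside (fun T => -T) fun T => by ring
  have hz : ∀ᶠ T : ℝ in atTop, (((∫ x : ℝ in -T..T, F x) - ∫ x : ℝ in -T..T, F (x + R * Complex.I))
      + Complex.I • ∫ y : ℝ in (0 : ℝ)..R, F ((T : ℝ) + y * Complex.I)) -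
      Complex.I • ∫ y : ℝ in (0 : ℝ)..R, F (((-T : ℝ) : ℂ) + y * Complex.I) = 0 := by
    filter_upwards [eventually_ge_atTop 0] with T hT
    have := Complex.integral_boundary_rect_eq_zero_of_continuousOn_of_differentiableOn F
      (⟨-T, 0⟩ : ℂ) (⟨T, R⟩ : ℂ) (hc.mono fun z hz => ?_) (hd.mono fun z hz => ?_)
    · simpa using this
    · simpa [uIcc_of_le hR] using (Complex.mem_reProdIm.1 hz).2
    · simpa [hR] using (Complex.mem_reProdIm.1 hz).2
  have hlim := (((t0.sub tR).add h1).sub h2)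
  have h0 := tendsto_nhds_unique (hlim.congr' hz) tendsto_const_nhds
  simp only [add_zero, sub_zero] at h0
  exact sub_eq_zero.1 h0

theorem one_add_sq_le (z : ℂ) : 1 + z.re ^ 2 ≤ (1 + ‖z‖) ^ 2 := by
  have := Complex.abs_re_le_norm z
  nlinarith [sq_abs z.re, norm_nonneg z, abs_nonneg z.re]

theorem norm_le_inv_of_mul_le {F : ℂ → ℂ} {z : ℂ} {D : ℝ}
    (h : (1 + ‖z‖) ^ 2 * ‖F z‖ ≤ D) : ‖F z‖ ≤ D * (1 + z.re ^ 2)⁻¹ := by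
  have h0 : 0 < 1 + z.re ^ 2 := by positivity
  rw [← div_eq_mul_inv, le_div_iff₀ h0, mul_comm]
  exact (mul_le_mul_of_nonneg_right (one_add_sq_le z) (norm_nonneg _)).trans h

/-- The integral of the Fourier transform of a function supported in `(-∞, a]` against the boundary
values of a holomorphic function on the upper half plane of suitable growth vanishes. -/
theorem integral_mul_fourierLaplace_eq_zero {m : ℂ → ℂ} (hc : ContinuousOn m {z | 0 ≤ z.im})
    (hd : DifferentiableOn ℂ m {z | 0 < z.im}) {C a : ℝ} {N : ℕ}
    (hb : ∀ z : ℂ, 0 ≤ z.im → ‖m z‖ ≤ C * (1 + ‖z‖) ^ N * Real.exp (-(a * z.im)))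
    (g : 𝓢(ℝ, ℂ)) (hg : ∀ t, a < t → g t = 0) :
    Integrable (fun ω : ℝ => m ω * fourierLaplace g ω) ∧
      ∫ ω : ℝ, m ω * fourierLaplace g ω = 0 := by
  -- Of the `N + 3` powers, `N` absorb the growth of `m`, two give integrability along horizontal
  -- lines, and the last gives the factor `1/(1 + Im z)` that sends the shifted integral to zero.
  obtain ⟨C', hC', h⟩ := exists_norm_fourierLaplace_le (N + 3) g hg
  have hC : 0 ≤ C := by
    have := (norm_nonneg _).trans (hb 0 (by simp))
    simpa using this
  set F : ℂ → ℂ := fun z => m z * fourierLaplace g z with hF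
  have hFb : ∀ z : ℂ, 0 ≤ z.im → (1 + ‖z‖) ^ 3 * ‖F z‖ ≤ C * C' := by
    intro z hz
    have h1 := hb z hz
    have h2 := h z hz
    calc (1 + ‖z‖) ^ 3 * ‖F z‖ = ‖m z‖ * ((1 + ‖z‖) ^ 3 * ‖fourierLaplace g z‖) := by
          rw [hF, norm_mul]; ring
      _ ≤ C * (1 + ‖z‖) ^ N * Real.exp (-(a * z.im)) *
          ((1 + ‖z‖) ^ 3 * ‖fourierLaplace g z‖) := by gcongr
      _ = C * Real.exp (-(a * z.im)) * ((1 + ‖z‖) ^ (N + 3) * ‖fourierLaplace g z‖) := by ring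
      _ ≤ C * Real.exp (-(a * z.im)) * (C' * Real.exp (a * z.im)) := by gcongr
      _ = C * C' * (Real.exp (-(a * z.im)) * Real.exp (a * z.im)) := by ring
      _ = C * C' := by rw [← Real.exp_add]; simp
  have hCC : 0 ≤ C * C' := mul_nonneg hC hC'
  have hF2 : ∀ z : ℂ, 0 ≤ z.im → ‖F z‖ ≤ C * C' * (1 + z.re ^ 2)⁻¹ := by
    intro z hz
    refine norm_le_inv_of_mul_le (le_trans ?_ (hFb z hz))
    gcongr
    · linarith [norm_nonneg z]
    · norm_num
  have hF3 : ∀ z : ℂ, 0 ≤ z.im → ‖F z‖ ≤ C * C' * (1 + z.im)⁻¹ * (1 + z.re ^ 2)⁻¹ := by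
    intro z hz
    have h0 : 0 < 1 + z.im := by positivity
    refine norm_le_inv_of_mul_le ?_
    rw [← div_eq_mul_inv, le_div_iff₀ h0]
    calc _ ≤ (1 + ‖z‖) ^ 2 * ‖F z‖ * (1 + ‖z‖) := by
          gcongr
          exact (le_abs_self _).trans (Complex.abs_im_le_norm z)
      _ = (1 + ‖z‖) ^ 3 * ‖F z‖ := by ring
      _ ≤ _ := hFb z hz
  have hFc : ContinuousOn F {z | 0 ≤ z.im} := hc.mul (continuousOn_fourierLaplace g.integrable hg)
  have hFd : DifferentiableOn ℂ F {z | 0 < z.im} := hd.mul (differentiableOn_fourierLaplace g hg)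
  have c0 : Continuous fun x : ℝ => F x := by
    simpa using continuous_comp_add_mul_I hFc (y := 0) (by simp)
  refine ⟨integrable_of_norm_le_inv_one_add_sq c0 (C := C * C')
    fun x => by simpa only [Complex.ofReal_re] using hF2 x (by simp), ?_⟩
  set J : ℝ := ∫ x : ℝ, (1 + x ^ 2)⁻¹
  have hlim : Tendsto (fun R : ℝ => C * C' * (1 + R)⁻¹ * J) atTop (𝓝 0) := by
    have : Tendsto (fun R : ℝ => (1 + R)⁻¹) atTop (𝓝 0) :=
      tendsto_inv_atTop_zero.comp (tendsto_atTop_add_const_left _ _ tendsto_id)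
    simpa using (this.const_mul (C * C')).mul_const J
  refine norm_le_zero_iff.1 (ge_of_tendsto hlim ?_)
  filter_upwards [eventually_ge_atTop 0] with R hR
  have e := integral_eq_integral_add_mul_I (F := F) hR (C := C * C')
    (hFc.mono fun z hz => hz.1) (hFd.mono fun z hz => hz.1) (fun z hz _ => hF2 z hz)
  rw [e, ← integral_const_mul]
  refine norm_integral_le_of_norm_le (integrable_inv_one_add_sq.const_mul _)
    (Eventually.of_forall fun x => ?_)
  simpa using hF3 (x + R * Complex.I) (by simpa)

theorem norm_exp_I_mul_mul (z : ℂ) (t : ℝ) :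
    ‖Complex.exp (Complex.I * z * t)‖ = Real.exp (-(z.im * t)) := by
  rw [Complex.norm_exp]
  simp

/-- Shifting the contour by `i`: here `F(t) = eᵗ f(t)`. -/
theorem integral_shift_I {m : ℂ → ℂ} (hc : ContinuousOn m {z | 0 ≤ z.im})
    (hd : DifferentiableOn ℂ m {z | 0 < z.im}) {C : ℝ} {N : ℕ}
    (hb : ∀ z : ℂ, 0 ≤ z.im → ‖m z‖ ≤ C * (1 + ‖z‖) ^ N) {f : ℝ → ℂ} (F : 𝓢(ℝ, ℂ))
    (hF : ∀ t : ℝ, F t = Complex.exp t * f t) {b : ℝ} (h0 : ∀ t, t < b → f t = 0) (t : ℝ) :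
    ∫ ω : ℝ, m ω * fourierLaplace f ω * Complex.exp (Complex.I * ω * t) =
      Complex.exp (-t) * ∫ ω : ℝ, m (ω + Complex.I) * fourierLaplace F ω *
        Complex.exp (Complex.I * ω * t) := by
  have hC : 0 ≤ C := by
    have := (norm_nonneg _).trans (hb 0 (by simp))
    simpa using this
  -- The function `f` vanishes for early times, so its transform continues downwards from any line
  -- on which it is controlled. Reflecting time brings this back to the upper half plane: the
  -- transform of `f` at `z` is that of `G` at `i - z`, which is available exactly for `Im z ≤ 1`.
  set G : 𝓢(ℝ, ℂ) := compCLMOfContinuousLinearEquiv ℂ (ContinuousLinearEquiv.neg ℝ) F with hG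
  have hGa : ∀ s, G s = F (-s) := fun s => rfl
  have hG0 : ∀ s, -b < s → G s = 0 := fun s hs => by
    rw [hGa, hF, h0 (-s) (by linarith), mul_zero]
  have hLG : ∀ z : ℂ, fourierLaplace F z = fourierLaplace G (-z) := by
    intro z
    rw [fourierLaplace, fourierLaplace,
      ← integral_neg_eq_self (fun s : ℝ => F s * Complex.exp (-(Complex.I * z * s)))]
    congr 1
    ext s
    rw [hGa]
    congr 2
    push_cast
    ring
  have hLf : ∀ z : ℂ, fourierLaplace f z = fourierLaplace G (Complex.I - z) := by
    intro z
    rw [← neg_sub, ← hLG, fourierLaplace, fourierLaplace]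
    congr 1
    ext s
    rw [hF, mul_comm (Complex.exp _), mul_assoc (f s), ← Complex.exp_add]
    congr 2
    ring_nf
    rw [Complex.I_sq]
    ring
  obtain ⟨C', hC', hL⟩ := exists_norm_fourierLaplace_le (N + 2) G hG0
  set Φ : ℂ → ℂ := fun z => m z * fourierLaplace G (Complex.I - z) *
    Complex.exp (Complex.I * z * t) with hΦ
  have key := integral_eq_integral_add_mul_I (F := Φ) zero_le_one
    (C := C * (2 ^ (N + 2) * (C' * Real.exp |b|)) * Real.exp |t|) ?_ ?_ ?_
  · have e1 : ∀ ω : ℝ, m ω * fourierLaplace f ω * Complex.exp (Complex.I * ω * t) = Φ ω := by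
      intro ω
      rw [hLf]
    have e2 : ∀ ω : ℝ, Φ (ω + (1 : ℝ) * Complex.I) = Complex.exp (-t) *
        (m (ω + Complex.I) * fourierLaplace F ω * Complex.exp (Complex.I * ω * t)) := by
      intro ω
      have a1 : Complex.I - (ω + (1 : ℝ) * Complex.I) = -(ω : ℂ) := by push_cast; ring
      have a2 : Complex.exp (Complex.I * (ω + (1 : ℝ) * Complex.I) * t) =
          Complex.exp (-t) * Complex.exp (Complex.I * ω * t) := by
        rw [← Complex.exp_add]
        congr 1
        push_cast
        ring_nf
        rw [Complex.I_sq]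
        ring
      simp only [hΦ]
      rw [a1, a2, ← hLG]
      push_cast
      rw [one_mul]
      ring
    simp_rw [e1]
    rw [key]
    simp_rw [e2]
    rw [integral_const_mul]
  · refine ((hc.mono fun z hz => hz.1).mul ?_).mul (by fun_prop)
    exact (continuousOn_fourierLaplace G.integrable hG0).comp (by fun_prop) fun z hz => by
      simpa using hz.2
  · refine ((hd.mono fun z hz => hz.1).mul ?_).mul (by fun_prop)
    exact (differentiableOn_fourierLaplace G hG0).comp (by fun_prop) fun z hz => by
      simpa using hz.2
  · intro z hz hz1
    refine norm_le_inv_of_mul_le ?_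
    have i1 : 0 ≤ (Complex.I - z).im := by simpa using hz1
    have i2 : (Complex.I - z).im ≤ 1 := by simpa using hz
    have n1 : 1 + ‖z‖ ≤ 2 * (1 + ‖Complex.I - z‖) := by
      have : ‖z‖ ≤ ‖Complex.I‖ + ‖Complex.I - z‖ := by
        simpa using norm_sub_le Complex.I (Complex.I - z)
      rw [Complex.norm_I] at this
      linarith [norm_nonneg (Complex.I - z)]
    have n2 : (1 + ‖z‖) ^ (N + 2) * ‖fourierLaplace G (Complex.I - z)‖ ≤
        2 ^ (N + 2) * (C' * Real.exp |b|) := by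
      calc _ ≤ (2 * (1 + ‖Complex.I - z‖)) ^ (N + 2) * ‖fourierLaplace G (Complex.I - z)‖ := by
            gcongr
        _ = 2 ^ (N + 2) * ((1 + ‖Complex.I - z‖) ^ (N + 2) *
            ‖fourierLaplace G (Complex.I - z)‖) := by rw [mul_pow]; ring
        _ ≤ 2 ^ (N + 2) * (C' * Real.exp (-b * (Complex.I - z).im)) := by
            exact mul_le_mul_of_nonneg_left (hL _ i1) (by positivity)
        _ ≤ _ := by
            gcongr
            calc -b * (Complex.I - z).im ≤ |b| * (Complex.I - z).im :=
                  mul_le_mul_of_nonneg_right (neg_le_abs b) i1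
              _ ≤ |b| * 1 := by gcongr
              _ = |b| := mul_one _
    have n3 : ‖Complex.exp (Complex.I * z * t)‖ ≤ Real.exp |t| := by
      rw [norm_exp_I_mul_mul, Real.exp_le_exp]
      calc -(z.im * t) ≤ |z.im * t| := neg_le_abs _
        _ = z.im * |t| := by rw [abs_mul, abs_of_nonneg hz]
        _ ≤ 1 * |t| := by gcongr
        _ = |t| := one_mul _
    calc (1 + ‖z‖) ^ 2 * ‖Φ z‖ = ‖m z‖ * ((1 + ‖z‖) ^ 2 * ‖fourierLaplace G (Complex.I - z)‖) *
          ‖Complex.exp (Complex.I * z * t)‖ := by rw [hΦ, norm_mul, norm_mul]; ring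
      _ ≤ C * (1 + ‖z‖) ^ N * ((1 + ‖z‖) ^ 2 * ‖fourierLaplace G (Complex.I - z)‖) *
          Real.exp |t| := by
          gcongr
          exact hb z hz
      _ = C * ((1 + ‖z‖) ^ (N + 2) * ‖fourierLaplace G (Complex.I - z)‖) * Real.exp |t| := by ring
      _ ≤ _ := by gcongr

/-! ### The time multiplier as an integral over angular frequency -/

theorem timeFourier_eq_fourierLaplace (φ : 𝓢(ℝ, ℂ)) (ω : ℝ) :
    timeFourier φ ω = (1 / Real.sqrt (2 * Real.pi) : ℝ) * fourierLaplace φ ω := rfl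

theorem timeMultiplier_one (φ : 𝓢(ℝ, ℂ)) : timeMultiplier (fun _ => 1) φ = φ := by
  simp [timeMultiplier]

theorem timeMultiplier_apply_eq_fourierLaplace {κ : ℝ → ℂ} (hκ : κ.HasTemperateGrowth)
    (φ : 𝓢(ℝ, ℂ)) (t : ℝ) :
    timeMultiplier κ φ t = (1 / (2 * Real.pi) : ℝ) *
      ∫ ω : ℝ, κ ω ^ 2 * fourierLaplace φ ω * Complex.exp (Complex.I * ω * t) := by
  have hp : (0 : ℝ) ≤ 2 * Real.pi := by positivity
  have hsq : (1 / (2 * Real.pi) : ℝ) =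
      (1 / Real.sqrt (2 * Real.pi)) * (1 / Real.sqrt (2 * Real.pi)) := by
    rw [div_mul_div_comm, Real.mul_self_sqrt hp, one_mul]
  rw [timeMultiplier_apply hκ, hsq, Complex.ofReal_mul, mul_assoc]
  congr 1
  rw [← integral_const_mul]
  refine integral_congr_ae (Eventually.of_forall fun ω => ?_)
  simp only [timeFourier_eq_fourierLaplace]
  ring

theorem eq_integral_fourierLaplace (φ : 𝓢(ℝ, ℂ)) (t : ℝ) :
    φ t = (1 / (2 * Real.pi) : ℝ) *
      ∫ ω : ℝ, fourierLaplace φ ω * Complex.exp (Complex.I * ω * t) := by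
  have := timeMultiplier_apply_eq_fourierLaplace
    (Function.HasTemperateGrowth.const (1 : ℂ) : (fun _ : ℝ => (1 : ℂ)).HasTemperateGrowth) φ t
  simpa [timeMultiplier_one] using this

theorem fourierLaplace_eq_fourier (φ : 𝓢(ℝ, ℂ)) (ω : ℝ) :
    fourierLaplace φ ω = 𝓕 φ (ω / (2 * Real.pi)) := by
  have hs : (Real.sqrt (2 * Real.pi) : ℂ) ≠ 0 := by
    exact_mod_cast (Real.sqrt_pos.2 (by positivity)).ne'
  rw [fourier_eq_timeFourier, timeFourier_eq_fourierLaplace, mul_div_cancel₀ _ (by positivity),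
    ← mul_assoc]
  push_cast
  rw [mul_one_div_cancel hs, one_mul]

theorem integrable_fourierLaplace_mul_exp (φ : 𝓢(ℝ, ℂ)) (t : ℝ) :
    Integrable fun ω : ℝ => fourierLaplace φ ω * Complex.exp (Complex.I * ω * t) := by
  have h1 : Integrable fun ω : ℝ => fourierLaplace φ ω := by
    simp_rw [fourierLaplace_eq_fourier]
    exact (𝓕 φ).integrable.comp_div (by positivity)
  refine h1.mul_bdd (c := 1) (by fun_prop : Continuous _).aestronglyMeasurable
    (Eventually.of_forall fun ω => ?_)
  rw [norm_exp_I_mul_mul]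
  simp

/-- Conjugation of the time multiplier with `eᵗ`, for functions cut off below `t = -1`. -/
theorem timeMultiplier_cutoff {κ : ℝ → ℂ} (hκ : κ.HasTemperateGrowth) {κt : ℂ → ℂ}
    (h : IsHolomorphicContinuation κ κt) {φ φ₂ f F : 𝓢(ℝ, ℂ)}
    (h2 : ∀ ω : ℝ, fourierLaplace φ₂ ω = κt (ω + Complex.I) ^ 2 * fourierLaplace φ ω)
    (hF : ∀ t : ℝ, F t = Complex.exp t * f t) {b : ℝ} (h0 : ∀ t, t < b → f t = 0)
    (hφ : ∀ t : ℝ, -1 < t → F t = φ t) {t : ℝ} (ht : -1 < t) :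
    timeMultiplier κ f t = Complex.exp (-t) * φ₂ t := by
  obtain ⟨C, hC, N, hb⟩ := h.poly_bound
  have hb2 : ∀ z : ℂ, 0 ≤ z.im → ‖κt z ^ 2‖ ≤ C ^ 2 * (1 + ‖z‖) ^ (N * 2) := by
    intro z hz
    rw [norm_pow, pow_mul, ← mul_pow]
    gcongr
    exact hb z hz
  have e1 := integral_shift_I (h.continuousOn.pow 2) (h.differentiableOn.pow 2) hb2 F hF h0 t
  rw [timeMultiplier_apply_eq_fourierLaplace hκ, eq_integral_fourierLaplace φ₂ t]
  simp only [Pi.pow_apply, h.eq_on_real] at e1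
  rw [e1, ← mul_assoc, ← mul_assoc, mul_comm (Complex.exp _)]
  congr 1
  -- The cutoff alters `φ` only at times at most `-1`. For `t > -1` the factor `e^{izt}` grows at
  -- most like `e^{Im z}` on the upper half plane, which matches the support of `g` with `a = -1`,
  -- so the alteration contributes nothing at time `t`.
  set g : 𝓢(ℝ, ℂ) := F - φ with hg
  have hga : ∀ s, g s = F s - φ s := fun s => rfl
  have hg0 : ∀ s, -1 < s → g s = 0 := fun s hs => by rw [hga, hφ s hs, sub_self]
  have him : ∀ z : ℂ, 0 ≤ z.im → 0 < (z + Complex.I).im := fun z hz => by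
    simp only [Complex.add_im, Complex.I_im]
    linarith
  have hv := integral_mul_fourierLaplace_eq_zero
    (m := fun z => κt (z + Complex.I) ^ 2 * Complex.exp (Complex.I * z * t))
    (C := C ^ 2 * 2 ^ (N * 2)) (N := N * 2) (a := -1) ?_ ?_ ?_ g hg0
  · have hi := integrable_fourierLaplace_mul_exp φ₂ t
    rw [← add_zero (∫ ω : ℝ, fourierLaplace φ₂ ω * Complex.exp (Complex.I * ω * t)), ← hv.2,
      ← integral_add hi hv.1]
    congr 1
    ext ω
    have hadd : fourierLaplace F ω = fourierLaplace φ ω + fourierLaplace g ω := by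
      rw [fourierLaplace_eq_fourier, fourierLaplace_eq_fourier, fourierLaplace_eq_fourier,
        ← add_apply, ← FourierTransform.fourier_add, hg, add_sub_cancel]
    rw [hadd, h2]
    ring
  · refine ContinuousOn.mul (ContinuousOn.pow ?_ 2) (by fun_prop)
    exact h.continuousOn.comp (by fun_prop) fun z hz => (him z hz).le
  · refine DifferentiableOn.mul (DifferentiableOn.pow ?_ 2) (by fun_prop)
    exact h.differentiableOn.comp (by fun_prop) fun z hz => him z (le_of_lt hz)
  · intro z hz
    rw [norm_mul, norm_exp_I_mul_mul]
    have n1 : 1 + ‖z + Complex.I‖ ≤ 2 * (1 + ‖z‖) := by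
      have := norm_add_le z Complex.I
      rw [Complex.norm_I] at this
      linarith [norm_nonneg z]
    calc _ ≤ C ^ 2 * (1 + ‖z + Complex.I‖) ^ (N * 2) * Real.exp (-(z.im * t)) := by
          gcongr
          exact hb2 _ (him z hz).le
      _ ≤ C ^ 2 * (2 * (1 + ‖z‖)) ^ (N * 2) * Real.exp (-(-1 * z.im)) := by
          have : Real.exp (-(z.im * t)) ≤ Real.exp (-(-1 * z.im)) :=
            Real.exp_le_exp.2 (by nlinarith)
          gcongr
      _ = _ := by rw [mul_pow]; ring

/-- The holomorphic continuation of an attenuation coefficient takes values in the open upper half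
plane. -/
theorem IsAttenuationCoefficient.im_pos {κ : ℝ → ℂ} (hκ : IsAttenuationCoefficient κ)
    {κt : ℂ → ℂ} (h : IsHolomorphicContinuation κ κt) {z : ℂ} (hz : 0 < z.im) :
    0 < (κt z).im := by
  have hU : IsOpen {z : ℂ | 0 < z.im} := isOpen_lt continuous_const Complex.continuous_im
  have hpre : IsPreconnected {z : ℂ | 0 < z.im} := (convex_halfSpace_im_gt 0).isPreconnected
  refine lt_of_le_of_ne (h.im_nonneg z hz.le) fun h0 => ?_
  -- Open mapping dichotomy. A constant `κt` would be real, and the symmetry of `κ` at `0` removes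
  -- its real part, against `κ ≠ 0`. Otherwise the image is open, hence contained in the interior of
  -- the closed half plane.
  rcases (h.differentiableOn.analyticOnNhd hU).is_constant_or_isOpen hpre with ⟨w, hw⟩ | hop
  · have hw' : ∀ x : ℝ, κ x = w := by
      intro x
      rw [← h.eq_on_real]
      have hcl : (x : ℂ) ∈ closure {z : ℂ | 0 < z.im} := by
        rw [Complex.closure_setOfPred_lt_im]
        simp
      have hne : (𝓝[{z : ℂ | 0 < z.im}] (x : ℂ)).NeBot := mem_closure_iff_nhdsWithin_neBot.1 hcl
      have t1 : Tendsto κt (𝓝[{z : ℂ | 0 < z.im}] (x : ℂ)) (𝓝 (κt x)) :=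
        (h.continuousOn x (by simp)).mono_left (nhdsWithin_mono _ fun z (hz : 0 < z.im) => hz.le)
      refine tendsto_nhds_unique t1 (tendsto_const_nhds.congr' ?_)
      filter_upwards [self_mem_nhdsWithin] with z hz using (hw z hz).symm
    have hwim : w.im = 0 := by rw [← hw z hz, ← h0]
    have hwre : w.re = 0 := by
      have := congrArg Complex.re (hκ.symm 0)
      rw [neg_zero, hw' 0] at this
      simp at this
      linarith
    refine hκ.ne_zero (funext fun x => ?_)
    rw [hw' x]
    exact Complex.ext hwre hwim
  · have ho := hop _ subset_rfl hU
    have hsub : κt '' {z : ℂ | 0 < z.im} ⊆ {z : ℂ | 0 ≤ z.im} := by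
      rintro _ ⟨y, hy, rfl⟩
      exact h.im_nonneg y (le_of_lt hy)
    have hmem := interior_maximal hsub ho ⟨z, hz, rfl⟩
    rw [Complex.interior_setOfPred_le_im] at hmem
    exact absurd h0 (ne_of_lt hmem)

/-! ### The fundamental solution of the Helmholtz equation -/

/-- The radial profile `e^{ikr} / r`. -/
noncomputable def helmholtzU (k : ℂ) (r : ℝ) : ℂ := Complex.exp (Complex.I * k * r) / r

/-- `r⁻¹ (d/dr)` applied to `e^{ikr} / r`. -/
noncomputable def helmholtzV (k : ℂ) (r : ℝ) : ℂ :=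
  Complex.exp (Complex.I * k * r) * (Complex.I * k / r ^ 2 - 1 / r ^ 3)

/-- `(r⁻¹ (d/dr))²` applied to `e^{ikr} / r`. -/
noncomputable def helmholtzW (k : ℂ) (r : ℝ) : ℂ :=
  Complex.exp (Complex.I * k * r) * (-k ^ 2 / r ^ 3 - 3 * Complex.I * k / r ^ 4 + 3 / r ^ 5)

theorem hasDerivAt_exp_I_mul (k : ℂ) (r : ℝ) :
    HasDerivAt (fun r : ℝ => Complex.exp (Complex.I * k * r))
      (Complex.I * k * Complex.exp (Complex.I * k * r)) r := by
  have h1 : HasDerivAt (fun r : ℝ => Complex.I * k * r) (Complex.I * k * 1) r :=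
    (Complex.ofRealCLM.hasDerivAt (x := r)).const_mul _
  exact h1.cexp.congr_deriv (by ring)

theorem hasDerivAt_helmholtzU (k : ℂ) {r : ℝ} (hr : 0 < r) :
    HasDerivAt (helmholtzU k) (r * helmholtzV k r) r := by
  have hr' : (r : ℂ) ≠ 0 := by exact_mod_cast hr.ne'
  refine ((hasDerivAt_exp_I_mul k r).div (Complex.ofRealCLM.hasDerivAt (x := r)) hr').congr_deriv ?_
  simp only [helmholtzV, Complex.ofRealCLM_apply, Complex.ofReal_one]
  field_simp

theorem hasDerivAt_helmholtzV (k : ℂ) {r : ℝ} (hr : 0 < r) :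
    HasDerivAt (helmholtzV k) (r * helmholtzW k r) r := by
  have hr' : (r : ℂ) ≠ 0 := by exact_mod_cast hr.ne'
  have h0 : HasDerivAt (fun r : ℝ => (r : ℂ)) 1 r := Complex.ofRealCLM.hasDerivAt (x := r)
  have h2 : HasDerivAt (fun r : ℝ => Complex.I * k / (r : ℂ) ^ 2 - 1 / (r : ℂ) ^ 3)
      (-2 * (Complex.I * k) / r ^ 3 + 3 / r ^ 4) r := by
    refine (((hasDerivAt_const r (Complex.I * k)).div (h0.pow 2) (pow_ne_zero _ hr')).sub
      ((hasDerivAt_const r (1 : ℂ)).div (h0.pow 3) (pow_ne_zero _ hr'))).congr_deriv ?_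
    simp only [Pi.pow_apply]
    push_cast
    field_simp
    ring
  refine ((hasDerivAt_exp_I_mul k r).mul h2).congr_deriv ?_
  simp only [helmholtzW]
  field_simp
  ring_nf
  simp only [Complex.I_sq]
  ring

/-- This is the radial Helmholtz equation `U'' + 2U'/r + k²U = 0`, rewritten with `U' = rV` and `U''
= V + r²W`. -/
theorem helmholtz_identity (k : ℂ) {r : ℝ} (hr : 0 < r) :
    3 * helmholtzV k r + r ^ 2 * helmholtzW k r + k ^ 2 * helmholtzU k r = 0 := by
  have hr' : (r : ℂ) ≠ 0 := by exact_mod_cast hr.ne'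
  simp only [helmholtzU, helmholtzV, helmholtzW]
  field_simp
  ring

theorem norm_exp_I_mul_le_one {k : ℂ} (hk : 0 ≤ k.im) {r : ℝ} (hr : 0 ≤ r) :
    ‖Complex.exp (Complex.I * k * r)‖ ≤ 1 := by
  rw [norm_exp_I_mul_mul, Real.exp_le_one_iff]
  nlinarith

theorem norm_helmholtzU_le {k : ℂ} (hk : 0 ≤ k.im) {r : ℝ} (hr : 0 ≤ r) :
    ‖helmholtzU k r‖ ≤ r⁻¹ := by
  rw [helmholtzU, norm_div, Complex.norm_real, Real.norm_of_nonneg hr, div_eq_mul_inv]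
  exact mul_le_of_le_one_left (inv_nonneg.2 hr) (norm_exp_I_mul_le_one hk hr)

theorem norm_helmholtzV_le {k : ℂ} (hk : 0 ≤ k.im) {ε r : ℝ} (hε : 0 < ε) (hr : ε ≤ r) :
    ‖helmholtzV k r‖ ≤ ‖k‖ / ε ^ 2 + 1 / ε ^ 3 := by
  have hr0 : 0 < r := hε.trans_le hr
  rw [helmholtzV, norm_mul]
  refine (mul_le_of_le_one_left (norm_nonneg _) (norm_exp_I_mul_le_one hk hr0.le)).trans ?_
  refine (norm_sub_le _ _).trans ?_
  simp only [norm_div, norm_mul, norm_pow, Complex.norm_I, Complex.norm_real,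
    Real.norm_of_nonneg hr0.le, one_mul, norm_one]
  gcongr

theorem norm_helmholtzW_le {k : ℂ} (hk : 0 ≤ k.im) {ε r : ℝ} (hε : 0 < ε) (hr : ε ≤ r) :
    ‖helmholtzW k r‖ ≤ ‖k‖ ^ 2 / ε ^ 3 + 3 * ‖k‖ / ε ^ 4 + 3 / ε ^ 5 := by
  have hr0 : 0 < r := hε.trans_le hr
  rw [helmholtzW, norm_mul]
  refine (mul_le_of_le_one_left (norm_nonneg _) (norm_exp_I_mul_le_one hk hr0.le)).trans ?_
  refine ((norm_add_le _ _).trans (add_le_add_left (norm_sub_le _ _) _)).trans ?_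
  simp only [norm_div, norm_mul, norm_pow, norm_neg, Complex.norm_I, Complex.norm_real,
    Real.norm_of_nonneg hr0.le, mul_one, Complex.norm_ofNat]
  gcongr

/-! ### Regularising the kernel at the origin -/

/-- The regularised radius `√(|x|² + ε²)`. -/
noncomputable def regRadius (ε : ℝ) (x : Space) : ℝ := Real.sqrt (‖x‖ ^ 2 + ε ^ 2)

theorem continuous_regRadius (ε : ℝ) : Continuous (regRadius ε) := by
  unfold regRadius
  fun_prop

theorem le_regRadius {ε : ℝ} (x : Space) : ε ≤ regRadius ε x :=
  Real.le_sqrt_of_sq_le (by nlinarith [sq_nonneg ‖x‖])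

theorem norm_le_regRadius {ε : ℝ} (x : Space) : ‖x‖ ≤ regRadius ε x :=
  Real.le_sqrt_of_sq_le (by nlinarith [sq_nonneg ε])

theorem regRadius_pos {ε : ℝ} (hε : 0 < ε) (x : Space) : 0 < regRadius ε x :=
  hε.trans_le (le_regRadius x)

theorem sq_regRadius (ε : ℝ) (x : Space) : regRadius ε x ^ 2 = ‖x‖ ^ 2 + ε ^ 2 :=
  Real.sq_sqrt (by positivity)

theorem hasDerivAt_regRadius {ε : ℝ} (hε : 0 < ε) (x : Space) (i : Fin 3) :
    HasDerivAt (fun t : ℝ => regRadius ε (x + t • EuclideanSpace.single i 1))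
      (x i / regRadius ε x) 0 := by
  have e : (fun t : ℝ => regRadius ε (x + t • EuclideanSpace.single i 1)) =
      fun t : ℝ => Real.sqrt (‖x‖ ^ 2 + 2 * (t * x i) + t ^ 2 + ε ^ 2) := by
    ext t
    rw [regRadius, norm_add_sq_real, inner_smul_right, norm_smul]
    simp [EuclideanSpace.inner_single_right]
  rw [e]
  have h1 : HasDerivAt (fun t : ℝ => ‖x‖ ^ 2 + 2 * (t * x i) + t ^ 2 + ε ^ 2) (2 * x i) 0 := by
    have h2 := (((((hasDerivAt_id (0 : ℝ)).mul_const (x i)).const_mul 2).const_add (‖x‖ ^ 2)).add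
      ((hasDerivAt_id (0 : ℝ)).pow 2)).add_const (ε ^ 2)
    exact h2.congr_deriv (by simp)
  refine (h1.sqrt (by simp; positivity)).congr_deriv ?_
  simp only [regRadius]
  norm_num
  rw [mul_div_mul_left _ _ two_ne_zero]

/-- The partial derivatives of the regularised radius are `x i / regRadius ε x`, just as for `|x|`.
Writing `P' = rQ` cancels the denominator, which is why the profiles are built with `r⁻¹ d/dr`. -/
theorem hasLineDerivAt_comp_regRadius {ε : ℝ} (hε : 0 < ε) {P Q : ℝ → ℂ}
    (hP : ∀ r : ℝ, 0 < r → HasDerivAt P (r * Q r) r) (x : Space) (i : Fin 3) :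
    HasLineDerivAt ℝ (fun x => P (regRadius ε x)) (x i * Q (regRadius ε x)) x
      (EuclideanSpace.single i 1) := by
  have h0 := regRadius_pos hε x
  have h0' : (regRadius ε x : ℂ) ≠ 0 := by exact_mod_cast h0.ne'
  have h1 := hasDerivAt_regRadius hε x i
  have h2 : HasDerivAt P (regRadius ε x * Q (regRadius ε x))
      (regRadius ε (x + (0 : ℝ) • EuclideanSpace.single i 1)) := by
    simpa using hP _ h0
  have h3 := HasDerivAt.scomp (0 : ℝ) h2 h1
  refine HasDerivAt.congr_deriv (f := fun t : ℝ =>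
    P (regRadius ε (x + t • EuclideanSpace.single i 1))) h3 ?_
  rw [Complex.real_smul]
  push_cast
  field_simp

theorem integrable_mul_schwartz {F : Space → ℂ} (hF : Continuous F) {C : ℝ}
    (hb : ∀ x, ‖F x‖ ≤ C * (1 + ‖x‖ ^ 2)) (g : 𝓢(Space, ℂ)) :
    Integrable fun x => F x * g x := by
  have h1 : Integrable fun x : Space => C * (‖g x‖ + ‖x‖ ^ 2 * ‖g x‖) :=
    (g.integrable.norm.add (g.integrable_pow_mul volume 2)).const_mul C
  refine h1.mono' (by fun_prop : Continuous _).aestronglyMeasurable (Eventually.of_forall fun x => ?_)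
  rw [norm_mul]
  calc _ ≤ C * (1 + ‖x‖ ^ 2) * ‖g x‖ := by gcongr; exact hb x
    _ = _ := by ring

theorem continuous_comp_regRadius {ε : ℝ} (hε : 0 < ε) {P Q : ℝ → ℂ}
    (hP : ∀ r : ℝ, 0 < r → HasDerivAt P (r * Q r) r) :
    Continuous fun x => P (regRadius ε x) := by
  rw [continuous_iff_continuousAt]
  intro x
  exact ContinuousAt.comp (g := P) (hP _ (regRadius_pos hε x)).continuousAt
    (continuous_regRadius ε).continuousAt

theorem continuous_helmholtzW_regRadius {ε : ℝ} (hε : 0 < ε) (k : ℂ) :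
    Continuous fun x => helmholtzW k (regRadius ε x) := by
  have h0 : ∀ x, (regRadius ε x : ℂ) ≠ 0 := fun x => by
    exact_mod_cast (regRadius_pos hε x).ne'
  have hc : Continuous fun x => (regRadius ε x : ℂ) :=
    Complex.continuous_ofReal.comp (continuous_regRadius ε)
  unfold helmholtzW
  refine Continuous.mul (by fun_prop) (((continuous_const.div (by fun_prop) fun x => ?_).sub
    (continuous_const.div (by fun_prop) fun x => ?_)).add
    (continuous_const.div (by fun_prop) fun x => ?_)) <;> exact pow_ne_zero _ (h0 x)

theorem norm_coord_le (x : Space) (i : Fin 3) : ‖(x i : ℂ)‖ ≤ ‖x‖ := by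
  rw [Complex.norm_real]
  exact PiLp.norm_apply_le x i

/-- Integration by parts for the regularised kernel. -/
theorem integral_regRadius_mul_lineDeriv {ε : ℝ} (hε : 0 < ε) {k : ℂ} (hk : 0 ≤ k.im)
    (g : 𝓢(Space, ℂ)) (i : Fin 3) :
    Integrable (fun x => (helmholtzV k (regRadius ε x) +
        x i * (x i * helmholtzW k (regRadius ε x))) * g x) ∧
    Integrable (fun x => helmholtzU k (regRadius ε x) *
        (∂_{EuclideanSpace.single i (1 : ℝ)} (∂_{EuclideanSpace.single i (1 : ℝ)} g)) x) ∧
    ∫ x, helmholtzU k (regRadius ε x) *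
        (∂_{EuclideanSpace.single i (1 : ℝ)} (∂_{EuclideanSpace.single i (1 : ℝ)} g)) x =
      ∫ x, (helmholtzV k (regRadius ε x) +
        x i * (x i * helmholtzW k (regRadius ε x))) * g x := by
  set e : Space := EuclideanSpace.single i (1 : ℝ) with he
  have cU := continuous_comp_regRadius hε (fun r hr => hasDerivAt_helmholtzU k hr)
  have cV := continuous_comp_regRadius hε (fun r hr => hasDerivAt_helmholtzV k hr)
  have cW := continuous_helmholtzW_regRadius hε k
  have ci : Continuous fun x : Space => (x i : ℂ) := by fun_prop
  set BV : ℝ := ‖k‖ / ε ^ 2 + 1 / ε ^ 3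
  set BW : ℝ := ‖k‖ ^ 2 / ε ^ 3 + 3 * ‖k‖ / ε ^ 4 + 3 / ε ^ 5
  have hBV : 0 ≤ BV := by positivity
  have hBW : 0 ≤ BW := by positivity
  have bU : ∀ x : Space, ‖helmholtzU k (regRadius ε x)‖ ≤ ε⁻¹ * (1 + ‖x‖ ^ 2) := fun x => by
    refine (norm_helmholtzU_le hk (regRadius_pos hε x).le).trans ?_
    calc (regRadius ε x)⁻¹ ≤ ε⁻¹ * 1 := by
          rw [mul_one]
          exact inv_anti₀ hε (le_regRadius x)
      _ ≤ _ := by gcongr; nlinarith [sq_nonneg ‖x‖]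
  have bV : ∀ x : Space, ‖(x i : ℂ) * helmholtzV k (regRadius ε x)‖ ≤ BV * (1 + ‖x‖ ^ 2) :=
    fun x => by
    rw [norm_mul, mul_comm]
    refine mul_le_mul (norm_helmholtzV_le hk hε (le_regRadius x)) ?_ (norm_nonneg _) hBV
    nlinarith [norm_coord_le x i, sq_nonneg (‖x‖ - 1), norm_nonneg x]
  have bW : ∀ x : Space, ‖helmholtzV k (regRadius ε x) +
      (x i : ℂ) * (x i * helmholtzW k (regRadius ε x))‖ ≤ (BV + BW) * (1 + ‖x‖ ^ 2) := fun x => by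
    refine (norm_add_le _ _).trans ?_
    have h1 := norm_helmholtzV_le hk hε (le_regRadius x)
    have h2 := norm_helmholtzW_le hk hε (le_regRadius x)
    rw [norm_mul, norm_mul]
    have h3 : ‖(x i : ℂ)‖ * (‖(x i : ℂ)‖ * ‖helmholtzW k (regRadius ε x)‖) ≤
        ‖x‖ * (‖x‖ * BW) := by
      gcongr <;> exact norm_coord_le x i
    calc _ ≤ BV + ‖x‖ * (‖x‖ * BW) := add_le_add h1 h3
      _ ≤ _ := by nlinarith [sq_nonneg ‖x‖, mul_nonneg hBV (sq_nonneg ‖x‖)]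
  have I1 := integrable_mul_schwartz cU bU (∂_{e} (∂_{e} g))
  have I1' := integrable_mul_schwartz cU bU (∂_{e} g)
  have I2 := integrable_mul_schwartz (ci.mul cV) bV (∂_{e} g)
  have I2' := integrable_mul_schwartz (ci.mul cV) bV g
  have I3 := integrable_mul_schwartz (cV.add (ci.mul (ci.mul cW))) bW g
  have dg : ∀ (g : 𝓢(Space, ℂ)) (x : Space), HasLineDerivAt ℝ g ((∂_{e} g) x) x e := fun g x => by
    rw [lineDerivOp_apply_eq_fderiv]
    exact (g.hasFDerivAt x).hasLineDerivAt e
  have dU : ∀ x : Space, HasLineDerivAt ℝ (fun x => helmholtzU k (regRadius ε x))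
      (x i * helmholtzV k (regRadius ε x)) x e := fun x =>
    hasLineDerivAt_comp_regRadius hε (fun r hr => hasDerivAt_helmholtzU k hr) x i
  have dV : ∀ x : Space, HasLineDerivAt ℝ (fun x : Space => (x i : ℂ) * helmholtzV k (regRadius ε x))
      (helmholtzV k (regRadius ε x) + x i * (x i * helmholtzW k (regRadius ε x))) x e := fun x => by
    have h1 := hasLineDerivAt_comp_regRadius hε (fun r hr => hasDerivAt_helmholtzV k hr) x i
    have h2 : HasLineDerivAt ℝ (fun x : Space => (x i : ℂ)) 1 x e := by
      have : HasDerivAt (fun t : ℝ => ((x i : ℂ) + t)) 1 0 :=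
        (Complex.ofRealCLM.hasDerivAt (x := (0 : ℝ))).const_add _
      refine this.congr_of_eventuallyEq (Eventually.of_forall fun t => ?_)
      simp [he]
    have h3 := HasDerivAt.mul h2 h1
    refine HasDerivAt.congr_deriv (f := fun t : ℝ => ((x + t • e) i : ℂ) *
      helmholtzV k (regRadius ε (x + t • e))) h3 ?_
    simp
  refine ⟨I3, I1, ?_⟩
  have e1 := integral_bilinear_hasLineDerivAt_right_eq_neg_left_of_integrable (μ := volume)
    (B := ContinuousLinearMap.mul ℝ ℂ) I2 I1 I1' (fun x _ => dU x) (fun x _ => dg (∂_{e} g) x)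
  have e2 := integral_bilinear_hasLineDerivAt_right_eq_neg_left_of_integrable (μ := volume)
    (B := ContinuousLinearMap.mul ℝ ℂ) I3 I2 I2' (fun x _ => dV x) (fun x _ => dg g x)
  simp only [ContinuousLinearMap.mul_apply'] at e1 e2
  rw [e1, e2, neg_neg]
  rfl

/-- Summing the integrations by parts over the coordinates gives `3V + |x|²W`. Since `|x|² = r² -
ε²` for the regularised radius `r`, the radial Helmholtz equation cancels everything except `-ε²W`.
-/
theorem integral_regRadius_mul_helmholtz {ε : ℝ} (hε : 0 < ε) {k : ℂ} (hk : 0 ≤ k.im)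
    (g : 𝓢(Space, ℂ)) :
    ∫ x, helmholtzU k (regRadius ε x) * (Δ g + k ^ 2 • g) x =
      -∫ x, ε ^ 2 * helmholtzW k (regRadius ε x) * g x := by
  have hI := fun i => integral_regRadius_mul_lineDeriv hε hk g i
  have cU := continuous_comp_regRadius hε (fun r hr => hasDerivAt_helmholtzU k hr)
  have IU : Integrable fun x => helmholtzU k (regRadius ε x) * g x := by
    refine integrable_mul_schwartz cU (C := ε⁻¹) (fun x => ?_) g
    refine (norm_helmholtzU_le hk (regRadius_pos hε x).le).trans ?_
    calc (regRadius ε x)⁻¹ ≤ ε⁻¹ * 1 := by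
          rw [mul_one]
          exact inv_anti₀ hε (le_regRadius x)
      _ ≤ _ := by gcongr; nlinarith [sq_nonneg ‖x‖]
  have e1 : ∀ x, helmholtzU k (regRadius ε x) * (Δ g + k ^ 2 • g) x =
      (∑ i : Fin 3, helmholtzU k (regRadius ε x) *
        (∂_{EuclideanSpace.single i (1 : ℝ)} (∂_{EuclideanSpace.single i (1 : ℝ)} g)) x) +
      k ^ 2 * (helmholtzU k (regRadius ε x) * g x) := by
    intro x
    rw [SchwartzMap.laplacian_eq_sum (EuclideanSpace.basisFun (Fin 3) ℝ)]
    simp only [add_apply, smul_apply, sum_apply, EuclideanSpace.basisFun_apply, smul_eq_mul,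
      Finset.mul_sum, mul_add]
    ring
  simp_rw [e1]
  rw [integral_add (integrable_finsetSum _ fun i _ => (hI i).2.1) (IU.const_mul _),
    integral_finsetSum _ fun i _ => (hI i).2.1, Finset.sum_congr rfl fun i _ => (hI i).2.2,
    ← integral_finsetSum _ fun i _ => (hI i).1,
    ← integral_add (integrable_finsetSum _ fun i _ => (hI i).1) (IU.const_mul _), ← integral_neg]
  refine integral_congr_ae (Eventually.of_forall fun x => ?_)
  have h1 := helmholtz_identity k (regRadius_pos hε x)
  have h2 : (regRadius ε x : ℂ) ^ 2 = x 0 ^ 2 + x 1 ^ 2 + x 2 ^ 2 + ε ^ 2 := by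
    have := sq_regRadius ε x
    rw [EuclideanSpace.norm_sq_eq, Fin.sum_univ_three] at this
    simp only [Real.norm_eq_abs, sq_abs] at this
    exact_mod_cast this
  rw [h2] at h1
  simp only [Fin.sum_univ_three]
  linear_combination g x * h1

/-! ### The limit of vanishing regularisation -/

/-- In polar coordinates the density `r²` compensates `r^{-p}` up to `p = 2`. -/
theorem integrable_indicator_inv_norm_pow {p : ℕ} (hp : p ≤ 2) :
    Integrable ((Metric.ball (0 : Space) 1).indicator fun x => (‖x‖ ^ p)⁻¹) := by
  have e : ((Metric.ball (0 : Space) 1).indicator fun x => (‖x‖ ^ p)⁻¹) =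
      fun x : Space => (Iio (1 : ℝ)).indicator (fun r => (r ^ p)⁻¹) ‖x‖ := by
    ext x
    simp [indicator]
  rw [e, integrable_fun_norm_addHaar]
  simp only [finrank_euclideanSpace, Fintype.card_fin]
  have h1 : IntegrableOn ((Iio (1 : ℝ)).indicator fun _ => (1 : ℝ)) (Ioi 0) := by
    rw [IntegrableOn, integrable_indicator_iff measurableSet_Iio, IntegrableOn,
      Measure.restrict_restrict measurableSet_Iio]
    refine integrableOn_const (ne_of_lt ?_)
    refine (measure_mono (t := Icc (0 : ℝ) 1) fun x hx => ⟨le_of_lt hx.2, le_of_lt hx.1⟩).trans_lt ?_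
    simp
  refine h1.mono' ?_ ?_
  · refine Measurable.aestronglyMeasurable ?_
    exact (measurable_id.pow_const _).smul
      (((measurable_id.pow_const p).inv).indicator measurableSet_Iio)
  · refine (ae_restrict_iff' measurableSet_Ioi).2 (Eventually.of_forall fun r (hr : 0 < r) => ?_)
    by_cases h : r < 1
    · simp only [indicator, mem_Iio, h, if_true, smul_eq_mul, norm_mul, norm_inv, norm_pow,
        Real.norm_of_nonneg hr.le]
      rw [← div_eq_mul_inv, div_le_one (by positivity)]
      exact pow_le_pow_of_le_one hr.le h.le hp
    · simp [indicator, h]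

theorem inv_norm_pow_le (p : ℕ) (x : Space) :
    (‖x‖ ^ p)⁻¹ ≤ (Metric.ball (0 : Space) 1).indicator (fun x => (‖x‖ ^ p)⁻¹) x + 1 := by
  by_cases h : ‖x‖ < 1
  · simp [indicator, h]
  · have : (‖x‖ ^ p)⁻¹ ≤ 1 := inv_le_one_of_one_le₀ (one_le_pow₀ (not_lt.1 h))
    simpa [indicator, h] using this

theorem integrable_inv_norm_pow_mul {p : ℕ} (hp : p ≤ 2) (g : 𝓢(Space, ℂ)) :
    Integrable fun x => (‖x‖ ^ p)⁻¹ * ‖g x‖ := by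
  have h1 := (((integrable_indicator_inv_norm_pow hp).mul_const
    (SchwartzMap.seminorm ℝ 0 0 g)).add g.integrable.norm)
  refine h1.mono' ?_ (Eventually.of_forall fun x => ?_)
  · exact Measurable.aestronglyMeasurable (by fun_prop)
  · rw [Real.norm_of_nonneg (by positivity)]
    have h2 : 0 ≤ (Metric.ball (0 : Space) 1).indicator (fun x => (‖x‖ ^ p)⁻¹) x :=
      indicator_nonneg (fun _ _ => by positivity) _
    calc _ ≤ ((Metric.ball (0 : Space) 1).indicator (fun x => (‖x‖ ^ p)⁻¹) x + 1) * ‖g x‖ := by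
          gcongr
          exact inv_norm_pow_le p x
      _ = (Metric.ball (0 : Space) 1).indicator (fun x => (‖x‖ ^ p)⁻¹) x * ‖g x‖ + ‖g x‖ := by ring
      _ ≤ _ := by
        simp only [Pi.add_apply]
        gcongr
        exact norm_le_seminorm ℝ g x

theorem tendsto_regRadius (x : Space) :
    Tendsto (fun ε => regRadius ε x) (𝓝[>] 0) (𝓝 ‖x‖) := by
  have : Continuous fun ε : ℝ => regRadius ε x := by unfold regRadius; fun_prop
  have h := this.tendsto 0
  simp only [regRadius, zero_pow two_ne_zero, add_zero, Real.sqrt_sq (norm_nonneg x)] at h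
  exact h.mono_left nhdsWithin_le_nhds

theorem tendsto_integral_helmholtzU {k : ℂ} (hk : 0 ≤ k.im) (g : 𝓢(Space, ℂ)) :
    Tendsto (fun ε => ∫ x, helmholtzU k (regRadius ε x) * g x) (𝓝[>] 0)
      (𝓝 (∫ x, helmholtzU k ‖x‖ * g x)) := by
  refine tendsto_integral_filter_of_dominated_convergence (fun x => (‖x‖ ^ 1)⁻¹ * ‖g x‖) ?_ ?_
    (integrable_inv_norm_pow_mul (by norm_num) g) ?_
  · filter_upwards [self_mem_nhdsWithin] with ε hε
    exact ((continuous_comp_regRadius hε (fun r hr => hasDerivAt_helmholtzU k hr)).mul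
      g.continuous).aestronglyMeasurable
  · filter_upwards [self_mem_nhdsWithin] with ε hε
    filter_upwards [Measure.ae_ne volume (0 : Space)] with x hx
    rw [norm_mul, pow_one]
    gcongr
    refine (norm_helmholtzU_le hk (regRadius_pos hε x).le).trans ?_
    exact inv_anti₀ (norm_pos_iff.2 hx) (norm_le_regRadius x)
  · filter_upwards [Measure.ae_ne volume (0 : Space)] with x hx
    refine Tendsto.mul_const _ ?_
    exact (hasDerivAt_helmholtzU k (norm_pos_iff.2 hx)).continuousAt.tendsto.comp
      (tendsto_regRadius x)

/-- Since `ε² ≤ r²` for the regularised radius `r`, the terms in `r⁻³` and `r⁻⁴` are dominated by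
`|x|⁻¹` and `|x|⁻²`, both integrable against `g`. The `r⁻⁵` term is left out: the same estimate
would give `|x|⁻³`, and this term produces the point mass. -/
theorem tendsto_integral_lower_order {k : ℂ} (hk : 0 ≤ k.im) (g : 𝓢(Space, ℂ)) :
    Tendsto (fun ε : ℝ => ∫ x, ε ^ 2 * (Complex.exp (Complex.I * k * regRadius ε x) *
      (-k ^ 2 / regRadius ε x ^ 3 - 3 * Complex.I * k / regRadius ε x ^ 4)) * g x) (𝓝[>] 0)
      (𝓝 0) := by
  rw [← integral_zero Space ℂ]
  have hdom : Integrable fun x : Space =>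
      (‖k‖ ^ 2 * ((‖x‖ ^ 1)⁻¹ * ‖g x‖) + 3 * ‖k‖ * ((‖x‖ ^ 2)⁻¹ * ‖g x‖)) :=
    ((integrable_inv_norm_pow_mul (by norm_num) g).const_mul _).add
      ((integrable_inv_norm_pow_mul le_rfl g).const_mul _)
  have hne : ∀ ε ∈ Ioi (0 : ℝ), ∀ x, (regRadius ε x : ℂ) ≠ 0 := fun ε hε x => by
    exact_mod_cast (regRadius_pos hε x).ne'
  refine tendsto_integral_filter_of_dominated_convergence _ ?_ ?_ hdom ?_
  · filter_upwards [self_mem_nhdsWithin] with ε hε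
    have hc : Continuous fun x => (regRadius ε x : ℂ) :=
      Complex.continuous_ofReal.comp (continuous_regRadius ε)
    refine Continuous.aestronglyMeasurable ((continuous_const.mul (Continuous.mul (by fun_prop)
      ((continuous_const.div (by fun_prop) fun x => ?_).sub
      (continuous_const.div (by fun_prop) fun x => ?_)))).mul g.continuous) <;>
    exact pow_ne_zero _ (hne ε hε x)
  · filter_upwards [self_mem_nhdsWithin] with ε hε
    filter_upwards [Measure.ae_ne volume (0 : Space)] with x hx
    have hε' : (0 : ℝ) < ε := hε
    have hr := regRadius_pos hε x
    have hx0 := norm_pos_iff.2 hx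
    have hs : ε ^ 2 ≤ regRadius ε x ^ 2 := by
      have := le_regRadius (ε := ε) x
      gcongr
    have h1 : ε ^ 2 / regRadius ε x ^ 3 ≤ (‖x‖ ^ 1)⁻¹ := by
      calc ε ^ 2 / regRadius ε x ^ 3 ≤ regRadius ε x ^ 2 / regRadius ε x ^ 3 := by gcongr
        _ = (regRadius ε x)⁻¹ := by field_simp
        _ ≤ _ := by rw [pow_one]; exact inv_anti₀ hx0 (norm_le_regRadius x)
    have h2 : ε ^ 2 / regRadius ε x ^ 4 ≤ (‖x‖ ^ 2)⁻¹ := by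
      calc ε ^ 2 / regRadius ε x ^ 4 ≤ regRadius ε x ^ 2 / regRadius ε x ^ 4 := by gcongr
        _ = (regRadius ε x ^ 2)⁻¹ := by field_simp
        _ ≤ _ := inv_anti₀ (by positivity) (by have := norm_le_regRadius (ε := ε) x; gcongr)
    have h3 : ‖-k ^ 2 / (regRadius ε x : ℂ) ^ 3 - 3 * Complex.I * k / (regRadius ε x : ℂ) ^ 4‖ ≤
        ‖k‖ ^ 2 / regRadius ε x ^ 3 + 3 * ‖k‖ / regRadius ε x ^ 4 := by
      refine (norm_sub_le _ _).trans_eq ?_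
      simp only [norm_div, norm_mul, norm_pow, norm_neg, Complex.norm_I, Complex.norm_real,
        Real.norm_of_nonneg hr.le, mul_one, Complex.norm_ofNat]
    have h4 := norm_exp_I_mul_le_one hk hr.le
    rw [norm_mul, norm_mul, norm_mul, norm_pow, Complex.norm_real, Real.norm_of_nonneg hε'.le]
    calc _ ≤ ε ^ 2 * (1 * (‖k‖ ^ 2 / regRadius ε x ^ 3 + 3 * ‖k‖ / regRadius ε x ^ 4)) * ‖g x‖ := by
          gcongr
      _ = ‖k‖ ^ 2 * (ε ^ 2 / regRadius ε x ^ 3 * ‖g x‖) +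
          3 * ‖k‖ * (ε ^ 2 / regRadius ε x ^ 4 * ‖g x‖) := by ring
      _ ≤ _ := by gcongr
  · filter_upwards [Measure.ae_ne volume (0 : Space)] with x hx
    have hx0 : (‖x‖ : ℂ) ≠ 0 := by exact_mod_cast (norm_pos_iff.2 hx).ne'
    have ht : Tendsto (fun ε : ℝ => (regRadius ε x : ℂ)) (𝓝[>] 0) (𝓝 ‖x‖) :=
      (Complex.continuous_ofReal.tendsto _).comp (tendsto_regRadius x)
    have hε : Tendsto (fun ε : ℝ => (ε : ℂ) ^ 2) (𝓝[>] 0) (𝓝 0) := by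
      have : Continuous fun ε : ℝ => (ε : ℂ) ^ 2 := by fun_prop
      simpa using (this.tendsto 0).mono_left (nhdsWithin_le_nhds (s := Ioi (0 : ℝ)))
    have hexp : Tendsto (fun ε : ℝ => Complex.exp (Complex.I * k * regRadius ε x)) (𝓝[>] 0)
        (𝓝 (Complex.exp (Complex.I * k * ‖x‖))) :=
      (Complex.continuous_exp.tendsto _).comp (ht.const_mul _)
    have := (hε.mul (hexp.mul (((tendsto_const_nhds (x := -k ^ 2)).div (ht.pow 3)
      (pow_ne_zero _ hx0)).sub ((tendsto_const_nhds (x := 3 * Complex.I * k)).div (ht.pow 4)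
      (pow_ne_zero _ hx0))))).mul_const (g x)
    simpa using this

theorem regRadius_smul {ε : ℝ} (hε : 0 < ε) (x : Space) :
    regRadius ε (ε • x) = ε * regRadius 1 x := by
  rw [regRadius, regRadius, norm_smul, Real.norm_of_nonneg hε.le,
    show (ε * ‖x‖) ^ 2 + ε ^ 2 = ε ^ 2 * (‖x‖ ^ 2 + 1 ^ 2) by ring, Real.sqrt_mul (by positivity),
    Real.sqrt_sq hε.le]

/-- An explicit primitive for the radial integral of `(r² + 1)^{-5/2}` over space. Its limit `1/3`
at infinity becomes the constant `4π/3`. -/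
theorem hasDerivAt_cube_div (r : ℝ) :
    HasDerivAt (fun r : ℝ => r ^ 3 / (3 * Real.sqrt (r ^ 2 + 1) ^ 3))
      (r ^ 2 * (Real.sqrt (r ^ 2 + 1) ^ 5)⁻¹) r := by
  have h0 : 0 < r ^ 2 + 1 := by positivity
  have hs := Real.sqrt_pos.2 h0
  have h1 : HasDerivAt (fun r : ℝ => Real.sqrt (r ^ 2 + 1)) (r / Real.sqrt (r ^ 2 + 1)) r := by
    refine ((((hasDerivAt_id r).pow 2).add_const 1).sqrt h0.ne').congr_deriv ?_
    simp
    field_simp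
  have h3 : 3 * Real.sqrt (r ^ 2 + 1) ^ 3 ≠ 0 := by positivity
  refine (((hasDerivAt_id r).pow 3).div ((h1.pow 3).const_mul 3) h3).congr_deriv ?_
  have h2 := Real.sq_sqrt h0.le
  have h4 : Real.sqrt (r ^ 2 + 1) ^ 4 = (r ^ 2 + 1) ^ 2 := by
    rw [show 4 = 2 * 2 from rfl, pow_mul, h2]
  simp only [Pi.pow_apply, id]
  set s := Real.sqrt (r ^ 2 + 1)
  field_simp
  norm_num
  rw [h2]
  linear_combination 3 * r ^ 2 * h4

theorem tendsto_cube_div :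
    Tendsto (fun r : ℝ => r ^ 3 / (3 * Real.sqrt (r ^ 2 + 1) ^ 3)) atTop (𝓝 (1 / 3)) := by
  have h1 : Tendsto (fun r : ℝ => 1 / (3 * Real.sqrt (1 + (r⁻¹) ^ 2) ^ 3)) atTop
      (𝓝 (1 / (3 * Real.sqrt (1 + 0 ^ 2) ^ 3))) := by
    have hc : Continuous fun s : ℝ => 1 / (3 * Real.sqrt (1 + s ^ 2) ^ 3) := by
      refine continuous_const.div (by fun_prop) fun s => ?_
      have : 0 < Real.sqrt (1 + s ^ 2) := Real.sqrt_pos.2 (by positivity)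
      positivity
    exact (hc.tendsto 0).comp tendsto_inv_atTop_zero
  have h2 : (1 / (3 * Real.sqrt (1 + 0 ^ 2) ^ 3) : ℝ) = 1 / 3 := by norm_num
  rw [h2] at h1
  refine h1.congr' ?_
  filter_upwards [eventually_gt_atTop 0] with r hr
  have h3 : Real.sqrt (r ^ 2 + 1) = r * Real.sqrt (1 + r⁻¹ ^ 2) := by
    rw [show r ^ 2 + 1 = r ^ 2 * (1 + r⁻¹ ^ 2) by field_simp, Real.sqrt_mul (by positivity),
      Real.sqrt_sq hr.le]
  rw [h3]
  have : 0 < Real.sqrt (1 + r⁻¹ ^ 2) := Real.sqrt_pos.2 (by positivity)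
  field_simp

theorem integral_inv_regRadius_pow :
    Integrable (fun x : Space => (regRadius 1 x ^ 5)⁻¹) ∧
    ∫ x : Space, (regRadius 1 x ^ 5)⁻¹ = 4 * Real.pi / 3 := by
  have e : (fun x : Space => (regRadius 1 x ^ 5)⁻¹) =
      fun x : Space => (fun r : ℝ => (Real.sqrt (r ^ 2 + 1) ^ 5)⁻¹) ‖x‖ := by
    ext x
    simp [regRadius]
  have hcont : ContinuousWithinAt (fun r : ℝ => r ^ 3 / (3 * Real.sqrt (r ^ 2 + 1) ^ 3))
      (Ici 0) 0 := (hasDerivAt_cube_div 0).continuousAt.continuousWithinAt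
  have hpos : ∀ r ∈ Ioi (0 : ℝ), 0 ≤ r ^ 2 * (Real.sqrt (r ^ 2 + 1) ^ 5)⁻¹ := fun r _ => by
    positivity
  have hi := integrableOn_Ioi_deriv_of_nonneg hcont (fun r _ => hasDerivAt_cube_div r) hpos
    tendsto_cube_div
  have hv := integral_Ioi_of_hasDerivAt_of_nonneg hcont (fun r _ => hasDerivAt_cube_div r) hpos
    tendsto_cube_div
  have hb : (volume : Measure Space).real (Metric.ball 0 1) = 4 * Real.pi / 3 := by
    rw [measureReal_def, EuclideanSpace.volume_ball_fin_three]
    rw [ENNReal.ofReal_one, one_pow, one_mul, ENNReal.toReal_ofReal (by positivity)]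
    ring
  rw [e]
  refine ⟨?_, ?_⟩
  · rw [integrable_fun_norm_addHaar volume (f := fun r : ℝ => (Real.sqrt (r ^ 2 + 1) ^ 5)⁻¹)]
    simpa [finrank_euclideanSpace] using hi
  · rw [integral_fun_norm_addHaar volume (fun r : ℝ => (Real.sqrt (r ^ 2 + 1) ^ 5)⁻¹), hb]
    simp only [finrank_euclideanSpace, Fintype.card_fin, smul_eq_mul, nsmul_eq_mul]
    rw [show (3 - 1 : ℕ) = 2 from rfl, hv]
    norm_num
    ring

/-- An approximate identity: substituting `εx` for `x` removes every power of `ε` and leaves `3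
(|x|² + 1)^{-5/2}` times a bounded factor tending to `g 0`. The total mass is `3 · 4π/3 = 4π`. -/
theorem tendsto_integral_main {k : ℂ} (hk : 0 ≤ k.im) (g : 𝓢(Space, ℂ)) :
    Tendsto (fun ε : ℝ => ∫ x, ε ^ 2 * (Complex.exp (Complex.I * k * regRadius ε x) *
      (3 / regRadius ε x ^ 5)) * g x) (𝓝[>] 0) (𝓝 (4 * Real.pi * g 0)) := by
  obtain ⟨hi, hv⟩ := integral_inv_regRadius_pow
  have e : ∀ᶠ ε : ℝ in 𝓝[>] 0, ∫ x : Space, 3 * ((regRadius 1 x ^ 5)⁻¹ : ℝ) *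
        (Complex.exp (Complex.I * k * (ε * regRadius 1 x : ℝ)) * g (ε • x)) =
      ∫ x, ε ^ 2 * (Complex.exp (Complex.I * k * regRadius ε x) *
      (3 / regRadius ε x ^ 5)) * g x := by
    filter_upwards [self_mem_nhdsWithin] with ε (hε : 0 < ε)
    have hε' : (ε : ℂ) ≠ 0 := by exact_mod_cast hε.ne'
    have h := Measure.integral_comp_smul (volume : Measure Space)
      (fun x => ε ^ 2 * (Complex.exp (Complex.I * k * regRadius ε x) *
      (3 / regRadius ε x ^ 5)) * g x) ε
    rw [finrank_euclideanSpace, Fintype.card_fin, abs_of_pos (by positivity)] at h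
    have h' : ∫ x, ε ^ 2 * (Complex.exp (Complex.I * k * regRadius ε x) *
        (3 / regRadius ε x ^ 5)) * g x = (ε ^ 3 : ℝ) • ∫ x, ε ^ 2 * (Complex.exp (Complex.I * k *
        regRadius ε (ε • x)) * (3 / regRadius ε (ε • x) ^ 5)) * g (ε • x) := by
      rw [h, smul_smul, mul_inv_cancel₀ (by positivity), one_smul]
    rw [h', ← integral_smul]
    refine integral_congr_ae (Eventually.of_forall fun x => ?_)
    have hr : (regRadius 1 x : ℂ) ≠ 0 := by exact_mod_cast (regRadius_pos one_pos x).ne'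
    simp only [regRadius_smul hε, Complex.real_smul]
    push_cast
    field_simp
  refine Tendsto.congr' e ?_
  have hlim : (4 * Real.pi * g 0 : ℂ) =
      ∫ x : Space, 3 * ((regRadius 1 x ^ 5)⁻¹ : ℝ) * (1 * g 0) := by
    rw [integral_mul_const, integral_const_mul, integral_complex_ofReal, hv]
    push_cast
    ring
  rw [hlim]
  refine tendsto_integral_filter_of_dominated_convergence
    (fun x : Space => 3 * (regRadius 1 x ^ 5)⁻¹ * SchwartzMap.seminorm ℝ 0 0 g) ?_ ?_
    ((hi.const_mul 3).mul_const _) ?_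
  · refine Eventually.of_forall fun ε => Measurable.aestronglyMeasurable ?_
    have hm := (continuous_regRadius 1).measurable
    fun_prop
  · filter_upwards [self_mem_nhdsWithin] with ε (hε : 0 < ε)
    refine Eventually.of_forall fun x => ?_
    have hr := regRadius_pos one_pos x
    have h1 := norm_exp_I_mul_le_one hk (r := ε * regRadius 1 x) (by positivity)
    have h2 := norm_le_seminorm ℝ g (ε • x)
    rw [norm_mul, norm_mul, norm_mul, Complex.norm_real, Real.norm_of_nonneg (by positivity),
      Complex.norm_ofNat]
    calc _ ≤ 3 * (regRadius 1 x ^ 5)⁻¹ * (1 * SchwartzMap.seminorm ℝ 0 0 g) := by gcongr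
      _ = _ := by rw [one_mul]
  · refine Eventually.of_forall fun x => Tendsto.const_mul _ ?_
    have hc : Continuous fun ε : ℝ =>
      Complex.exp (Complex.I * k * (ε * regRadius 1 x : ℝ)) * g (ε • x) := by fun_prop
    have := (hc.tendsto 0).mono_left (nhdsWithin_le_nhds (s := Ioi (0 : ℝ)))
    simpa using this

theorem integral_helmholtzU_mul_zero {k : ℂ} (hk : 0 ≤ k.im) (g : 𝓢(Space, ℂ)) :
    ∫ x, helmholtzU k ‖x‖ * (Δ g + k ^ 2 • g) x = -(4 * Real.pi * g 0) := by
  have t1 := tendsto_integral_helmholtzU hk (Δ g + k ^ 2 • g)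
  have t2 := ((tendsto_integral_lower_order hk g).add (tendsto_integral_main hk g)).neg
  rw [zero_add] at t2
  refine tendsto_nhds_unique t1 (t2.congr' ?_)
  filter_upwards [self_mem_nhdsWithin] with ε (hε : 0 < ε)
  have hc : Continuous fun x => (regRadius ε x : ℂ) :=
    Complex.continuous_ofReal.comp (continuous_regRadius ε)
  have hne : ∀ x, (regRadius ε x : ℂ) ≠ 0 := fun x => by
    exact_mod_cast (regRadius_pos hε x).ne'
  rw [integral_regRadius_mul_helmholtz hε hk g, neg_inj]
  have hint : ∀ (c d e : ℂ), Integrable fun x => ε ^ 2 * (Complex.exp (Complex.I * k *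
      regRadius ε x) * (c / regRadius ε x ^ 3 - d / regRadius ε x ^ 4 + e / regRadius ε x ^ 5)) *
      g x := by
    intro c d e
    refine integrable_mul_schwartz (C := ε ^ 2 * (‖c‖ / ε ^ 3 + ‖d‖ / ε ^ 4 + ‖e‖ / ε ^ 5)) ?_
      (fun x => ?_) g
    · refine continuous_const.mul (Continuous.mul (by fun_prop)
        (((continuous_const.div (by fun_prop) fun x => ?_).sub
        (continuous_const.div (by fun_prop) fun x => ?_)).add
        (continuous_const.div (by fun_prop) fun x => ?_))) <;> exact pow_ne_zero _ (hne x)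
    · have hr := regRadius_pos hε x
      have hle := le_regRadius (ε := ε) x
      rw [norm_mul, norm_mul, norm_pow, Complex.norm_real, Real.norm_of_nonneg hε.le]
      have h1 : ‖c / (regRadius ε x : ℂ) ^ 3 - d / (regRadius ε x : ℂ) ^ 4 +
          e / (regRadius ε x : ℂ) ^ 5‖ ≤ ‖c‖ / ε ^ 3 + ‖d‖ / ε ^ 4 + ‖e‖ / ε ^ 5 := by
        refine ((norm_add_le _ _).trans (add_le_add_left (norm_sub_le _ _) _)).trans ?_
        simp only [norm_div, norm_pow, Complex.norm_real, Real.norm_of_nonneg hr.le]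
        gcongr
      calc _ ≤ ε ^ 2 * (1 * (‖c‖ / ε ^ 3 + ‖d‖ / ε ^ 4 + ‖e‖ / ε ^ 5)) := by
            gcongr
            exact norm_exp_I_mul_le_one hk hr.le
        _ ≤ _ := by
            rw [one_mul]
            refine le_mul_of_one_le_right (by positivity) ?_
            nlinarith [sq_nonneg ‖x‖]
  -- The two choices of coefficients are the lower order part and the `r⁻⁵` part of `helmholtzW`,
  -- whose limits are known separately.
  have i1 := hint (-k ^ 2) (3 * Complex.I * k) 0
  have i2 := hint 0 0 3
  simp only [zero_div, sub_zero, zero_add, add_zero] at i1 i2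
  rw [← integral_add i1 i2]
  refine integral_congr_ae (Eventually.of_forall fun x => ?_)
  simp only [helmholtzW]
  ring

/-- `e^{ik|x|} / (4π|x|)` is a fundamental solution of `-(Δ + k²)`. -/
theorem integral_helmholtzU_mul {k : ℂ} (hk : 0 ≤ k.im) (g : 𝓢(Space, ℂ)) (y : Space) :
    ∫ x, helmholtzU k ‖x - y‖ * (Δ g + k ^ 2 • g) x = -(4 * Real.pi * g y) := by
  set G : 𝓢(Space, ℂ) := g.compSubConstCLM ℂ (-y) with hG
  have hGa : ∀ x, G x = g (x + y) := fun x => by simp [hG]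
  have hline : ∀ (f : 𝓢(Space, ℂ)) (v x : Space),
      (∂_{v} (f.compSubConstCLM ℂ (-y))) x = (∂_{v} f) (x + y) := by
    intro f v x
    rw [lineDerivOp_apply_eq_fderiv, lineDerivOp_apply_eq_fderiv]
    have : ⇑(f.compSubConstCLM ℂ (-y)) = fun x => f (x + y) := by
      ext x
      simp
    rw [this, fderiv_comp_add_right]
  have hline' : ∀ (f : 𝓢(Space, ℂ)) (v : Space),
      ∂_{v} (f.compSubConstCLM ℂ (-y)) = (∂_{v} f).compSubConstCLM ℂ (-y) := by
    intro f v
    ext x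
    rw [hline]
    simp
  have hlap : ∀ x, (Δ G) x = (Δ g) (x + y) := by
    intro x
    rw [SchwartzMap.laplacian_eq_sum (EuclideanSpace.basisFun (Fin 3) ℝ),
      SchwartzMap.laplacian_eq_sum (EuclideanSpace.basisFun (Fin 3) ℝ), sum_apply, sum_apply]
    refine Finset.sum_congr rfl fun i _ => ?_
    rw [hG, hline', hline]
  have h := integral_helmholtzU_mul_zero hk G
  rw [hGa, zero_add] at h
  rw [← h, ← integral_add_right_eq_self _ y]
  refine integral_congr_ae (Eventually.of_forall fun x => ?_)
  simp only [add_apply, smul_apply, hlap, hGa, add_sub_cancel_right]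

/-! ### Slices of Schwartz functions on space-time -/

theorem event_eq (t : ℝ) (x : Space) : event t x = t • event 1 0 + event 0 x := by
  simp [event, ← WithLp.toLp_smul, ← WithLp.toLp_add]

@[simp]
theorem event_fst (t : ℝ) (x : Space) : (event t x).fst = t := rfl

@[simp]
theorem event_snd (t : ℝ) (x : Space) : (event t x).snd = x := rfl

theorem event_fst_snd (z : SpaceTime) : event z.fst z.snd = z := rfl

theorem continuous_event : Continuous fun q : ℝ × Space => event q.1 q.2 :=
  (WithLp.prodContinuousLinearEquiv 2 ℝ ℝ Space).symm.continuous

theorem abs_le_norm_event (t : ℝ) (x : Space) : |t| ≤ ‖event t x‖ := by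
  simpa using WithLp.norm_fst_le (p := 2) (x := event t x)

theorem norm_le_norm_event (t : ℝ) (x : Space) : ‖x‖ ≤ ‖event t x‖ := by
  simpa using WithLp.norm_snd_le (p := 2) (x := event t x)

theorem inner_event (s t : ℝ) (x y : Space) :
    inner ℝ (event s x) (event t y) = s * t + inner ℝ x y := by
  rw [WithLp.prod_inner_apply]
  simp [event, mul_comm]

theorem hasTemperateGrowth_event_left (x : Space) :
    (fun t : ℝ => event t x).HasTemperateGrowth := by
  have h := ((ContinuousLinearMap.toSpanSingleton ℝ (event 1 0)).hasTemperateGrowth).add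
    (Function.HasTemperateGrowth.const (event 0 x))
  convert h using 1
  ext1 t
  simpa using event_eq t x

theorem hasTemperateGrowth_event_right (t : ℝ) :
    (fun x : Space => event t x).HasTemperateGrowth := by
  have h := (((WithLp.prodContinuousLinearEquiv 2 ℝ ℝ Space).symm : ℝ × Space →L[ℝ] SpaceTime) ∘L
    (ContinuousLinearMap.inr ℝ ℝ Space)).hasTemperateGrowth.add
    (Function.HasTemperateGrowth.const (event t 0))
  convert h using 1
  ext1 x
  simp [event, ← WithLp.toLp_add]

/-- The restriction of a Schwartz function on space-time to the time axis through `x`. -/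
noncomputable def timeSlice (x : Space) : 𝓢(SpaceTime, ℂ) →L[ℂ] 𝓢(ℝ, ℂ) :=
  compCLM ℂ (hasTemperateGrowth_event_left x)
    ⟨1, 1, fun t => by
      have := abs_le_norm_event t x
      simp only [Real.norm_eq_abs, pow_one, one_mul]
      linarith⟩

@[simp]
theorem timeSlice_apply (x : Space) (θ : 𝓢(SpaceTime, ℂ)) (t : ℝ) :
    timeSlice x θ t = θ (event t x) := rfl

/-- The restriction of a Schwartz function on space-time to the space at time `t`. -/
noncomputable def spaceSlice (t : ℝ) : 𝓢(SpaceTime, ℂ) →L[ℂ] 𝓢(Space, ℂ) :=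
  compCLM ℂ (hasTemperateGrowth_event_right t)
    ⟨1, 1, fun x => by
      have := norm_le_norm_event t x
      simp only [pow_one, one_mul]
      linarith⟩

@[simp]
theorem spaceSlice_apply (t : ℝ) (θ : 𝓢(SpaceTime, ℂ)) (x : Space) :
    spaceSlice t θ x = θ (event t x) := rfl

/-- A continuous seminorm controlling the decay of a Schwartz function on space-time. -/
noncomputable def decaySeminorm (θ : 𝓢(SpaceTime, ℂ)) : ℝ :=
  2 ^ 6 * (SchwartzMap.seminorm ℂ 6 0 θ + SchwartzMap.seminorm ℂ 0 0 θ)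

theorem decaySeminorm_nonneg (θ : 𝓢(SpaceTime, ℂ)) : 0 ≤ decaySeminorm θ := by
  unfold decaySeminorm
  positivity

theorem continuous_decaySeminorm : Continuous decaySeminorm := by
  have h := fun i => (schwartz_withSeminorms ℂ SpaceTime ℂ).continuous_seminorm i
  exact continuous_const.mul ((h (6, 0)).add (h (0, 0)))

theorem one_add_pow_le {a : ℝ} (ha : 0 ≤ a) (k : ℕ) : (1 + a) ^ k ≤ 2 ^ k * (a ^ k + 1) := by
  rcases le_total 1 a with h | h
  · calc (1 + a) ^ k ≤ (2 * a) ^ k := by gcongr; linarith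
      _ = 2 ^ k * a ^ k := mul_pow _ _ _
      _ ≤ _ := by gcongr; linarith
  · calc (1 + a) ^ k ≤ 2 ^ k := by gcongr; linarith
      _ = 2 ^ k * 1 := (mul_one _).symm
      _ ≤ _ := by gcongr; linarith [pow_nonneg ha k]

/-- Six powers of decay are split into two for time and four for space. Four exceeds the dimension
3, so the spatial factor is integrable. -/
theorem norm_event_le (θ : 𝓢(SpaceTime, ℂ)) (t : ℝ) (x : Space) :
    ‖θ (event t x)‖ ≤ decaySeminorm θ * ((1 + t ^ 2)⁻¹ * (1 + ‖x‖) ^ (-4 : ℝ)) := by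
  set z := event t x with hz
  have h1 := SchwartzMap.norm_pow_mul_le_seminorm ℂ θ 6 z
  have h0 := SchwartzMap.norm_le_seminorm ℂ θ z
  have ht := abs_le_norm_event t x
  have hx := norm_le_norm_event t x
  rw [Real.rpow_neg (by positivity), ← mul_inv, ← div_eq_mul_inv, le_div_iff₀ (by positivity),
    show (4 : ℝ) = ((4 : ℕ) : ℝ) by norm_num, Real.rpow_natCast]
  have h2 : (1 + t ^ 2) * (1 + ‖x‖) ^ 4 ≤ (1 + ‖z‖) ^ 6 := by
    have a1 : 1 + t ^ 2 ≤ (1 + ‖z‖) ^ 2 := by nlinarith [sq_abs t, abs_nonneg t]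
    calc _ ≤ (1 + ‖z‖) ^ 2 * (1 + ‖z‖) ^ 4 := by gcongr
      _ = _ := by ring
  calc _ ≤ ‖θ z‖ * (1 + ‖z‖) ^ 6 := by gcongr
    _ ≤ ‖θ z‖ * (2 ^ 6 * (‖z‖ ^ 6 + 1)) := by gcongr; exact one_add_pow_le (norm_nonneg z) 6
    _ = 2 ^ 6 * (‖z‖ ^ 6 * ‖θ z‖ + ‖θ z‖) := by ring
    _ ≤ _ := by unfold decaySeminorm; gcongr

theorem integrable_one_add_norm_rpow : Integrable fun x : Space => (1 + ‖x‖) ^ (-4 : ℝ) :=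
  integrable_one_add_norm (by simp; norm_num)

theorem integrable_event (θ : 𝓢(SpaceTime, ℂ)) :
    Integrable fun q : ℝ × Space => θ (event q.1 q.2) := by
  refine ((integrable_inv_one_add_sq.mul_prod integrable_one_add_norm_rpow).const_mul
    (decaySeminorm θ)).mono' (θ.continuous.comp continuous_event).aestronglyMeasurable
    (Eventually.of_forall fun q => norm_event_le θ q.1 q.2)

theorem integral_spaceTime (f : SpaceTime → ℂ) :
    ∫ z, f z = ∫ q : ℝ × Space, f (event q.1 q.2) :=
  (((WithLp.volume_preserving_ofLp ℝ Space).symm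
    (MeasurableEquiv.toLp 2 (ℝ × Space)).symm).integral_comp
    (MeasurableEquiv.toLp 2 (ℝ × Space)).measurableEmbedding f).symm

/-- Fourier transform with respect to time only, in terms of the full Fourier transform. -/
theorem fourier_timeSlice (θ : 𝓢(SpaceTime, ℂ)) (x : Space) (ω : ℝ) :
    𝓕 (timeSlice x θ) ω = 𝓕⁻ (spaceSlice ω (𝓕 θ)) x := by
  set Θ := 𝓕 θ with hΘ
  set B : ℝ → ℂ := fun ω => 𝓕⁻ (spaceSlice ω Θ) x with hB
  have hBe : ∀ ω, B ω = ∫ ξ : Space,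
      Complex.exp ((2 * Real.pi * inner ℝ ξ x : ℝ) * Complex.I) * Θ (event ω ξ) := by
    intro ω
    simp only [hB]
    rw [SchwartzMap.fourierInv_coe, Real.fourierInv_eq']
    simp
  have hn : ∀ r : ℝ, ‖Complex.exp ((r : ℂ) * Complex.I)‖ = 1 := Complex.norm_exp_ofReal_mul_I
  have hbd : ∀ ω ξ, ‖Complex.exp ((2 * Real.pi * inner ℝ ξ x : ℝ) * Complex.I) * Θ (event ω ξ)‖ ≤
      decaySeminorm Θ * ((1 + ω ^ 2)⁻¹ * (1 + ‖ξ‖) ^ (-4 : ℝ)) := by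
    intro ω ξ
    rw [norm_mul, hn, one_mul]
    exact norm_event_le Θ ω ξ
  have hBc : Continuous B := by
    have : B = fun ω => ∫ ξ : Space,
      Complex.exp ((2 * Real.pi * inner ℝ ξ x : ℝ) * Complex.I) * Θ (event ω ξ) := funext hBe
    rw [this]
    refine continuous_of_dominated (bound := fun ξ => decaySeminorm Θ * (1 + ‖ξ‖) ^ (-4 : ℝ))
      (fun ω => ?_) (fun ω => Eventually.of_forall fun ξ => (hbd ω ξ).trans ?_)
      (integrable_one_add_norm_rpow.const_mul _) (Eventually.of_forall fun ξ => ?_)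
    · have h1 : Continuous fun ξ : Space => Θ (event ω ξ) := (spaceSlice ω Θ).continuous
      exact (Continuous.mul (by fun_prop) h1).aestronglyMeasurable
    · refine mul_le_mul_of_nonneg_left ?_ (decaySeminorm_nonneg _)
      refine mul_le_of_le_one_left (by positivity) (inv_le_one_of_one_le₀ ?_)
      nlinarith [sq_nonneg ω]
    · have h1 : Continuous fun ω : ℝ => Θ (event ω ξ) := (timeSlice ξ Θ).continuous
      exact continuous_const.mul h1
  have hint : Integrable fun q : ℝ × Space =>
      Complex.exp ((2 * Real.pi * inner ℝ q.2 x : ℝ) * Complex.I) * Θ (event q.1 q.2) :=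
    (integrable_event Θ).bdd_mul (c := 1) (by fun_prop : Continuous _).aestronglyMeasurable
      (Eventually.of_forall fun q => (hn _).le)
  have hBi : Integrable B := by
    have := hint.integral_prod_left
    exact this.congr (Eventually.of_forall fun ω => (hBe ω).symm)
  -- The full inversion formula, read through Fubini with the temporal frequency outside, says that
  -- the inverse transform of `B` is the time slice. Transforming back then requires only that `B`
  -- is continuous and that `B` and its transform are integrable.
  have hinv : ∀ t : ℝ, 𝓕⁻ B t = timeSlice x θ t := by
    intro t
    have h1 : θ (event t x) = 𝓕⁻ Θ (event t x) := by
      rw [hΘ, FourierTransform.fourierInv_fourier_eq]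
    rw [timeSlice_apply, h1, SchwartzMap.fourierInv_coe, Real.fourierInv_eq', Real.fourierInv_eq',
      integral_spaceTime]
    have hint2 : Integrable fun q : ℝ × Space => Complex.exp ((2 * Real.pi *
        inner ℝ (event q.1 q.2) (event t x) : ℝ) * Complex.I) • Θ (event q.1 q.2) := by
      simp only [inner_event]
      exact (integrable_event Θ).bdd_mul (c := 1) (by fun_prop : Continuous _).aestronglyMeasurable
        (Eventually.of_forall fun q => (hn _).le)
    rw [Measure.volume_eq_prod, integral_prod _ hint2]
    refine integral_congr_ae (Eventually.of_forall fun ω => ?_)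
    simp only [hBe, smul_eq_mul, ← integral_const_mul, inner_event]
    refine integral_congr_ae (Eventually.of_forall fun ξ => ?_)
    simp only [RCLike.inner_apply, conj_trivial]
    rw [← mul_assoc, ← Complex.exp_add]
    congr 2
    push_cast
    ring
  have hfi : Integrable (𝓕 B) := by
    have h1 : 𝓕 B = fun t => timeSlice x θ (-t) := by
      ext t
      rw [← hinv, Real.fourierInv_eq_fourier_neg, neg_neg]
    rw [h1]
    exact (timeSlice x θ).integrable.comp_neg
  have hfin := hBc.fourier_fourierInv_eq hBi hfi
  rw [SchwartzMap.fourier_coe, show ⇑(timeSlice x θ) = 𝓕⁻ B from funext fun t => (hinv t).symm, hfin]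

theorem fourierInv_smul_apply {f g : 𝓢(Space, ℂ)} {c : ℂ} (h : ∀ ξ, g ξ = c * f ξ) (x : Space) :
    𝓕⁻ g x = c * 𝓕⁻ f x := by
  have : g = c • f := by
    ext ξ
    simp [h]
  rw [this, FourierTransform.fourierInv_smul, smul_apply, smul_eq_mul]

/-- Multipliers depending only on the temporal frequency act on time slices. -/
theorem fourier_timeSlice_of_mul {θ θ₂ : 𝓢(SpaceTime, ℂ)} {m : ℝ → ℂ}
    (h : ∀ ω ξ, 𝓕 θ₂ (event ω ξ) = m ω * 𝓕 θ (event ω ξ)) (x : Space) (ω : ℝ) :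
    𝓕 (timeSlice x θ₂) ω = m ω * 𝓕 (timeSlice x θ) ω := by
  rw [fourier_timeSlice, fourier_timeSlice]
  exact fourierInv_smul_apply (fun ξ => h ω ξ) x

theorem fourier_attenuationTest {κ : ℝ → ℂ} (hκ : κ.HasTemperateGrowth) (θ : 𝓢(SpaceTime, ℂ))
    (ω : ℝ) (ξ : Space) :
    𝓕 (attenuationTest κ θ) (event ω ξ) = κ (2 * Real.pi * ω) ^ 2 * 𝓕 θ (event ω ξ) := by
  rw [attenuationTest, SchwartzMap.fourierMultiplierCLM_apply,
    FourierTransform.fourier_fourierInv_eq,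
    SchwartzMap.smulLeftCLM_apply_apply (temperate_aux' hκ)]
  rfl

theorem timeSlice_attenuationTest {κ : ℝ → ℂ} (hκ : κ.HasTemperateGrowth) (θ : 𝓢(SpaceTime, ℂ))
    (x : Space) : timeSlice x (attenuationTest κ θ) = timeMultiplier κ (timeSlice x θ) := by
  have h : 𝓕 (timeSlice x (attenuationTest κ θ)) = 𝓕 (timeMultiplier κ (timeSlice x θ)) := by
    ext ω
    rw [fourier_timeSlice_of_mul (fourier_attenuationTest hκ θ) x ω, timeMultiplier,
      SchwartzMap.fourierMultiplierCLM_apply, FourierTransform.fourier_fourierInv_eq,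
      SchwartzMap.smulLeftCLM_apply_apply (temperate_aux hκ)]
    rfl
  rw [← FourierTransform.fourierInv_fourier_eq (F := 𝓢(ℝ, ℂ)) (timeSlice x (attenuationTest κ θ)),
    h, FourierTransform.fourierInv_fourier_eq]

theorem fourierLaplace_attenuationTest {κ : ℝ → ℂ} (hκ : κ.HasTemperateGrowth)
    (θ : 𝓢(SpaceTime, ℂ)) (x : Space) (ω : ℝ) :
    fourierLaplace (timeSlice x (attenuationTest κ θ)) ω =
      κ ω ^ 2 * fourierLaplace (timeSlice x θ) ω := by
  rw [fourierLaplace_eq_fourier, fourierLaplace_eq_fourier,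
    fourier_timeSlice_of_mul (fourier_attenuationTest hκ θ), mul_div_cancel₀ _ (by positivity)]

/-- The partial Fourier transform with respect to time, at a fixed frequency. -/
noncomputable def freqSlice (ω : ℝ) (θ : 𝓢(SpaceTime, ℂ)) : 𝓢(Space, ℂ) :=
  𝓕⁻ (spaceSlice (ω / (2 * Real.pi)) (𝓕 θ))

theorem freqSlice_apply (ω : ℝ) (θ : 𝓢(SpaceTime, ℂ)) (x : Space) :
    freqSlice ω θ x = fourierLaplace (timeSlice x θ) ω := by
  rw [fourierLaplace_eq_fourier, fourier_timeSlice, freqSlice]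

/-- Purely spatial directions do not see the temporal frequency, so differentiation is the same
multiplier on the full and on the spatial Fourier side. -/
theorem freqSlice_lineDeriv (ω : ℝ) (θ : 𝓢(SpaceTime, ℂ)) (v : Space) :
    freqSlice ω (∂_{event 0 v} θ) = ∂_{v} (freqSlice ω θ) := by
  rw [freqSlice, freqSlice, lineDerivOp_fourierInv_eq, fourier_lineDerivOp_eq]
  congr 1
  ext ξ
  rw [spaceSlice_apply, smul_apply, smul_apply,
    SchwartzMap.smulLeftCLM_apply_apply (by fun_prop),
    SchwartzMap.smulLeftCLM_apply_apply (by fun_prop), inner_event, mul_zero, zero_add,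
    spaceSlice_apply]

/-- The spatial Laplacian on Schwartz functions on space-time. -/
noncomputable def spaceLaplacian (θ : 𝓢(SpaceTime, ℂ)) : 𝓢(SpaceTime, ℂ) :=
  ∑ i : Fin 3, ∂_{event 0 (EuclideanSpace.single i 1)} (∂_{event 0 (EuclideanSpace.single i 1)} θ)

theorem spatialLaplacian_apply (u : 𝓢'(SpaceTime, ℂ)) (θ : 𝓢(SpaceTime, ℂ)) :
    spatialLaplacian u θ = u (spaceLaplacian θ) := by
  have h1 : spatialLaplacian u θ = ∑ i : Fin 3,
      (∂_{event 0 (EuclideanSpace.single i 1)} (∂_{event 0 (EuclideanSpace.single i 1)} u)) θ := by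
    simp [spatialLaplacian, Fin.sum_univ_three]
  rw [h1, spaceLaplacian, map_sum]
  refine Finset.sum_congr rfl fun i _ => ?_
  rw [TemperedDistribution.lineDerivOp_apply_apply, map_neg,
    TemperedDistribution.lineDerivOp_apply_apply, map_neg, neg_neg]

theorem fourierLaplace_spaceLaplacian (ω : ℝ) (θ : 𝓢(SpaceTime, ℂ)) (x : Space) :
    fourierLaplace (timeSlice x (spaceLaplacian θ)) ω = (Δ (freqSlice ω θ)) x := by
  rw [← freqSlice_apply, SchwartzMap.laplacian_eq_sum (EuclideanSpace.basisFun (Fin 3) ℝ)]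
  have : freqSlice ω (spaceLaplacian θ) = ∑ i : Fin 3, freqSlice ω
      (∂_{event 0 (EuclideanSpace.single i 1)} (∂_{event 0 (EuclideanSpace.single i 1)} θ)) := by
    simp only [freqSlice, spaceLaplacian, Fin.sum_univ_three, FourierTransform.fourier_add, map_add,
      FourierTransform.fourierInv_add]
  rw [this]
  simp only [freqSlice_lineDeriv, EuclideanSpace.basisFun_apply]

/-! ### Joint bounds for the partial Fourier transform -/

theorem timeSlice_lineDeriv (θ : 𝓢(SpaceTime, ℂ)) (x : Space) :
    timeSlice x (∂_{event 1 0} θ) = derivCLM ℂ ℂ (timeSlice x θ) := by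
  ext t
  rw [timeSlice_apply, derivCLM_apply, lineDerivOp_apply_eq_fderiv]
  have h1 : HasDerivAt (fun t : ℝ => event t x) (event 1 0) t := by
    have : (fun t : ℝ => event t x) = fun t : ℝ => t • event 1 0 + event 0 x :=
      funext fun t => event_eq t x
    rw [this]
    simpa using ((hasDerivAt_id t).smul_const (event 1 0)).add_const (event 0 x)
  exact ((θ.hasFDerivAt (event t x)).comp_hasDerivAt t h1).deriv.symm

theorem fourierLaplace_derivCLM (g : 𝓢(ℝ, ℂ)) (ω : ℝ) :
    fourierLaplace (derivCLM ℂ ℂ g) ω = Complex.I * ω * fourierLaplace g ω := by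
  have h : 𝓕 (deriv g) = fun x : ℝ => (2 * Real.pi * Complex.I * x : ℂ) • 𝓕 (g : ℝ → ℂ) x :=
    Real.fourier_deriv g.integrable g.differentiable (derivCLM ℂ ℂ g).integrable
  have hp : (2 * Real.pi : ℂ) ≠ 0 := by exact_mod_cast (by positivity : (2 * Real.pi : ℝ) ≠ 0)
  rw [fourierLaplace_eq_fourier, fourierLaplace_eq_fourier, SchwartzMap.fourier_coe,
    SchwartzMap.fourier_coe, show ⇑(derivCLM ℂ ℂ g) = deriv g from rfl, h]
  simp only [smul_eq_mul]
  push_cast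
  field_simp

theorem norm_fourierLaplace_timeSlice_le (θ : 𝓢(SpaceTime, ℂ)) (x : Space) (ω : ℝ) :
    ‖fourierLaplace (timeSlice x θ) ω‖ ≤
      Real.pi * decaySeminorm θ * (1 + ‖x‖) ^ (-4 : ℝ) := by
  have h : Real.pi * decaySeminorm θ * (1 + ‖x‖) ^ (-4 : ℝ) =
      ∫ t : ℝ, (1 + t ^ 2)⁻¹ * (decaySeminorm θ * (1 + ‖x‖) ^ (-4 : ℝ)) := by
    rw [integral_mul_const, integral_univ_inv_one_add_sq]
    ring
  rw [h]
  refine norm_integral_le_of_norm_le (integrable_inv_one_add_sq.mul_const _)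
    (Eventually.of_forall fun t => ?_)
  rw [norm_mul, norm_exp_neg_I_mul]
  simp only [Complex.ofReal_im, zero_mul, Real.exp_zero, mul_one]
  refine (norm_event_le θ t x).trans_eq ?_
  ring

/-- A continuous seminorm controlling `ω ↦ ω θ̂(ω, x)`. -/
noncomputable def freqSeminorm (θ : 𝓢(SpaceTime, ℂ)) : ℝ :=
  Real.pi * (decaySeminorm (∂_{event 1 0} θ) +
    decaySeminorm (∂_{event 1 0} (∂_{event 1 0} (∂_{event 1 0} θ))))

theorem freqSeminorm_nonneg (θ : 𝓢(SpaceTime, ℂ)) : 0 ≤ freqSeminorm θ :=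
  mul_nonneg Real.pi_pos.le (add_nonneg (decaySeminorm_nonneg _) (decaySeminorm_nonneg _))

theorem continuous_freqSeminorm : Continuous freqSeminorm := by
  have hT : Continuous fun θ : 𝓢(SpaceTime, ℂ) => ∂_{event 1 0} θ :=
    (lineDerivOpCLM ℂ 𝓢(SpaceTime, ℂ) (event 1 0)).continuous
  exact continuous_const.mul ((continuous_decaySeminorm.comp hT).add
    (continuous_decaySeminorm.comp (hT.comp (hT.comp hT))))

theorem freqSeminorm_zero : freqSeminorm 0 = 0 := by
  have h : ∂_{event 1 0} (0 : 𝓢(SpaceTime, ℂ)) = 0 :=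
    (lineDerivOpCLM ℂ 𝓢(SpaceTime, ℂ) (event 1 0)).map_zero
  simp [freqSeminorm, h, decaySeminorm]

/-- Multiplying by `1 + ω²` turns `ω` into `ω + ω³`, which is why the first and third time
derivatives enter `freqSeminorm`. -/
theorem norm_mul_fourierLaplace_timeSlice_le (θ : 𝓢(SpaceTime, ℂ)) (x : Space) (ω : ℝ) :
    ‖(ω : ℂ) * fourierLaplace (timeSlice x θ) ω‖ ≤
      freqSeminorm θ * ((1 + ω ^ 2)⁻¹ * (1 + ‖x‖) ^ (-4 : ℝ)) := by
  have h1 := norm_fourierLaplace_timeSlice_le (∂_{event 1 0} θ) x ω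
  have h3 := norm_fourierLaplace_timeSlice_le (∂_{event 1 0} (∂_{event 1 0} (∂_{event 1 0} θ))) x ω
  simp only [timeSlice_lineDeriv, fourierLaplace_derivCLM, norm_mul, Complex.norm_I, one_mul,
    Complex.norm_real, Real.norm_eq_abs] at h1 h3
  rw [← mul_assoc, mul_comm (freqSeminorm θ), mul_assoc, ← div_eq_inv_mul,
    le_div_iff₀ (by positivity), norm_mul, Complex.norm_real, Real.norm_eq_abs, freqSeminorm]
  calc _ = |ω| * ‖fourierLaplace (timeSlice x θ) ω‖ +
        |ω| * (|ω| * (|ω| * ‖fourierLaplace (timeSlice x θ) ω‖)) := by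
        rw [← sq_abs ω]; ring
    _ ≤ _ := add_le_add h1 h3
    _ = _ := by ring

/-! ### The causal solution -/

theorem integrable_of_memLp_of_compact {h : Space → ℂ} (hL2 : MemLp h 2 volume) {K : Set Space}
    (hK : IsCompact K) (hh : ∀ᵐ x, x ∉ K → h x = 0) : Integrable h := by
  have : IsFiniteMeasure (volume.restrict K) := ⟨by simpa using hK.measure_lt_top⟩
  have h1 : IntegrableOn h K := (hL2.restrict K).integrable one_le_two
  have h2 : K.indicator h =ᵐ[volume] h := by
    filter_upwards [hh] with x hx
    by_cases hxK : x ∈ K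
    · simp [hxK]
    · simp [hxK, hx hxK]
  exact ((integrable_indicator_iff hK.measurableSet).2 h1).congr h2

theorem greenKernel_eq (κ : ℝ → ℂ) (ω : ℝ) (x : Space) :
    greenKernel κ ω x = -(Complex.I * ω / (4 * Real.pi * Real.sqrt (2 * Real.pi) : ℝ)) *
      helmholtzU (κ ω) ‖x‖ := rfl

/-- Near the diagonal this is the integrand of the convolution of `|h|` with the integrable function
`1/|x|` on the unit ball. Away from it `1/|x - y| ≤ 1`, and the weight in `x` supplies
integrability. -/
theorem integrable_kernel {h : Space → ℂ} (hh : Integrable h) :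
    Integrable fun q : Space × Space => (1 + ‖q.1‖) ^ (-4 : ℝ) * (‖q.1 - q.2‖⁻¹ * ‖h q.2‖) := by
  have h1 := Integrable.convolution_integrand (ContinuousLinearMap.mul ℝ ℝ) hh.norm
    (integrable_indicator_inv_norm_pow one_le_two)
  have h2 := integrable_one_add_norm_rpow.mul_prod hh.norm
  have h3 := h1.add h2
  have hm : AEStronglyMeasurable (fun q : Space × Space => ‖h q.2‖)
    (volume.prod volume) := hh.aestronglyMeasurable.comp_snd.norm
  refine h3.mono' (AEStronglyMeasurable.mul (Measurable.aestronglyMeasurable (by fun_prop))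
    (AEStronglyMeasurable.mul (Measurable.aestronglyMeasurable (by fun_prop)) hm))
    (Eventually.of_forall fun q => ?_)
  have h4 : (1 + ‖q.1‖) ^ (-4 : ℝ) ≤ 1 :=
    Real.rpow_le_one_of_one_le_of_nonpos (by linarith [norm_nonneg q.1]) (by norm_num)
  have h5 := inv_norm_pow_le 1 (q.1 - q.2)
  have h6 : 0 ≤ (Metric.ball (0 : Space) 1).indicator (fun x => (‖x‖ ^ 1)⁻¹) (q.1 - q.2) :=
    indicator_nonneg (fun _ _ => by positivity) _
  rw [Real.norm_of_nonneg (by positivity)]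
  simp only [Pi.add_apply, ContinuousLinearMap.mul_apply']
  rw [pow_one] at h5
  calc _ ≤ (1 + ‖q.1‖) ^ (-4 : ℝ) * (((Metric.ball (0 : Space) 1).indicator
        (fun x => (‖x‖ ^ 1)⁻¹) (q.1 - q.2) + 1) * ‖h q.2‖) := by gcongr
    _ = (1 + ‖q.1‖) ^ (-4 : ℝ) * (‖h q.2‖ * (Metric.ball (0 : Space) 1).indicator
        (fun x => (‖x‖ ^ 1)⁻¹) (q.1 - q.2)) + (1 + ‖q.1‖) ^ (-4 : ℝ) * ‖h q.2‖ := by ring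
    _ ≤ _ := add_le_add
        (mul_le_of_le_one_left (mul_nonneg (norm_nonneg (h q.2)) h6) h4) le_rfl

theorem continuous_fourierLaplace_timeSlice (θ : 𝓢(SpaceTime, ℂ)) :
    Continuous fun q : ℝ × Space => fourierLaplace (timeSlice q.2 θ) q.1 := by
  unfold fourierLaplace
  refine continuous_of_dominated (bound := fun t => decaySeminorm θ * (1 + t ^ 2)⁻¹)
    (fun q => ?_) (fun q => Eventually.of_forall fun t => ?_)
    (integrable_inv_one_add_sq.const_mul _) (Eventually.of_forall fun t => ?_)
  · exact ((timeSlice q.2 θ).continuous.mul (by fun_prop)).aestronglyMeasurable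
  · rw [norm_mul, norm_exp_neg_I_mul, timeSlice_apply]
    simp only [Complex.ofReal_im, zero_mul, Real.exp_zero, mul_one]
    refine (norm_event_le θ t q.2).trans (mul_le_mul_of_nonneg_left ?_ (decaySeminorm_nonneg θ))
    exact mul_le_of_le_one_right (by positivity)
      (Real.rpow_le_one_of_one_le_of_nonpos (by linarith [norm_nonneg q.2]) (by norm_num))
  · simp only [timeSlice_apply]
    refine Continuous.mul ?_ (by fun_prop)
    exact θ.continuous.comp (continuous_event.comp (by fun_prop : Continuous fun q : ℝ × Space =>
      ((t, q.2) : ℝ × Space)))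

/-- The integrand defining the solution. -/
noncomputable def solutionIntegrand (κ : ℝ → ℂ) (h : Space → ℂ) (θ : 𝓢(SpaceTime, ℂ))
    (q : ℝ × Space × Space) : ℂ :=
  greenKernel κ q.1 (q.2.1 - q.2.2) * h q.2.2 * timeFourier (timeSlice q.2.1 θ) q.1

/-- The normalising constant of the solution. -/
noncomputable def greenConst : ℝ :=
  (4 * Real.pi * Real.sqrt (2 * Real.pi))⁻¹ * (1 / Real.sqrt (2 * Real.pi))

theorem solutionIntegrand_eq (κ : ℝ → ℂ) (h : Space → ℂ) (θ : 𝓢(SpaceTime, ℂ)) (ω : ℝ)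
    (x y : Space) : solutionIntegrand κ h θ (ω, x, y) = -Complex.I * greenConst *
      (helmholtzU (κ ω) ‖x - y‖ * h y * (ω * fourierLaplace (timeSlice x θ) ω)) := by
  simp only [solutionIntegrand, greenKernel_eq, timeFourier_eq_fourierLaplace, greenConst]
  push_cast
  ring

theorem norm_solutionIntegrand_le {κ : ℝ → ℂ} (hκ : IsAttenuationCoefficient κ) (h : Space → ℂ)
    (θ : 𝓢(SpaceTime, ℂ)) (q : ℝ × Space × Space) :
    ‖solutionIntegrand κ h θ q‖ ≤ greenConst * freqSeminorm θ * ((1 + q.1 ^ 2)⁻¹ *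
      ((1 + ‖q.2.1‖) ^ (-4 : ℝ) * (‖q.2.1 - q.2.2‖⁻¹ * ‖h q.2.2‖))) := by
  obtain ⟨ω, x, y⟩ := q
  have hg : 0 ≤ greenConst := by unfold greenConst; positivity
  rw [solutionIntegrand_eq, norm_mul, norm_mul, norm_neg, Complex.norm_I, one_mul,
    Complex.norm_real, Real.norm_of_nonneg hg, norm_mul, norm_mul]
  have h1 := norm_helmholtzU_le (hκ.im_nonneg ω) (norm_nonneg (x - y))
  have h2 := norm_mul_fourierLaplace_timeSlice_le θ x ω
  calc _ ≤ greenConst * (‖x - y‖⁻¹ * ‖h y‖ *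
        (freqSeminorm θ * ((1 + ω ^ 2)⁻¹ * (1 + ‖x‖) ^ (-4 : ℝ)))) := by gcongr
    _ = _ := by ring

theorem continuous_of_isAttenuationCoefficient {κ : ℝ → ℂ} (hκ : IsAttenuationCoefficient κ) :
    Continuous κ := hκ.smooth.continuous

theorem integrable_solutionIntegrand {κ : ℝ → ℂ} (hκ : IsAttenuationCoefficient κ) {h : Space → ℂ}
    (hh : Integrable h) (θ : 𝓢(SpaceTime, ℂ)) : Integrable (solutionIntegrand κ h θ) := by
  have hb := (integrable_inv_one_add_sq.mul_prod (integrable_kernel hh)).const_mul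
    (greenConst * freqSeminorm θ)
  refine hb.mono' ?_ (Eventually.of_forall (norm_solutionIntegrand_le hκ h θ))
  have hκm : Measurable κ := (continuous_of_isAttenuationCoefficient hκ).measurable
  have h1 : Measurable fun q : ℝ × Space × Space => greenKernel κ q.1 (q.2.1 - q.2.2) := by
    unfold greenKernel
    fun_prop
  have h2 : AEStronglyMeasurable (fun q : ℝ × Space × Space => h q.2.2)
      (volume.prod (volume.prod volume)) :=
    (hh.aestronglyMeasurable.comp_snd (μ := volume)).comp_snd
  have h3 : Continuous fun q : ℝ × Space × Space => timeFourier (timeSlice q.2.1 θ) q.1 := by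
    simp only [timeFourier_eq_fourierLaplace]
    exact continuous_const.mul ((continuous_fourierLaplace_timeSlice θ).comp
      (by fun_prop : Continuous fun q : ℝ × Space × Space => ((q.1, q.2.1) : ℝ × Space)))
  exact (h1.aestronglyMeasurable.mul h2).mul h3.aestronglyMeasurable

theorem fourierLaplace_timeSlice_add (θ θ' : 𝓢(SpaceTime, ℂ)) (x : Space) (ω : ℝ) :
    fourierLaplace (timeSlice x (θ + θ')) ω =
      fourierLaplace (timeSlice x θ) ω + fourierLaplace (timeSlice x θ') ω := by
  simp only [fourierLaplace_eq_fourier, map_add, FourierTransform.fourier_add, add_apply]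

theorem fourierLaplace_timeSlice_smul (c : ℂ) (θ : 𝓢(SpaceTime, ℂ)) (x : Space) (ω : ℝ) :
    fourierLaplace (timeSlice x (c • θ)) ω = c * fourierLaplace (timeSlice x θ) ω := by
  simp only [fourierLaplace_eq_fourier, map_smul, FourierTransform.fourier_smul, smul_apply,
    smul_eq_mul]

/-- The solution, as a linear map on Schwartz functions. -/
noncomputable def solutionLM {κ : ℝ → ℂ} (hκ : IsAttenuationCoefficient κ) {h : Space → ℂ}
    (hh : Integrable h) : 𝓢(SpaceTime, ℂ) →ₗ[ℂ] ℂ where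
  toFun θ := ∫ q, solutionIntegrand κ h θ q
  map_add' θ θ' := by
    rw [← integral_add (integrable_solutionIntegrand hκ hh θ)
      (integrable_solutionIntegrand hκ hh θ')]
    refine integral_congr_ae (Eventually.of_forall fun q => ?_)
    obtain ⟨ω, x, y⟩ := q
    simp only [solutionIntegrand_eq, fourierLaplace_timeSlice_add]
    ring
  map_smul' c θ := by
    rw [RingHom.id_apply, smul_eq_mul, ← integral_const_mul]
    refine integral_congr_ae (Eventually.of_forall fun q => ?_)
    obtain ⟨ω, x, y⟩ := q
    simp only [solutionIntegrand_eq, fourierLaplace_timeSlice_smul]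
    ring

/-- This gives continuity of the functional: the bound depends continuously on the test function and
vanishes at zero. -/
theorem norm_solutionLM_le {κ : ℝ → ℂ} (hκ : IsAttenuationCoefficient κ) {h : Space → ℂ}
    (hh : Integrable h) (θ : 𝓢(SpaceTime, ℂ)) :
    ‖solutionLM hκ hh θ‖ ≤ freqSeminorm θ * (greenConst * ∫ q : ℝ × Space × Space,
      ((1 + q.1 ^ 2)⁻¹ * ((1 + ‖q.2.1‖) ^ (-4 : ℝ) * (‖q.2.1 - q.2.2‖⁻¹ * ‖h q.2.2‖)))) := by
  rw [← mul_assoc, mul_comm (freqSeminorm θ), ← integral_const_mul]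
  exact norm_integral_le_of_norm_le
    ((integrable_inv_one_add_sq.mul_prod (integrable_kernel hh)).const_mul _)
    (Eventually.of_forall (norm_solutionIntegrand_le hκ h θ))

/-- The causal solution of the attenuated wave equation, as a tempered distribution. -/
noncomputable def solution {κ : ℝ → ℂ} (hκ : IsAttenuationCoefficient κ) {h : Space → ℂ}
    (hh : Integrable h) : 𝓢'(SpaceTime, ℂ) :=
  ContinuousLinearMap.toPointwiseConvergenceCLM _ _ _ _
    ({ toLinearMap := solutionLM hκ hh
       cont := by
        refine continuous_of_continuousAt_zero (solutionLM hκ hh) ?_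
        rw [ContinuousAt, map_zero]
        refine squeeze_zero_norm (norm_solutionLM_le hκ hh) ?_
        have := (continuous_freqSeminorm.tendsto 0).mul_const (greenConst *
          ∫ q : ℝ × Space × Space, ((1 + q.1 ^ 2)⁻¹ * ((1 + ‖q.2.1‖) ^ (-4 : ℝ) *
          (‖q.2.1 - q.2.2‖⁻¹ * ‖h q.2.2‖))))
        rwa [freqSeminorm_zero, zero_mul] at this } : 𝓢(SpaceTime, ℂ) →L[ℂ] ℂ)

theorem solution_apply {κ : ℝ → ℂ} (hκ : IsAttenuationCoefficient κ) {h : Space → ℂ}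
    (hh : Integrable h) (θ : 𝓢(SpaceTime, ℂ)) :
    solution hκ hh θ = ∫ q, solutionIntegrand κ h θ q := rfl

/-! ### Causality of the Green integral and the wave equation -/

/-- For fixed `x` and `y`, the factor `z e^{iκt(z)|x-y|}/|x-y|` continues to the upper half plane
with linear growth, because `Im κt ≥ 0`. The time slice vanishes for positive times, so the contour
argument with `a = 0` and `N = 1` kills the frequency integral. -/
theorem solution_isVanishingOn {κ : ℝ → ℂ} (hκ : IsAttenuationCoefficient κ) {h : Space → ℂ}
    (hh : Integrable h) :
    Distribution.IsVanishingOn (solution hκ hh) {z : SpaceTime | z.fst < 0} := by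
  intro θ hθ
  obtain ⟨κt, hκt⟩ := hκ.holomorphic
  rw [solution_apply, Measure.volume_eq_prod,
    integral_prod_symm _ (integrable_solutionIntegrand hκ hh θ)]
  refine integral_eq_zero_of_ae (Eventually.of_forall fun q => ?_)
  obtain ⟨x, y⟩ := q
  have h0 : ∀ t : ℝ, 0 < t → timeSlice x θ t = 0 := by
    intro t ht
    refine image_eq_zero_of_notMem_tsupport (f := θ) (x := event t x) fun hmem => ?_
    have hneg : t < 0 := hθ hmem
    linarith
  have hv := integral_mul_fourierLaplace_eq_zero
    (m := fun z => z * helmholtzU (κt z) ‖x - y‖) (C := ‖x - y‖⁻¹) (N := 1) (a := 0)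
    ?_ ?_ ?_ (timeSlice x θ) h0
  · have e : ∀ ω : ℝ, solutionIntegrand κ h θ (ω, x, y) = -Complex.I * greenConst * h y *
        (ω * helmholtzU (κt ω) ‖x - y‖ * fourierLaplace (timeSlice x θ) ω) := by
      intro ω
      rw [solutionIntegrand_eq, hκt.eq_on_real]
      ring
    simp only [e]
    rw [integral_const_mul, hv.2, mul_zero]
    rfl
  · have := hκt.continuousOn
    unfold helmholtzU
    simp only [div_eq_mul_inv]
    fun_prop
  · have := hκt.differentiableOn
    unfold helmholtzU
    simp only [div_eq_mul_inv]
    fun_prop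
  · intro z hz
    have h1 := norm_helmholtzU_le (hκt.im_nonneg z hz) (norm_nonneg (x - y))
    rw [norm_mul]
    simp only [zero_mul, neg_zero, Real.exp_zero, mul_one, pow_one]
    calc _ ≤ ‖z‖ * ‖x - y‖⁻¹ := by gcongr
      _ ≤ (1 + ‖z‖) * ‖x - y‖⁻¹ := by gcongr; linarith
      _ = _ := mul_comm _ _

theorem solution_support {κ : ℝ → ℂ} (hκ : IsAttenuationCoefficient κ) {h : Space → ℂ}
    (hh : Integrable h) :
    Distribution.dsupport (solution hκ hh) ⊆ {z : SpaceTime | 0 ≤ z.fst} := by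
  intro z hz
  by_contra hlt
  simp only [mem_ofPred_eq, not_le] at hlt
  refine (Distribution.mem_dsupport_iff_not_isVanishingOn z).1 hz _ hlt ?_
    (solution_isVanishingOn hκ hh)
  exact isOpen_lt (WithLp.fstL 2 ℝ ℝ Space).continuous continuous_const

/-- In the frequency variable the transposed operator becomes `Δ + κ(ω)²` acting on `freqSlice ω θ`,
and the kernel is its fundamental solution centred at `y`. -/
theorem integral_helmholtz_slice {κ : ℝ → ℂ} (hκ : IsAttenuationCoefficient κ)
    (θ : 𝓢(SpaceTime, ℂ)) (ω : ℝ) (y : Space) :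
    ∫ x, helmholtzU (κ ω) ‖x - y‖ *
      fourierLaplace (timeSlice x (attenuationTest κ θ + spaceLaplacian θ)) ω =
      -(4 * Real.pi * fourierLaplace (timeSlice y θ) ω) := by
  rw [← freqSlice_apply ω θ y, ← integral_helmholtzU_mul (hκ.im_nonneg ω) (freqSlice ω θ) y]
  refine integral_congr_ae (Eventually.of_forall fun x => ?_)
  simp only [add_apply, smul_apply, smul_eq_mul, fourierLaplace_timeSlice_add,
    fourierLaplace_attenuationTest hκ.hasTemperateGrowth, fourierLaplace_spaceLaplacian,
    freqSlice_apply]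
  ring

/-- Fourier inversion for the derivative of `φ`, evaluated at `t = 0`. The factor `iω` of the Green
kernel is thus what creates `δ'(t)`. -/
theorem integral_mul_fourierLaplace (φ : 𝓢(ℝ, ℂ)) :
    ∫ ω : ℝ, Complex.I * ω * fourierLaplace φ ω = (2 * Real.pi : ℝ) * deriv φ 0 := by
  have h := eq_integral_fourierLaplace (derivCLM ℂ ℂ φ) 0
  simp only [fourierLaplace_derivCLM, Complex.ofReal_zero, mul_zero, Complex.exp_zero, mul_one,
    derivCLM_apply] at h
  rw [h, ← mul_assoc, ← Complex.ofReal_mul, mul_one_div_cancel (by positivity)]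
  simp

theorem greenConst_mul : greenConst * (4 * Real.pi) = (2 * Real.pi)⁻¹ := by
  have h := Real.mul_self_sqrt (by positivity : 0 ≤ 2 * Real.pi)
  have h' : 0 < Real.sqrt (2 * Real.pi) := Real.sqrt_pos.2 (by positivity)
  unfold greenConst
  generalize Real.sqrt (2 * Real.pi) = s at *
  have hp := Real.pi_pos
  field_simp
  linarith

/-- Both operators of the wave equation are moved onto the test function, so the overall sign is
opposite to that of the equation in `IsCausalSolution`. -/
theorem solution_equation {κ : ℝ → ℂ} (hκ : IsAttenuationCoefficient κ) {h : Space → ℂ}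
    (hh : Integrable h) (θ : 𝓢(SpaceTime, ℂ)) :
    solution hκ hh (attenuationTest κ θ + spaceLaplacian θ) =
      ∫ x : Space, h x * deriv (fun t : ℝ => θ (event t x)) 0 := by
  have hint := integrable_solutionIntegrand hκ hh (attenuationTest κ θ + spaceLaplacian θ)
  rw [solution_apply, Measure.volume_eq_prod, integral_prod _ hint]
  have e1 : ∀ᵐ ω : ℝ, (∫ q, solutionIntegrand κ h (attenuationTest κ θ + spaceLaplacian θ) (ω, q)) =
      ∫ y, h y * (((2 * Real.pi)⁻¹ : ℝ) * (Complex.I * ω * fourierLaplace (timeSlice y θ) ω)) := by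
    filter_upwards [hint.prod_right_ae] with ω hω
    -- The `x`-integral is taken first, since the fundamental solution acts in `x`. The later swap
    -- makes the frequency integral the inner one, where inversion applies.
    rw [Measure.volume_eq_prod, integral_prod_symm _ hω]
    refine integral_congr_ae (Eventually.of_forall fun y => ?_)
    have e2 : ∀ x, solutionIntegrand κ h (attenuationTest κ θ + spaceLaplacian θ) (ω, x, y) =
        -Complex.I * greenConst * h y * ω * (helmholtzU (κ ω) ‖x - y‖ *
        fourierLaplace (timeSlice x (attenuationTest κ θ + spaceLaplacian θ)) ω) := by
      intro x
      rw [solutionIntegrand_eq]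
      ring
    simp only [e2]
    rw [integral_const_mul, integral_helmholtz_slice hκ, ← greenConst_mul]
    push_cast
    ring
  rw [integral_congr_ae e1, integral_integral_swap]
  · refine integral_congr_ae (Eventually.of_forall fun y => ?_)
    simp only
    rw [integral_const_mul, integral_const_mul, integral_mul_fourierLaplace,
      ← mul_assoc (((2 * Real.pi)⁻¹ : ℝ) : ℂ), ← Complex.ofReal_mul, inv_mul_cancel₀ (by positivity), Complex.ofReal_one, one_mul]
    rfl
  · have hb := (integrable_inv_one_add_sq.mul_prod hh.norm).const_mul
      ((2 * Real.pi)⁻¹ * freqSeminorm θ)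
    refine hb.mono' ?_ (Eventually.of_forall fun q => ?_)
    · refine (hh.aestronglyMeasurable.comp_snd).mul ?_
      have := continuous_fourierLaplace_timeSlice θ
      exact (by fun_prop : Continuous _).aestronglyMeasurable
    · obtain ⟨ω, y⟩ := q
      have h2 := norm_mul_fourierLaplace_timeSlice_le θ y ω
      have h4 : (1 + ‖y‖) ^ (-4 : ℝ) ≤ 1 :=
        Real.rpow_le_one_of_one_le_of_nonpos (by linarith [norm_nonneg y]) (by norm_num)
      have hf := freqSeminorm_nonneg θ
      simp only [Function.uncurry]
      rw [mul_assoc Complex.I, norm_mul, norm_mul, norm_mul Complex.I, Complex.norm_I, one_mul,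
        Complex.norm_real, Real.norm_of_nonneg (by positivity)]
      calc _ ≤ ‖h y‖ * ((2 * Real.pi)⁻¹ * (freqSeminorm θ *
            ((1 + ω ^ 2)⁻¹ * (1 + ‖y‖) ^ (-4 : ℝ)))) := by gcongr
        _ ≤ ‖h y‖ * ((2 * Real.pi)⁻¹ * (freqSeminorm θ * ((1 + ω ^ 2)⁻¹ * 1))) := by gcongr
        _ = _ := by ring

theorem isCausalSolution_solution {κ : ℝ → ℂ} (hκ : IsAttenuationCoefficient κ) {h : Space → ℂ}
    (hh : Integrable h) : IsCausalSolution κ h (solution hκ hh) where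
  equation θ := by
    rw [← solution_equation hκ hh, attenuationOp_apply, spatialLaplacian_apply, map_add]
    ring
  support := solution_support hκ hh

theorem solutionIntegrand_tensor (κ : ℝ → ℂ) (h : Space → ℂ) (φ : 𝓢(ℝ, ℂ)) (ψ : 𝓢(Space, ℂ))
    (q : ℝ × Space × Space) : solutionIntegrand κ h (tensor φ ψ) q =
      greenKernel κ q.1 (q.2.1 - q.2.2) * h q.2.2 * timeFourier φ q.1 * ψ q.2.1 := by
  have : timeFourier (timeSlice q.2.1 (tensor φ ψ)) q.1 = timeFourier φ q.1 * ψ q.2.1 := by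
    rw [timeFourier, timeFourier, mul_assoc, ← integral_mul_const]
    congr 1
    refine integral_congr_ae (Eventually.of_forall fun t => ?_)
    simp only [timeSlice_apply, tensor_apply, event_fst, event_snd]
    ring
  rw [solutionIntegrand, this]
  ring

theorem solution_tensor {κ : ℝ → ℂ} (hκ : IsAttenuationCoefficient κ) {h : Space → ℂ}
    (hh : Integrable h) (φ : 𝓢(ℝ, ℂ)) (ψ : 𝓢(Space, ℂ)) :
    Integrable (fun q : ℝ × Space × Space =>
      greenKernel κ q.1 (q.2.1 - q.2.2) * h q.2.2 * timeFourier φ q.1 * ψ q.2.1) ∧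
    solution hκ hh (tensor φ ψ) = ∫ ω : ℝ, ∫ x : Space, (∫ y : Space,
      greenKernel κ ω (x - y) * h y) * timeFourier φ ω * ψ x := by
  have hint := integrable_solutionIntegrand hκ hh (tensor φ ψ)
  refine ⟨hint.congr (Eventually.of_forall (solutionIntegrand_tensor κ h φ ψ)), ?_⟩
  rw [solution_apply, Measure.volume_eq_prod, integral_prod _ hint]
  refine integral_congr_ae ?_
  filter_upwards [hint.prod_right_ae] with ω hω
  rw [Measure.volume_eq_prod, integral_prod _ hω]
  refine integral_congr_ae (Eventually.of_forall fun x => ?_)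
  simp only [solutionIntegrand_tensor]
  rw [integral_mul_const, integral_mul_const]

open scoped ContDiff Manifold

/-! ### Density of compactly supported functions -/

section Density

variable {E : Type*} [NormedAddCommGroup E] [InnerProductSpace ℝ E] [FiniteDimensional ℝ E]

/-- A standard bump function, equal to `1` on the unit ball and supported in the ball of
radius `2`. -/
noncomputable def stdBump (E : Type*) [NormedAddCommGroup E] [InnerProductSpace ℝ E] :
    ContDiffBump (0 : E) := ⟨1, 2, one_pos, one_lt_two⟩

/-- The standard bump function, complex valued and rescaled to radius `n + 1`. -/
noncomputable def scaledBump (n : ℕ) (x : E) : ℂ := (stdBump E (((n : ℝ) + 1)⁻¹ • x) : ℝ)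

theorem contDiff_scaledBump (n : ℕ) : ContDiff ℝ ∞ (scaledBump n : E → ℂ) :=
  Complex.ofRealCLM.contDiff.comp ((stdBump E).contDiff.comp (contDiff_const_smul _))

theorem hasCompactSupport_scaledBump (n : ℕ) : HasCompactSupport (scaledBump n : E → ℂ) := by
  have h0 : ((n : ℝ) + 1)⁻¹ ≠ 0 := by positivity
  have h1 : HasCompactSupport fun x : E => stdBump E (((n : ℝ) + 1)⁻¹ • x) :=
    (stdBump E).hasCompactSupport.comp_homeomorph (Homeomorph.smulOfNeZero _ h0)
  exact h1.comp_left (g := fun r : ℝ => (r : ℂ)) Complex.ofReal_zero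

theorem scaledBump_eq_one {n : ℕ} {x : E} (hx : ‖x‖ ≤ n + 1) : scaledBump n x = 1 := by
  have h : stdBump E (((n : ℝ) + 1)⁻¹ • x) = 1 := by
    refine (stdBump E).one_of_mem_closedBall ?_
    rw [mem_closedBall_zero_iff, norm_smul, norm_inv, Real.norm_of_nonneg (by positivity)]
    exact inv_mul_le_one_of_le₀ hx (by positivity)
  rw [scaledBump, h, Complex.ofReal_one]

/-- The rescaling is precomposition with a contraction, which cannot increase derivatives; hence the
bound is uniform in `n`. -/
theorem exists_norm_iteratedFDeriv_scaledBump_le (i : ℕ) :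
    ∃ A : ℝ, 0 ≤ A ∧ ∀ (n : ℕ) (x : E), ‖iteratedFDeriv ℝ i (scaledBump n : E → ℂ) x‖ ≤ A := by
  have hs : ContDiff ℝ ∞ fun x : E => ((stdBump E x : ℝ) : ℂ) :=
    Complex.ofRealCLM.contDiff.comp (stdBump E).contDiff
  have hc : HasCompactSupport fun x : E => ((stdBump E x : ℝ) : ℂ) :=
    (stdBump E).hasCompactSupport.comp_left (g := fun r : ℝ => (r : ℂ)) Complex.ofReal_zero
  set β : 𝓢(E, ℂ) := hc.toSchwartzMap hs
  refine ⟨SchwartzMap.seminorm ℝ 0 i β, apply_nonneg _ _, fun n x => ?_⟩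
  set L : E →L[ℝ] E := ((n : ℝ) + 1)⁻¹ • ContinuousLinearMap.id ℝ E
  have e : (scaledBump n : E → ℂ) = β ∘ L := rfl
  have hL : ‖L‖ ≤ 1 := by
    refine ContinuousLinearMap.opNorm_le_bound _ zero_le_one fun y => ?_
    have h1 : ((n : ℝ) + 1)⁻¹ ≤ 1 := inv_le_one_of_one_le₀ (by linarith [n.cast_nonneg (α := ℝ)])
    simp only [L, smul_apply, ContinuousLinearMap.id_apply, norm_smul, norm_inv]
    rw [Real.norm_of_nonneg (by positivity)]
    gcongr
  rw [e, L.iteratedFDeriv_comp_right (β.smooth ⊤) x (by exact_mod_cast le_top)]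
  refine (ContinuousMultilinearMap.norm_compContinuousLinearMap_le _ _).trans ?_
  refine (mul_le_of_le_one_right (norm_nonneg _) ?_).trans
    (SchwartzMap.norm_iteratedFDeriv_le_seminorm ℝ β i (L x))
  simpa using pow_le_one₀ (norm_nonneg _) hL

/-- Truncation of a Schwartz function to a ball of radius `2 (n + 1)`. -/
noncomputable def truncate (n : ℕ) (θ : 𝓢(E, ℂ)) : 𝓢(E, ℂ) :=
  ((hasCompactSupport_scaledBump n).mul_right (f' := θ)).toSchwartzMap
    ((contDiff_scaledBump n).mul (θ.smooth ⊤))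

theorem truncate_apply (n : ℕ) (θ : 𝓢(E, ℂ)) (x : E) :
    truncate n θ x = scaledBump n x * θ x := rfl

theorem hasCompactSupport_truncate (n : ℕ) (θ : 𝓢(E, ℂ)) : HasCompactSupport (truncate n θ) :=
  (hasCompactSupport_scaledBump n).mul_right (f' := θ)

/-- The error vanishes identically where `‖x‖ < n + 1`. Elsewhere one spare power of `‖x‖` in the
seminorms of `θ` yields a factor `1/(n + 1)`. -/
theorem tendsto_truncate (θ : 𝓢(E, ℂ)) : Tendsto (fun n => truncate n θ) atTop (𝓝 θ) := by
  rw [(schwartz_withSeminorms ℝ E ℂ).tendsto_nhds]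
  rintro ⟨k, m⟩ ε hε
  choose A hA0 hA using fun i => exists_norm_iteratedFDeriv_scaledBump_le (E := E) i
  set B : ℝ := ∑ i ∈ Finset.range (m + 1), (m.choose i : ℝ) * ((A i + 1) *
    SchwartzMap.seminorm ℝ (k + 1) (m - i) θ) with hB
  have hB0 : 0 ≤ B := Finset.sum_nonneg fun i _ => by have := hA0 i; positivity
  have hlim : Tendsto (fun n : ℕ => B * ((n : ℝ) + 1)⁻¹) atTop (𝓝 0) := by
    have := (tendsto_inv_atTop_zero.comp
      (tendsto_atTop_add_const_right atTop (1 : ℝ) tendsto_natCast_atTop_atTop)).const_mul B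
    simpa using this
  filter_upwards [hlim.eventually_lt_const hε] with n hn
  refine lt_of_le_of_lt ?_ hn
  rw [schwartzSeminormFamily_apply]
  refine SchwartzMap.seminorm_le_bound ℝ k m _ (by positivity) fun x => ?_
  have e : ⇑(truncate n θ - θ) = fun x => (scaledBump n x - 1) * θ x := by
    ext x
    rw [sub_apply, truncate_apply]
    ring
  rw [e]
  have hs : ContDiff ℝ ∞ fun x : E => scaledBump n x - 1 :=
    (contDiff_scaledBump n).sub contDiff_const
  have hle := norm_iteratedFDeriv_mul_le (𝕜 := ℝ) (N := ∞) hs (θ.smooth ⊤) x (n := m)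
    (by exact_mod_cast le_top)
  rcases lt_or_ge ‖x‖ (n + 1) with hx | hx
  · have hz : (fun x : E => (scaledBump n x - 1) * θ x) =ᶠ[𝓝 x] fun _ => 0 := by
      filter_upwards [(isOpen_lt continuous_norm continuous_const).mem_nhds hx] with y hy
      rw [scaledBump_eq_one (le_of_lt hy)]
      ring
    rw [(hz.iteratedFDeriv ℝ m).eq_of_nhds]
    have : iteratedFDeriv ℝ m (fun _ : E => (0 : ℂ)) x = 0 := by simp
    rw [this, norm_zero, mul_zero]
    positivity
  · have hx0 : 0 < ‖x‖ := lt_of_lt_of_le (by positivity) hx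
    have hb : ∀ i, ‖iteratedFDeriv ℝ i (fun x : E => scaledBump n x - 1) x‖ ≤ A i + 1 := by
      intro i
      have h1 : iteratedFDeriv ℝ i (fun x : E => scaledBump n x - 1) x =
          iteratedFDeriv ℝ i (scaledBump n : E → ℂ) x -
          iteratedFDeriv ℝ i (fun _ : E => (1 : ℂ)) x :=
        iteratedFDeriv_sub_apply ((contDiff_scaledBump n).of_le
          (by exact_mod_cast le_top)).contDiffAt contDiffAt_const
      rw [h1]
      refine (norm_sub_le _ _).trans (add_le_add (hA i n x) ?_)
      rcases i with _ | i
      · simp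
      · rw [iteratedFDeriv_const_of_ne (by simp)]
        simp
    calc _ ≤ ‖x‖ ^ k * ∑ i ∈ Finset.range (m + 1), (m.choose i : ℝ) *
          ‖iteratedFDeriv ℝ i (fun x : E => scaledBump n x - 1) x‖ *
          ‖iteratedFDeriv ℝ (m - i) θ x‖ := by gcongr
      _ ≤ ‖x‖ ^ k * ∑ i ∈ Finset.range (m + 1), (m.choose i : ℝ) * (A i + 1) *
          (SchwartzMap.seminorm ℝ (k + 1) (m - i) θ * (‖x‖ ^ (k + 1))⁻¹) := by
          gcongr with i _
          · have := hA0 i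
            positivity
          · exact hb i
          · rw [← div_eq_mul_inv, le_div_iff₀ (by positivity), mul_comm]
            exact SchwartzMap.le_seminorm ℝ (k + 1) (m - i) θ x
      _ = B * ‖x‖⁻¹ := by
          rw [hB, Finset.mul_sum, Finset.sum_mul]
          refine Finset.sum_congr rfl fun i _ => ?_
          field_simp
          ring
      _ ≤ B * ((n : ℝ) + 1)⁻¹ := by gcongr

theorem eq_zero_of_forall_hasCompactSupport {T : 𝓢(E, ℂ) → ℂ} (hT : Continuous T)
    (h : ∀ θ : 𝓢(E, ℂ), HasCompactSupport θ → T θ = 0) (θ : 𝓢(E, ℂ)) : T θ = 0 :=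
  tendsto_nhds_unique ((hT.tendsto θ).comp (tendsto_truncate θ))
    (tendsto_const_nhds.congr fun n => (h _ (hasCompactSupport_truncate n θ)).symm)

/-! ### Vanishing away from the support -/

/-- The definition of the support gives only local vanishing. Compactness reduces to finitely many
open sets, and a smooth partition of unity splits `θ` into pieces carried by them. -/
theorem eq_zero_of_tsupport_disjoint_dsupport (p : 𝓢'(E, ℂ)) {θ : 𝓢(E, ℂ)}
    (hc : HasCompactSupport θ) (hd : tsupport θ ⊆ (Distribution.dsupport p)ᶜ) : p θ = 0 := by
  have hU : ∀ x : tsupport θ, ∃ U : Set E, Distribution.IsVanishingOn p U ∧ IsOpen U ∧ (x : E) ∈ U :=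
    fun x => (Distribution.notMem_dsupport_iff (x : E)).1 (hd x.2)
  choose U hUv hUo hxU using hU
  obtain ⟨t, ht⟩ := hc.isCompact.elim_finite_subcover U hUo
    fun x hx => mem_iUnion.2 ⟨⟨x, hx⟩, hxU _⟩
  have ht' : tsupport θ ⊆ ⋃ i : t, U i := by
    intro x hx
    obtain ⟨i, hi, hxi⟩ := mem_iUnion₂.1 (ht hx)
    exact mem_iUnion.2 ⟨⟨i, hi⟩, hxi⟩
  obtain ⟨f, hf⟩ := SmoothPartitionOfUnity.exists_isSubordinate 𝓘(ℝ, E) (isClosed_tsupport θ)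
    (fun i : t => U i) (fun i => hUo i) ht'
  have hfs : ∀ i : t, ContDiff ℝ ∞ fun x => ((f i x : ℝ) : ℂ) := fun i =>
    Complex.ofRealCLM.contDiff.comp (f i).contMDiff.contDiff
  set θi : t → 𝓢(E, ℂ) := fun i => (hc.mul_left (f := fun x => ((f i x : ℝ) : ℂ))).toSchwartzMap
    ((hfs i).mul (θ.smooth ⊤))
  have hθi : ∀ i x, θi i x = (f i x : ℝ) * θ x := fun i x => rfl
  have hsum : θ = ∑ i : t, θi i := by
    ext x
    rw [sum_apply]
    simp only [hθi]
    rw [← Finset.sum_mul]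
    by_cases hx : x ∈ tsupport θ
    · have := f.sum_eq_one hx
      rw [finsum_eq_sum_of_fintype] at this
      rw [← Complex.ofReal_sum, this, Complex.ofReal_one, one_mul]
    · rw [image_eq_zero_of_notMem_tsupport hx, mul_zero]
  rw [hsum, map_sum]
  refine Finset.sum_eq_zero fun i _ => hUv i _ ?_
  refine (closure_mono fun x hx => ?_ : tsupport (θi i) ⊆ tsupport (f i)).trans (hf i)
  rw [Function.mem_support, hθi] at hx
  exact fun h0 => hx (by rw [h0, Complex.ofReal_zero, zero_mul])

end Density

/-- The gap between `-1` and `0` keeps the closed support of `θ` off the support of `p`. Truncation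
supplies the compactness needed for the local argument. -/
theorem eq_zero_of_eq_zero_of_lt {p : 𝓢'(SpaceTime, ℂ)}
    (hp : Distribution.dsupport p ⊆ {z : SpaceTime | 0 ≤ z.fst}) {θ : 𝓢(SpaceTime, ℂ)}
    (hθ : ∀ z : SpaceTime, -1 < z.fst → θ z = 0) : p θ = 0 := by
  have h : ∀ n, p (truncate n θ) = 0 := by
    intro n
    refine eq_zero_of_tsupport_disjoint_dsupport p (hasCompactSupport_truncate n θ) ?_
    have hcl : IsClosed {z : SpaceTime | z.fst ≤ -1} :=
      isClosed_le (WithLp.fstL 2 ℝ ℝ Space).continuous continuous_const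
    have hsub : tsupport (truncate n θ) ⊆ {z : SpaceTime | z.fst ≤ -1} := by
      refine closure_minimal (fun z hz => ?_) hcl
      by_contra hlt
      exact hz (by rw [truncate_apply, hθ z (not_le.1 hlt), mul_zero])
    intro z hz hmem
    have h1 : z.fst ≤ -1 := hsub hz
    have h2 : 0 ≤ z.fst := hp hmem
    linarith
  have hpc : Continuous fun θ => p θ := p.continuous
  exact tendsto_nhds_unique ((hpc.tendsto θ).comp (tendsto_truncate θ))
    (tendsto_const_nhds.congr fun n => (h n).symm)

/-! ### Exponential weights -/

/-- A smooth cutoff function: `0` for `t ≤ -2` and `1` for `t ≥ -1`. -/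
noncomputable def timeCutoff (t : ℝ) : ℝ := Real.smoothTransition (t + 2)

theorem contDiff_timeCutoff : ContDiff ℝ ∞ timeCutoff :=
  Real.smoothTransition.contDiff.comp (contDiff_id.add contDiff_const)

theorem timeCutoff_eq_zero {t : ℝ} (ht : t ≤ -2) : timeCutoff t = 0 :=
  Real.smoothTransition.zero_of_nonpos (by linarith)

theorem timeCutoff_eq_one {t : ℝ} (ht : -1 ≤ t) : timeCutoff t = 1 :=
  Real.smoothTransition.one_of_one_le (by linarith)

/-- The weight `t ↦ χ(t) e^{-at}` with the cutoff function `χ`. -/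
noncomputable def weight (a : ℝ) (t : ℝ) : ℂ := timeCutoff t * Complex.exp (-(a * t))

theorem contDiff_exp_neg_mul (a : ℝ) : ContDiff ℝ ∞ fun t : ℝ => Complex.exp (-(a * t)) := by
  have h : ContDiff ℝ ∞ fun t : ℝ => (t : ℂ) := Complex.ofRealCLM.contDiff
  exact ((contDiff_const.mul h).neg).cexp

theorem contDiff_weight (a : ℝ) : ContDiff ℝ ∞ (weight a) :=
  (Complex.ofRealCLM.contDiff.comp contDiff_timeCutoff).mul (contDiff_exp_neg_mul a)

theorem norm_weight_le {a : ℝ} (ha : 0 ≤ a) (t : ℝ) : ‖weight a t‖ ≤ Real.exp (2 * a) := by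
  rcases le_or_gt t (-2) with h | h
  -- For `t ≤ -2` the cutoff vanishes. Beyond that point `e^{-at}` is at most `e^{2a}`.
  · simp [weight, timeCutoff_eq_zero h, Real.exp_nonneg]
  · rw [weight, norm_mul, Complex.norm_real, Complex.norm_exp,
      Real.norm_of_nonneg (show 0 ≤ timeCutoff t from Real.smoothTransition.nonneg _)]
    refine (mul_le_of_le_one_left (Real.exp_nonneg _) (Real.smoothTransition.le_one _)).trans ?_
    rw [Real.exp_le_exp]
    simp
    nlinarith

/-- The part of the derivative of the weight coming from the cutoff function. -/
noncomputable def weightRemainder (a : ℝ) (t : ℝ) : ℂ :=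
  (deriv timeCutoff t : ℝ) * Complex.exp (-(a * t))

theorem contDiff_weightRemainder (a : ℝ) : ContDiff ℝ ∞ (weightRemainder a) := by
  have h : ContDiff ℝ ∞ (deriv timeCutoff) := (contDiff_infty_iff_deriv.1 contDiff_timeCutoff).2
  exact (Complex.ofRealCLM.contDiff.comp h).mul (contDiff_exp_neg_mul a)

theorem hasCompactSupport_weightRemainder (a : ℝ) : HasCompactSupport (weightRemainder a) := by
  refine HasCompactSupport.intro (isCompact_Icc (a := (-2 : ℝ)) (b := -1)) fun t ht => ?_
  have h : deriv timeCutoff t = 0 := by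
    rcases lt_or_ge t (-2) with h | h
    · have : timeCutoff =ᶠ[𝓝 t] fun _ => 0 := by
        filter_upwards [gt_mem_nhds h] with s hs using timeCutoff_eq_zero (le_of_lt hs)
      rw [this.deriv_eq]
      simp
    · have h1 : -1 < t := by
        by_contra h1
        exact ht ⟨h, not_lt.1 h1⟩
      have : timeCutoff =ᶠ[𝓝 t] fun _ => 1 := by
        filter_upwards [lt_mem_nhds h1] with s hs using timeCutoff_eq_one (le_of_lt hs)
      rw [this.deriv_eq]
      simp
  simp [weightRemainder, h]

theorem deriv_weight (a : ℝ) : deriv (weight a) = fun t => -a * weight a t + weightRemainder a t := by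
  ext t
  have h1 : HasDerivAt (fun t => (timeCutoff t : ℂ)) (deriv timeCutoff t : ℝ) t :=
    ((contDiff_timeCutoff.differentiable (by simp)) t).hasDerivAt.ofReal_comp
  have h2 : HasDerivAt (fun t : ℝ => -((a : ℂ) * t)) (-((a : ℂ) * 1)) t :=
    ((Complex.ofRealCLM.hasDerivAt (x := t)).const_mul (a : ℂ)).neg
  refine (h1.mul h2.cexp).deriv.trans ?_
  simp only [weight, weightRemainder]
  ring

/-- Differentiating the weight reproduces `-a` times itself plus a smooth function of compact
support, so boundedness of all derivatives follows by induction. -/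
theorem exists_norm_iteratedDeriv_weight_le {a : ℝ} (ha : 0 ≤ a) (n : ℕ) :
    ∃ C : ℝ, ∀ t, ‖iteratedDeriv n (weight a) t‖ ≤ C := by
  induction n with
  | zero => exact ⟨Real.exp (2 * a), fun t => by simpa using norm_weight_le ha t⟩
  | succ n ih =>
    obtain ⟨C, hC⟩ := ih
    set R : 𝓢(ℝ, ℂ) := (hasCompactSupport_weightRemainder a).toSchwartzMap
      (contDiff_weightRemainder a)
    refine ⟨a * C + SchwartzMap.seminorm ℝ 0 n R, fun t => ?_⟩
    have hn : ((n : ℕ∞) : WithTop ℕ∞) ≤ ∞ := by exact_mod_cast le_top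
    have hw : ContDiffAt ℝ n (weight a) t := ((contDiff_weight a).of_le hn).contDiffAt
    have hr : ContDiffAt ℝ n (weightRemainder a) t :=
      ((contDiff_weightRemainder a).of_le hn).contDiffAt
    rw [iteratedDeriv_succ', deriv_weight, iteratedDeriv_fun_add (contDiffAt_const.mul hw) hr,
      iteratedDeriv_const_mul_field]
    refine (norm_add_le _ _).trans (add_le_add ?_ ?_)
    · rw [norm_mul, norm_neg, Complex.norm_real, Real.norm_of_nonneg ha]
      exact mul_le_mul_of_nonneg_left (hC t) ha
    · have := SchwartzMap.norm_iteratedFDeriv_le_seminorm ℝ R n t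
      rwa [norm_iteratedFDeriv_eq_norm_iteratedDeriv] at this

theorem hasTemperateGrowth_weight {a : ℝ} (ha : 0 ≤ a) : (weight a).HasTemperateGrowth := by
  refine ⟨contDiff_weight a, fun n => ?_⟩
  obtain ⟨C, hC⟩ := exists_norm_iteratedDeriv_weight_le ha n
  refine ⟨0, C, fun t => ?_⟩
  rw [norm_iteratedFDeriv_eq_norm_iteratedDeriv, pow_zero, mul_one]
  exact hC t

theorem hasTemperateGrowth_weight_fst {a : ℝ} (ha : 0 ≤ a) :
    (fun z : SpaceTime => weight a z.fst).HasTemperateGrowth :=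
  (hasTemperateGrowth_weight ha).comp (WithLp.fstL 2 ℝ ℝ Space).hasTemperateGrowth

/-- Multiplication by the weight `χ(t) e^{-at}` on Schwartz functions on space-time. -/
noncomputable def weightCLM (a : ℝ) : 𝓢(SpaceTime, ℂ) →L[ℂ] 𝓢(SpaceTime, ℂ) :=
  SchwartzMap.smulLeftCLM ℂ fun z : SpaceTime => weight a z.fst

theorem weightCLM_apply {a : ℝ} (ha : 0 ≤ a) (θ : 𝓢(SpaceTime, ℂ)) (z : SpaceTime) :
    weightCLM a θ z = weight a z.fst * θ z := by
  rw [weightCLM, SchwartzMap.smulLeftCLM_apply_apply (hasTemperateGrowth_weight_fst ha), smul_eq_mul]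

theorem weight_eq {a t : ℝ} (ht : -1 ≤ t) : weight a t = Complex.exp (-(a * t)) := by
  rw [weight, timeCutoff_eq_one ht, Complex.ofReal_one, one_mul]

theorem lineDeriv_weightCLM {a : ℝ} (ha : 0 ≤ a) (θ : 𝓢(SpaceTime, ℂ)) (v : Space) :
    ∂_{event 0 v} (weightCLM a θ) = weightCLM a (∂_{event 0 v} θ) := by
  ext z
  rw [weightCLM_apply ha, SchwartzMap.lineDerivOp_apply, SchwartzMap.lineDerivOp_apply, lineDeriv,
    lineDeriv]
  simp only [weightCLM_apply ha]
  simp [event, deriv_const_mul_field]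

theorem spaceLaplacian_weightCLM {a : ℝ} (ha : 0 ≤ a) (θ : 𝓢(SpaceTime, ℂ)) :
    spaceLaplacian (weightCLM a θ) = weightCLM a (spaceLaplacian θ) := by
  simp only [spaceLaplacian, lineDeriv_weightCLM ha, map_sum]

/-! ### Uniqueness -/

theorem fourier_spaceLaplacian (θ : 𝓢(SpaceTime, ℂ)) (ζ : SpaceTime) :
    𝓕 (spaceLaplacian θ) ζ = -((2 * Real.pi * ‖ζ.snd‖ : ℝ) : ℂ) ^ 2 * 𝓕 θ ζ := by
  have h : ∀ (η : 𝓢(SpaceTime, ℂ)) (v : Space), 𝓕 (∂_{event 0 v} η) ζ =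
      2 * Real.pi * Complex.I * (inner ℝ ζ.snd v : ℝ) * 𝓕 η ζ := by
    intro η v
    rw [fourier_lineDerivOp_eq, smul_apply, SchwartzMap.smulLeftCLM_apply_apply (by fun_prop),
      ← event_fst_snd ζ, inner_event, mul_zero, zero_add, event_snd, Complex.real_smul, smul_eq_mul]
    ring
  have h1 : 𝓕 (spaceLaplacian θ) ζ = ∑ i : Fin 3, 𝓕 (∂_{event 0 (EuclideanSpace.single i 1)}
      (∂_{event 0 (EuclideanSpace.single i 1)} θ)) ζ := by
    simp only [spaceLaplacian, Fin.sum_univ_three, FourierTransform.fourier_add, add_apply]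
  have h2 : ((‖ζ.snd‖ : ℝ) : ℂ) ^ 2 = (ζ.snd 0 : ℂ) ^ 2 + (ζ.snd 1 : ℂ) ^ 2 + (ζ.snd 2 : ℂ) ^ 2 := by
    have := EuclideanSpace.norm_sq_eq (𝕜 := ℝ) ζ.snd
    rw [Fin.sum_univ_three] at this
    simp only [Real.norm_eq_abs, sq_abs] at this
    exact_mod_cast this
  rw [h1]
  simp only [h, Fin.sum_univ_three, EuclideanSpace.inner_single_right, one_mul,
    conj_trivial]
  push_cast
  rw [mul_pow, h2]
  ring_nf
  rw [Complex.I_sq]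
  ring

/-- The symbol of the attenuated wave operator, at frequencies shifted into the upper half plane. -/
noncomputable def shiftedSymbol (κt : ℂ → ℂ) (ζ : SpaceTime) : ℂ :=
  κt ((2 * Real.pi * ζ.fst : ℝ) + Complex.I) ^ 2

/-- The shifted frequencies stay on the line `Im z = 1`, inside the domain of holomorphy. -/
theorem contDiff_shiftedSymbol {κ : ℝ → ℂ} {κt : ℂ → ℂ} (h : IsHolomorphicContinuation κ κt) :
    ContDiff ℝ ∞ (shiftedSymbol κt) := by
  have hU : IsOpen {z : ℂ | 0 < z.im} := isOpen_lt continuous_const Complex.continuous_im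
  have h1 : ContDiffOn ℝ ∞ κt {z : ℂ | 0 < z.im} :=
    (h.differentiableOn.contDiffOn hU).restrict_scalars ℝ
  have h2 : ContDiff ℝ ∞ fun ζ : SpaceTime => ((2 * Real.pi * ζ.fst : ℝ) : ℂ) + Complex.I :=
    (Complex.ofRealCLM.contDiff.comp
      (contDiff_const.mul (WithLp.fstL 2 ℝ ℝ Space).contDiff)).add contDiff_const
  exact (h1.comp_contDiff h2 fun ζ => by simp).pow 2

/-- The difference of squares factors, and both factors have the imaginary part of `κt`, which is
positive off the real axis. -/
theorem shiftedSymbol_sub_ne_zero {κ : ℝ → ℂ} (hκ : IsAttenuationCoefficient κ) {κt : ℂ → ℂ}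
    (h : IsHolomorphicContinuation κ κt) (ζ : SpaceTime) (r : ℝ) :
    shiftedSymbol κt ζ - (r : ℂ) ^ 2 ≠ 0 := by
  have him := hκ.im_pos h (z := (2 * Real.pi * ζ.fst : ℝ) + Complex.I) (by simp)
  rw [shiftedSymbol, sq_sub_sq]
  refine mul_ne_zero (fun h0 => ?_) (fun h0 => ?_)
  · have := congrArg Complex.im h0
    simp only [Complex.add_im, Complex.ofReal_im, Complex.zero_im, add_zero] at this
    linarith
  · have := congrArg Complex.im h0
    simp only [Complex.sub_im, Complex.ofReal_im, Complex.zero_im, sub_zero] at this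
    linarith

/-- The conjugated attenuation operator. -/
theorem attenuationTest_weightCLM {κ : ℝ → ℂ} (hκ : IsAttenuationCoefficient κ) {κt : ℂ → ℂ}
    (h : IsHolomorphicContinuation κ κt) {η η₂ : 𝓢(SpaceTime, ℂ)}
    (h2 : ∀ ζ, 𝓕 η₂ ζ = shiftedSymbol κt ζ * 𝓕 η ζ) {z : SpaceTime} (hz : -1 < z.fst) :
    attenuationTest κ (weightCLM 1 η) z = weightCLM 1 η₂ z := by
  have e1 : attenuationTest κ (weightCLM 1 η) z =
      timeMultiplier κ (timeSlice z.snd (weightCLM 1 η)) z.fst := by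
    rw [← timeSlice_attenuationTest hκ.hasTemperateGrowth, timeSlice_apply, event_fst_snd]
  -- The weight with `a = 0` is the bare cutoff, so `F` is the cut off slice of `η`, and `f` is
  -- `e^{-t}F`. The value `b = -2` is where the cutoff starts.
  rw [e1, timeMultiplier_cutoff hκ.hasTemperateGrowth h (φ := timeSlice z.snd η)
    (φ₂ := timeSlice z.snd η₂) (F := timeSlice z.snd (weightCLM 0 η)) (b := -2) ?_ ?_ ?_ ?_ hz,
    weightCLM_apply zero_le_one, weight_eq hz.le, timeSlice_apply, event_fst_snd]
  · simp
  · intro s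
    have h3 := fourier_timeSlice_of_mul (θ := η) (θ₂ := η₂)
      (m := fun s => κt ((2 * Real.pi * s : ℝ) + Complex.I) ^ 2) (fun s ξ => h2 (event s ξ))
      z.snd (s / (2 * Real.pi))
    rw [fourierLaplace_eq_fourier, fourierLaplace_eq_fourier, h3, mul_div_cancel₀ _ (by positivity)]
  · intro t
    simp only [timeSlice_apply, weightCLM_apply zero_le_one, weightCLM_apply le_rfl, weight,
      event_fst]
    rw [← mul_assoc, mul_left_comm, ← Complex.exp_add]
    congr 3
    simp
  · intro t ht
    simp [weightCLM_apply zero_le_one, weight, timeCutoff_eq_zero ht.le]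
  · intro t ht
    simp [weightCLM_apply le_rfl, weight_eq ht.le]

/-- Division by the shifted symbol on the Fourier side. With `g` of compact support, smoothness and
the absence of zeros make the quotient Schwartz; no quantitative lower bound on the symbol is
needed. -/
theorem exists_preimage {κ : ℝ → ℂ} (hκ : IsAttenuationCoefficient κ) {κt : ℂ → ℂ}
    (h : IsHolomorphicContinuation κ κt) {g : 𝓢(SpaceTime, ℂ)} (hg : HasCompactSupport g) :
    ∃ η η₂ : 𝓢(SpaceTime, ℂ), (∀ ζ, 𝓕 η₂ ζ = shiftedSymbol κt ζ * 𝓕 η ζ) ∧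
      η₂ + spaceLaplacian η = 𝓕⁻ g := by
  have hsm := contDiff_shiftedSymbol h
  have hnorm : ContDiff ℝ ∞ fun ζ : SpaceTime => ((2 * Real.pi * ‖ζ.snd‖ : ℝ) : ℂ) ^ 2 := by
    have e : (fun ζ : SpaceTime => ((2 * Real.pi * ‖ζ.snd‖ : ℝ) : ℂ) ^ 2) =
        fun ζ : SpaceTime => (((2 * Real.pi) ^ 2 * ‖ζ.snd‖ ^ 2 : ℝ) : ℂ) := by
      ext ζ
      push_cast
      ring
    rw [e]
    exact Complex.ofRealCLM.contDiff.comp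
      (contDiff_const.mul ((WithLp.sndL 2 ℝ ℝ Space).contDiff.norm_sq ℝ))
  have hne := fun ζ : SpaceTime => shiftedSymbol_sub_ne_zero hκ h ζ (2 * Real.pi * ‖ζ.snd‖)
  have hG : ContDiff ℝ ∞ fun ζ : SpaceTime =>
      (shiftedSymbol κt ζ - ((2 * Real.pi * ‖ζ.snd‖ : ℝ) : ℂ) ^ 2)⁻¹ * g ζ :=
    ((hsm.sub hnorm).inv hne).mul (g.smooth ⊤)
  set G : 𝓢(SpaceTime, ℂ) := (hg.mul_left (f := fun ζ : SpaceTime =>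
    (shiftedSymbol κt ζ - ((2 * Real.pi * ‖ζ.snd‖ : ℝ) : ℂ) ^ 2)⁻¹)).toSchwartzMap hG with hGdef
  have hGa : ∀ ζ, G ζ = (shiftedSymbol κt ζ - ((2 * Real.pi * ‖ζ.snd‖ : ℝ) : ℂ) ^ 2)⁻¹ * g ζ :=
    fun ζ => rfl
  have hGc : HasCompactSupport G := hg.mul_left
  set G₂ : 𝓢(SpaceTime, ℂ) := (hGc.mul_left (f := shiftedSymbol κt)).toSchwartzMap
    (hsm.mul (G.smooth ⊤))
  have hG₂a : ∀ ζ, G₂ ζ = shiftedSymbol κt ζ * G ζ := fun ζ => rfl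
  refine ⟨𝓕⁻ G, 𝓕⁻ G₂, fun ζ => ?_, ?_⟩
  · rw [FourierTransform.fourier_fourierInv_eq, FourierTransform.fourier_fourierInv_eq, hG₂a]
  · have key : 𝓕 (𝓕⁻ G₂ + spaceLaplacian (𝓕⁻ G)) = g := by
      ext ζ
      rw [FourierTransform.fourier_add, add_apply, fourier_spaceLaplacian,
        FourierTransform.fourier_fourierInv_eq, FourierTransform.fourier_fourierInv_eq, hG₂a, hGa]
      have := hne ζ
      field_simp
      ring
    rw [← key, FourierTransform.fourierInv_fourier_eq]

/-- The range of the transposed operator contains, up to changes that `q` ignores, all weighted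
inverse transforms of compactly supported functions. Density first removes the restriction on the
Fourier side, then the weight is undone. -/
theorem eq_zero_of_homogeneous {κ : ℝ → ℂ} (hκ : IsAttenuationCoefficient κ)
    {q : 𝓢'(SpaceTime, ℂ)}
    (hloc : ∀ θ : 𝓢(SpaceTime, ℂ), (∀ z : SpaceTime, -1 < z.fst → θ z = 0) → q θ = 0)
    (heq : ∀ θ : 𝓢(SpaceTime, ℂ), q (attenuationTest κ θ + spaceLaplacian θ) = 0) : q = 0 := by
  obtain ⟨κt, hκt⟩ := hκ.holomorphic
  have hqc : Continuous fun θ => q θ := q.continuous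
  have hcongr : ∀ θ θ' : 𝓢(SpaceTime, ℂ), (∀ z : SpaceTime, -1 < z.fst → θ z = θ' z) →
      q θ = q θ' := by
    intro θ θ' hθ
    rw [← sub_eq_zero, ← map_sub]
    refine hloc _ fun z hz => ?_
    rw [sub_apply, hθ z hz, sub_self]
  have h1 : ∀ g : 𝓢(SpaceTime, ℂ), HasCompactSupport g → q (weightCLM 1 (𝓕⁻ g)) = 0 := by
    intro g hg
    obtain ⟨η, η₂, h2, h3⟩ := exists_preimage hκ hκt hg
    rw [← heq (weightCLM 1 η), ← h3]
    refine hcongr _ _ fun z hz => ?_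
    rw [add_apply, attenuationTest_weightCLM hκ hκt h2 hz, spaceLaplacian_weightCLM zero_le_one,
      map_add, add_apply]
  have hFc : Continuous fun g : 𝓢(SpaceTime, ℂ) => 𝓕⁻ g :=
    (FourierTransform.fourierInvCLM ℂ 𝓢(SpaceTime, ℂ)).continuous
  have h2 : ∀ θ : 𝓢(SpaceTime, ℂ), q (weightCLM 1 θ) = 0 := by
    intro θ
    have := eq_zero_of_forall_hasCompactSupport
      (hqc.comp ((weightCLM 1).continuous.comp hFc)) h1 (𝓕 θ)
    simpa only [Function.comp_apply, FourierTransform.fourierInv_fourier_eq] using this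
  ext θ
  refine eq_zero_of_forall_hasCompactSupport hqc (fun θ hθ => ?_) θ
  have hexp : ContDiff ℝ ∞ fun z : SpaceTime => Complex.exp (z.fst : ℝ) :=
    (Complex.ofRealCLM.contDiff.comp (WithLp.fstL 2 ℝ ℝ Space).contDiff).cexp
  -- A compactly supported `θ` can be multiplied by `e^t` without leaving the Schwartz space.
  -- Weighting the product returns `θ` for `t > -1`, which is all that `q` sees.
  rw [← h2 ((hθ.mul_left (f := fun z : SpaceTime => Complex.exp (z.fst : ℝ))).toSchwartzMap
    (hexp.mul (θ.smooth ⊤)))]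
  refine hcongr _ _ fun z hz => ?_
  rw [weightCLM_apply zero_le_one, weight_eq hz.le, HasCompactSupport.toSchwartzMap_toFun,
    Pi.mul_apply, ← mul_assoc, ← Complex.exp_add]
  simp

theorem IsCausalSolution.unique {κ : ℝ → ℂ} (hκ : IsAttenuationCoefficient κ) {h : Space → ℂ}
    {p p' : 𝓢'(SpaceTime, ℂ)} (hp : IsCausalSolution κ h p) (hp' : IsCausalSolution κ h p') :
    p = p' := by
  rw [← sub_eq_zero]
  refine eq_zero_of_homogeneous hκ (fun θ hθ => ?_) (fun θ => ?_)
  · rw [sub_apply, eq_zero_of_eq_zero_of_lt hp.support hθ,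
      eq_zero_of_eq_zero_of_lt hp'.support hθ, sub_zero]
  · have h1 := hp.equation θ
    have h2 := hp'.equation θ
    rw [attenuationOp_apply, spatialLaplacian_apply] at h1 h2
    rw [sub_apply, map_add, map_add]
    linear_combination h2 - h1

end AttWave

/-! ### Existence, uniqueness and the Green representation -/

theorem mainTheorem6 (κ : ℝ → ℂ) (hκ : AttWave.IsAttenuationCoefficient κ)
    (h : AttWave.Space → ℂ) (hL2 : MemLp h 2 volume)
    (hsupp : ∃ K : Set AttWave.Space, IsCompact K ∧ ∀ᵐ x, x ∉ K → h x = 0) :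
    (∃! p : 𝓢'(AttWave.SpaceTime, ℂ), AttWave.IsCausalSolution κ h p) ∧
    ∀ p : 𝓢'(AttWave.SpaceTime, ℂ), AttWave.IsCausalSolution κ h p →
      ∀ (φ : 𝓢(ℝ, ℂ)) (ψ : 𝓢(AttWave.Space, ℂ)),
        Integrable (fun q : ℝ × AttWave.Space × AttWave.Space =>
          AttWave.greenKernel κ q.1 (q.2.1 - q.2.2) * h q.2.2 *
            AttWave.timeFourier φ q.1 * ψ q.2.1) ∧
        p (AttWave.tensor φ ψ) =
          ∫ ω : ℝ, ∫ x : AttWave.Space, (∫ y : AttWave.Space,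
            AttWave.greenKernel κ ω (x - y) * h y) * AttWave.timeFourier φ ω * ψ x := by
  obtain ⟨K, hK, hzero⟩ := hsupp
  have hh := AttWave.integrable_of_memLp_of_compact hL2 hK hzero
  have hsol := AttWave.isCausalSolution_solution hκ hh
  refine ⟨⟨_, hsol, fun p hp => hp.unique hκ hsol⟩, fun p hp φ ψ => ?_⟩
  rw [hp.unique hκ hsol]
  exact AttWave.solution_tensor hκ hh φ ψ
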